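/- **Setting.** Let $N_*$ be the Lazard ring of formal group laws of order two (commutative one-dimensional formal group laws $F$ with $F(x,x)=0$; then $2=0$), and let $F$ denote the universal one and its image in any commutative $N_*$-algebra. Let $\mathcal B_*=\mathbf Z_2[h_0^{\pm1},h_1,h_2,\dots]$ be the Faà di Bruno Hopf algebra, with $h(x)=\sum_n h_nx^{n+1}$, diagonal $\delta(h)=(h\otimes1)\circ(1\otimes h)$ and counit $\varepsilon(h)=x$; it coacts on $N_*$ by the ring homomorphism $\varphi:N_*\to\mathcal B_*\otimes N_*$ with $\varphi(F)(x,y)=h(F(h^{-1}(x),h^{-1}(y)))$. All tensor products are over $\mathbf Z_2$. A *Landweber–Novikov coaction* on an $N_*$-module $M$ is a left $\mathcal B_*$-comodule structure $\varphi:M\to\mathcal B_*\otimes M$ such that $N_*\otimes M\to M$ is a map of comodules. A *D-ring* is a commutative $N_*$-algebra $R$ with a ring homomorphism $D_t:R\to R[[t]]$ such that (a) $D_0(a)=a^2$; (b) $D_t(F)=F_t$, where $F_t$ is the formal group law for which $xF(x,t)$ is a homomorphism $F\to F_t$, that is, $D_t(F)(xF(x,t),yF(y,t))=F(x,y)\,F(F(x,y),t)$;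 (c) $D_sD_t(a)$ is symmetric in $s$ and $t$, where $D_s$ is extended to $R[[t]]$ by $D_s(t)=tF(t,s)$. The *free D-ring* $D\langle M\rangle$ on an $N_*$-module $M$ is the D-ring with an $N_*$-linear map $M\to D\langle M\rangle$ through which every $N_*$-linear map from $M$ to a D-ring factors by a unique homomorphism of D-rings. If $R$ is a D-ring, give $\mathcal B_*\otimes R$ the D-structure (with the formal group law of $R$) that extends that of $R$ and satisfies $D_t(h)(xF(x,t))=h(x)\,h(F(x,t))$. For a D-ring $R$ with a Landweber–Novikov coaction $\varphi$, the *Nishida relations* are $D_t(\varphi(a))=\varphi(D_t(a))$ in $(\mathcal B_*\otimes R)[[t]]$ for all $a\in R$, where $\varphi$ is extended to $R[[t]]$ by $\varphi(t)=h(t)$. **Theorem 3.** Let $M$ be an $N_*$-module with a Landweber–Novikov coaction. Then there is a unique Landweber–Novikov coaction on $D\langle M\rangle$ such that 1. the canonical map $M\to D\langle M\rangle$ is a map of comodules; 2. $D\langle M\rangle$ is an algebra over its coaction, that is, its unit and multiplication are maps of comodules: $\varphi(1)=1$ and $\varphi(ab)=\varphi(a)\varphi(b)$; 3. the Nishida relations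 hold for $D\langle M\rangle$. In particular, on the free D-ring $D\langle x\rangle$ on one generator there is a unique Landweber–Novikov coaction that satisfies (2), (3) and $\varphi(x)=1\otimes x$. (Through the known identification $N_*(B\Sigma_*)=D\langle x\rangle$, which is not part of this statement, this determines the coaction on $N_*(B\Sigma_*)$.) -/

import Mathlib

open scoped TensorProduct

universe u

noncomputable section

/-! ### Formal group laws of order two and their Lazard ring -/

namespace FormalGroup

/-- A formal group law of order two: it is commutative and `F(x, x) = 0`. -/
structure IsOrderTwo {R : Type*} [CommRing R] (F : FormalGroup R) : Prop where
  comm : F.toPowerSeries.subst ![MvPowerSeries.X 1, MvPowerSeries.X 0] = F.toPowerSeries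
  self_add : F.toPowerSeries.subst ![PowerSeries.X, PowerSeries.X] = (0 : PowerSeries R)

/-- `F(u, v)` for power series `u`, `v` in any variables. -/
def eval₂ {R : Type*} [CommRing R] (F : FormalGroup R) {τ : Type*} (u v : MvPowerSeries τ R) :
    MvPowerSeries τ R :=
  F.toPowerSeries.subst ![u, v]

end FormalGroup

namespace LazardTwo

/-- The indeterminates: the coefficients `a_{ij}` with `i + j ≥ 2` of a formal group law. -/
abbrev Index : Type := {n : Fin 2 →₀ ℕ // 2 ≤ n.degree}

/-- The generic series `x + y + ∑_{i+j≥2} a_{ij} x^i y^j`. -/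
def generic : MvPowerSeries (Fin 2) (MvPolynomial Index (ZMod 2)) := fun n =>
  if h : 2 ≤ n.degree then MvPolynomial.X ⟨n, h⟩ else if n = 0 then 0 else 1

/-- The difference of the two sides of the associativity axiom. -/
def assocDefect : MvPowerSeries (Fin 3) (MvPolynomial Index (ZMod 2)) :=
  generic.subst ![generic.subst ![MvPowerSeries.X 0, MvPowerSeries.X 1], MvPowerSeries.X 2] -
    generic.subst ![MvPowerSeries.X 0, generic.subst ![MvPowerSeries.X 1, MvPowerSeries.X 2]]

/-- The difference of the two sides of the commutativity axiom. -/
def commDefect : MvPowerSeries (Fin 2) (MvPolynomial Index (ZMod 2)) :=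
  generic.subst ![MvPowerSeries.X 1, MvPowerSeries.X 0] - generic

/-- The series `F(x, x)`. -/
def selfDefect : PowerSeries (MvPolynomial Index (ZMod 2)) :=
  generic.subst ![PowerSeries.X, PowerSeries.X]

/-- The ideal generated by the coefficients of the axioms. -/
def relations : Ideal (MvPolynomial Index (ZMod 2)) :=
  Ideal.span (Set.range (fun n => MvPowerSeries.coeff n assocDefect) ∪
    Set.range (fun n => MvPowerSeries.coeff n commDefect) ∪
    Set.range (fun n => PowerSeries.coeff n selfDefect))

end LazardTwo

/-- The Lazard ring `N_*` of formal group laws of order two. -/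
def LazardTwo : Type := MvPolynomial LazardTwo.Index (ZMod 2) ⧸ LazardTwo.relations

namespace LazardTwo

instance : CommRing LazardTwo :=
  inferInstanceAs (CommRing (MvPolynomial Index (ZMod 2) ⧸ relations))

instance : Algebra (ZMod 2) LazardTwo :=
  inferInstanceAs (Algebra (ZMod 2) (MvPolynomial Index (ZMod 2) ⧸ relations))

/-- The quotient map. -/
def mk : MvPolynomial Index (ZMod 2) →ₐ[ZMod 2] LazardTwo :=
  Ideal.Quotient.mkₐ (ZMod 2) relations

theorem mk_eq_zero {p : MvPolynomial Index (ZMod 2)} (hp : p ∈ relations) : mk p = 0 :=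
  Ideal.Quotient.eq_zero_iff_mem.mpr hp

theorem constantCoeff_generic : MvPowerSeries.constantCoeff generic = 0 := by
  change generic 0 = 0
  simp [generic]

theorem map_vec {R S : Type*} [CommRing R] [CommRing S] {τ : Type*} (f : R →+* S)
    (a b : MvPowerSeries τ R) :
    (fun i => MvPowerSeries.map f (![a, b] i)) =
      ![MvPowerSeries.map f a, MvPowerSeries.map f b] := by
  funext i; fin_cases i <;> rfl

theorem map_assocDefect {A : Type*} [CommRing A] (f : MvPolynomial Index (ZMod 2) →+* A) :
    MvPowerSeries.map f assocDefect =
      (generic.map f).subst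
        ![(generic.map f).subst ![MvPowerSeries.X 0, MvPowerSeries.X 1], MvPowerSeries.X 2] -
      (generic.map f).subst
        ![MvPowerSeries.X 0, (generic.map f).subst ![MvPowerSeries.X 1, MvPowerSeries.X 2]] := by
  rw [assocDefect, map_sub,
    MvPowerSeries.map_subst (MvPowerSeries.HasSubst.cons_subst_zero_left _ _ _
      constantCoeff_generic),
    MvPowerSeries.map_subst (MvPowerSeries.HasSubst.cons_subst_zero_right _ _ _
      constantCoeff_generic), map_vec, map_vec,
    MvPowerSeries.map_subst .X_X, MvPowerSeries.map_subst .X_X, map_vec, map_vec]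
  simp only [MvPowerSeries.map_X]

theorem map_commDefect {A : Type*} [CommRing A] (f : MvPolynomial Index (ZMod 2) →+* A) :
    MvPowerSeries.map f commDefect =
      (generic.map f).subst ![MvPowerSeries.X 1, MvPowerSeries.X 0] - generic.map f := by
  rw [commDefect, map_sub, MvPowerSeries.map_subst .X_X, map_vec]
  simp only [MvPowerSeries.map_X]

theorem map_selfDefect {A : Type*} [CommRing A] (f : MvPolynomial Index (ZMod 2) →+* A) :
    MvPowerSeries.map f selfDefect =
      ((generic.map f).subst ![PowerSeries.X, PowerSeries.X] : PowerSeries A) := by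
  rw [selfDefect, PowerSeries.X, MvPowerSeries.map_subst .X_X, map_vec]
  simp only [MvPowerSeries.map_X, PowerSeries.X]

/-- The universal formal group law of order two, over `N_*`. -/
def univ : FormalGroup LazardTwo where
  toPowerSeries := generic.map mk.toRingHom
  zero_constantCoeff := by
    rw [MvPowerSeries.constantCoeff_map, constantCoeff_generic, map_zero]
  lin_coeff_X := by
    rw [MvPowerSeries.coeff_map]
    have : MvPowerSeries.coeff (Finsupp.single 0 1) generic = 1 := by
      change generic _ = 1
      simp [generic]
    rw [this, map_one]
  lin_coeff_Y := by
    rw [MvPowerSeries.coeff_map]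
    have : MvPowerSeries.coeff (Finsupp.single 1 1) generic = 1 := by
      change generic _ = 1
      simp [generic]
    rw [this, map_one]
  assoc := by
    rw [← sub_eq_zero, ← map_assocDefect]
    ext n
    rw [MvPowerSeries.coeff_map]
    exact mk_eq_zero (Ideal.subset_span (Or.inl (Or.inl ⟨n, rfl⟩)))

theorem univ_isOrderTwo : univ.IsOrderTwo where
  comm := by
    change (generic.map mk.toRingHom).subst _ = generic.map mk.toRingHom
    rw [← sub_eq_zero, ← map_commDefect]
    ext n
    rw [MvPowerSeries.coeff_map]
    exact mk_eq_zero (Ideal.subset_span (Or.inl (Or.inr ⟨n, rfl⟩)))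
  self_add := by
    change (generic.map mk.toRingHom).subst _ = _
    rw [← map_selfDefect]
    refine PowerSeries.ext fun n => ?_
    exact mk_eq_zero (Ideal.subset_span (Or.inr ⟨n, rfl⟩))

section lift

variable {A : Type*} [CommRing A] [Algebra (ZMod 2) A] (F : FormalGroup A)

/-- The homomorphism from the polynomial ring sending `a_{ij}` to the coefficients of `F`. -/
def preLift : MvPolynomial Index (ZMod 2) →ₐ[ZMod 2] A :=
  MvPolynomial.aeval fun n : Index => MvPowerSeries.coeff n.1 F.toPowerSeries

theorem map_preLift : generic.map (preLift F).toRingHom = F.toPowerSeries := by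
  ext n
  rw [MvPowerSeries.coeff_map]
  change preLift F (generic n) = _
  unfold generic
  split_ifs with h h0
  · simp [preLift]
  · subst h0
    rw [map_zero]
    exact F.zero_constantCoeff.symm
  · have h1 : n.degree = 1 := by
      have : n.degree ≠ 0 := fun h' => h0 ((Finsupp.degree_eq_zero_iff n).mp h')
      omega
    rw [map_one]
    have h2 : n 0 + n 1 = 1 := by
      rw [Finsupp.degree_eq_sum, Fin.sum_univ_two] at h1
      exact h1
    have h3 : n = Finsupp.single 0 1 ∨ n = Finsupp.single 1 1 := by
      rcases Nat.eq_zero_or_pos (n 0) with h4 | h4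
      · right
        ext i; fin_cases i
        · simpa using h4
        · simp; omega
      · left
        ext i; fin_cases i
        · simp; omega
        · simp; omega
    rcases h3 with rfl | rfl
    · exact F.lin_coeff_X.symm
    · exact F.lin_coeff_Y.symm

theorem preLift_eq_zero (hF : F.IsOrderTwo) (p : MvPolynomial Index (ZMod 2))
    (hp : p ∈ relations) : preLift F p = 0 := by
  have h1 := map_assocDefect (preLift F).toRingHom
  have h2 := map_commDefect (preLift F).toRingHom
  have h3 := map_selfDefect (preLift F).toRingHom
  rw [map_preLift] at h1 h2 h3
  rw [F.assoc, sub_self] at h1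
  rw [hF.comm, sub_self] at h2
  rw [hF.self_add] at h3
  have key : relations ≤ RingHom.ker (preLift F).toRingHom := by
    refine Ideal.span_le.mpr ?_
    rintro _ ((⟨n, rfl⟩ | ⟨n, rfl⟩) | ⟨n, rfl⟩)
    · have := congrArg (MvPowerSeries.coeff n) h1
      rwa [MvPowerSeries.coeff_map] at this
    · have := congrArg (MvPowerSeries.coeff n) h2
      rwa [MvPowerSeries.coeff_map] at this
    · exact congrArg (PowerSeries.coeff n) h3
  exact key hp

/-- The classifying homomorphism of a formal group law of order two. -/
def lift (hF : F.IsOrderTwo) : LazardTwo →ₐ[ZMod 2] A :=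
  Ideal.Quotient.liftₐ relations (preLift F) (preLift_eq_zero F hF)

theorem map_lift (hF : F.IsOrderTwo) : univ.map (lift F hF).toRingHom = F := by
  refine FormalGroup.ext ?_
  rw [← map_preLift F]
  rfl

end lift

/-- The formal group law of an `N_*`-algebra. -/
def law (R : Type*) [CommRing R] [Algebra LazardTwo R] : FormalGroup R :=
  univ.map (algebraMap LazardTwo R)

end LazardTwo

/-! ### The Faa di Bruno Hopf algebra -/

/-- The algebra `B_* = Z/2[h₀^{±1}, h₁, h₂, …]`. -/
abbrev FaaDiBruno : Type := Localization.Away (MvPolynomial.X 0 : MvPolynomial ℕ (ZMod 2))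

namespace FaaDiBruno

/-- The generators `h_n`. -/
def gen (n : ℕ) : FaaDiBruno :=
  algebraMap (MvPolynomial ℕ (ZMod 2)) FaaDiBruno (MvPolynomial.X n)

/-- The generic invertible series `h(x) = ∑ h_n x^{n+1}`. -/
def series : PowerSeries FaaDiBruno := PowerSeries.X * PowerSeries.mk gen

theorem constantCoeff_series : PowerSeries.constantCoeff series = 0 := by simp [series]

theorem coeff_succ_series (n : ℕ) : PowerSeries.coeff (n + 1) series = gen n := by
  simp [series, PowerSeries.coeff_succ_X_mul]

theorem isUnit_coeff_one_series : IsUnit (PowerSeries.coeff 1 series) := by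
  rw [coeff_succ_series 0]
  exact IsLocalization.Away.algebraMap_isUnit _

/-- The homomorphism sending `h(x)` to a given series with invertible linear coefficient. -/
def lift {A : Type*} [CommRing A] [Algebra (ZMod 2) A] (f : PowerSeries A)
    (hf : IsUnit (PowerSeries.coeff 1 f)) : FaaDiBruno →ₐ[ZMod 2] A :=
  IsLocalization.liftAlgHom (M := Submonoid.powers (MvPolynomial.X 0 : MvPolynomial ℕ (ZMod 2)))
    (f := MvPolynomial.aeval fun n => PowerSeries.coeff (n + 1) f) (by
      rintro ⟨_, k, rfl⟩
      simpa using hf.pow k)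

theorem lift_gen {A : Type*} [CommRing A] [Algebra (ZMod 2) A] (f : PowerSeries A)
    (hf : IsUnit (PowerSeries.coeff 1 f)) (n : ℕ) :
    lift f hf (gen n) = PowerSeries.coeff (n + 1) f := by
  simp [lift, gen]

theorem coeff_one_subst {A : Type*} [CommRing A] (f g : PowerSeries A)
    (hg : PowerSeries.constantCoeff g = 0) :
    PowerSeries.coeff 1 (PowerSeries.subst g f) =
      PowerSeries.coeff 1 f * PowerSeries.coeff 1 g := by
  rw [PowerSeries.coeff_subst' (PowerSeries.HasSubst.of_constantCoeff_zero' hg),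
    finsum_eq_single _ 1]
  · simp
  · intro n hn
    obtain ⟨k, rfl⟩ := PowerSeries.X_dvd_iff.mpr hg
    rcases n with _ | _ | n
    · simp [PowerSeries.coeff_one]
    · exact absurd rfl hn
    · rw [mul_pow, PowerSeries.coeff_X_pow_mul']
      simp

/-- The series `(h ⊗ 1) ∘ (1 ⊗ h)`. -/
def comulSeries : PowerSeries (FaaDiBruno ⊗[ZMod 2] FaaDiBruno) :=
  PowerSeries.subst
    (series.map (Algebra.TensorProduct.includeRight :
      FaaDiBruno →ₐ[ZMod 2] FaaDiBruno ⊗[ZMod 2] FaaDiBruno).toRingHom)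
    (series.map (Algebra.TensorProduct.includeLeft :
      FaaDiBruno →ₐ[ZMod 2] FaaDiBruno ⊗[ZMod 2] FaaDiBruno).toRingHom)

theorem isUnit_coeff_one_comulSeries : IsUnit (PowerSeries.coeff 1 comulSeries) := by
  rw [comulSeries, coeff_one_subst, PowerSeries.coeff_map, PowerSeries.coeff_map]
  · exact (isUnit_coeff_one_series.map _).mul (isUnit_coeff_one_series.map _)
  · rw [← PowerSeries.coeff_zero_eq_constantCoeff_apply, PowerSeries.coeff_map,
      PowerSeries.coeff_zero_eq_constantCoeff_apply, constantCoeff_series, map_zero]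

/-- The diagonal, `δ(h) = (h ⊗ 1) ∘ (1 ⊗ h)`. -/
def comul : FaaDiBruno →ₐ[ZMod 2] FaaDiBruno ⊗[ZMod 2] FaaDiBruno :=
  lift comulSeries isUnit_coeff_one_comulSeries

/-- The counit, `ε(h) = x`. -/
def counit : FaaDiBruno →ₐ[ZMod 2] ZMod 2 :=
  lift PowerSeries.X (by simp)

/-- The series `h(x)` with coefficients in `B_* ⊗ R`. -/
def seriesOver (R : Type*) [CommRing R] [Algebra (ZMod 2) R] :
    PowerSeries (FaaDiBruno ⊗[ZMod 2] R) :=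
  series.map (Algebra.TensorProduct.includeLeft :
    FaaDiBruno →ₐ[ZMod 2] FaaDiBruno ⊗[ZMod 2] R).toRingHom

/-- The inclusion of `R` in `B_* ⊗ R`. -/
def incl (R : Type*) [CommRing R] [Algebra (ZMod 2) R] : R →+* FaaDiBruno ⊗[ZMod 2] R :=
  (Algebra.TensorProduct.includeRight : R →ₐ[ZMod 2] FaaDiBruno ⊗[ZMod 2] R).toRingHom

theorem constantCoeff_seriesOver (R : Type*) [CommRing R] [Algebra (ZMod 2) R] :
    PowerSeries.constantCoeff (seriesOver R) = 0 := by
  rw [seriesOver, ← PowerSeries.coeff_zero_eq_constantCoeff_apply, PowerSeries.coeff_map,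
    PowerSeries.coeff_zero_eq_constantCoeff_apply, constantCoeff_series, map_zero]

theorem isUnit_coeff_one_seriesOver (R : Type*) [CommRing R] [Algebra (ZMod 2) R] :
    IsUnit (PowerSeries.coeff 1 (seriesOver R)) := by
  rw [seriesOver, PowerSeries.coeff_map]
  exact isUnit_coeff_one_series.map _

end FaaDiBruno

/-! ### Change of parameter in a formal group law -/

namespace FormalGroup

variable {R : Type*} [CommRing R]

theorem hasSubst_vec {τ : Type*} {a b : MvPowerSeries τ R} (ha : PowerSeries.HasSubst a)
    (hb : PowerSeries.HasSubst b) : MvPowerSeries.HasSubst ![a, b] :=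
  MvPowerSeries.hasSubst_of_constantCoeff_nilpotent fun s => by fin_cases s <;> assumption

theorem hasSubst_eval₂ (F : FormalGroup R) {τ : Type*} {a b : MvPowerSeries τ R}
    (ha : PowerSeries.HasSubst a) (hb : PowerSeries.HasSubst b) :
    PowerSeries.HasSubst (F.eval₂ a b) :=
  MvPowerSeries.IsNilpotent_subst (hasSubst_vec ha hb) (F.zero_constantCoeff ▸ IsNilpotent.zero)

theorem hasSubst_subst {τ : Type*} {P : PowerSeries R} (hP : PowerSeries.constantCoeff P = 0)
    {a : MvPowerSeries τ R} (ha : PowerSeries.HasSubst a) :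
    PowerSeries.HasSubst (PowerSeries.subst a P) := by
  rw [← PowerSeries.coe_substAlgHom ha]
  exact PowerSeries.HasSubst.comp (PowerSeries.HasSubst.of_constantCoeff_zero' hP) ha

/-- The series `P(F(Q(x), Q(y)))`, for two series `P`, `Q` in one variable. -/
def conjSeries (F : FormalGroup R) (P Q : PowerSeries R) : MvPowerSeries (Fin 2) R :=
  PowerSeries.subst
    (F.eval₂ (PowerSeries.subst (MvPowerSeries.X 0) Q) (PowerSeries.subst (MvPowerSeries.X 1) Q)) P

theorem conjSeries_subst (F : FormalGroup R) {P Q : PowerSeries R}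
    (hQ : PowerSeries.constantCoeff Q = 0)
    {τ : Type*} {a b : MvPowerSeries τ R} (ha : PowerSeries.HasSubst a)
    (hb : PowerSeries.HasSubst b) :
    (F.conjSeries P Q).subst ![a, b] =
      PowerSeries.subst (F.eval₂ (PowerSeries.subst a Q) (PowerSeries.subst b Q)) P := by
  have hab := hasSubst_vec ha hb
  have h0 := hasSubst_subst hQ (PowerSeries.HasSubst.X (S := R) (0 : Fin 2))
  have h1 := hasSubst_subst hQ (PowerSeries.HasSubst.X (S := R) (1 : Fin 2))
  have e (i : Fin 2) : MvPowerSeries.subst ![a, b]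
      (PowerSeries.subst (MvPowerSeries.X i : MvPowerSeries (Fin 2) R) Q) =
      PowerSeries.subst (![a, b] i) Q := by
    rw [PowerSeries.subst, MvPowerSeries.subst_comp_subst_apply
      (PowerSeries.HasSubst.X (S := R) i).const hab, PowerSeries.subst]
    simp only [MvPowerSeries.subst_X hab]
  rw [conjSeries, PowerSeries.subst_def (F.eval₂ _ _) P, MvPowerSeries.subst_comp_subst_apply
    (F.hasSubst_eval₂ h0 h1).const hab, PowerSeries.subst_def (F.eval₂ _ _) P]
  congr 1
  funext _
  rw [eval₂, MvPowerSeries.subst_comp_subst_apply (hasSubst_vec h0 h1) hab, eval₂]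
  congr 1
  funext i
  fin_cases i
  · exact e 0
  · exact e 1

theorem subst_subst {τ : Type*} {P Q : PowerSeries R} (hQ : PowerSeries.constantCoeff Q = 0)
    (h : PowerSeries.subst Q P = PowerSeries.X) {a : MvPowerSeries τ R}
    (ha : PowerSeries.HasSubst a) :
    PowerSeries.subst (PowerSeries.subst a Q) P = a := by
  rw [← PowerSeries.subst_comp_subst_apply (PowerSeries.HasSubst.of_constantCoeff_zero' hQ) ha, h,
    PowerSeries.subst_X ha]

theorem subst_zero_of {τ : Type*} {P : PowerSeries R} (hP : PowerSeries.constantCoeff P = 0) :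
    PowerSeries.subst (0 : MvPowerSeries τ R) P = 0 := by
  rw [PowerSeries.subst_zero_of_constantCoeff_zero hP]

theorem coeff_single_of_subst {G : MvPowerSeries (Fin 2) R}
    (h : G.subst ![PowerSeries.X, 0] = (PowerSeries.X : PowerSeries R)) :
    MvPowerSeries.coeff (Finsupp.single 0 1) G = 1 := by
  have h1 := congrArg (PowerSeries.coeff 1) h
  rw [PowerSeries.coeff_one_X, PowerSeries.coeff,
    MvPowerSeries.coeff_subst (hasSubst_vec PowerSeries.HasSubst.X' PowerSeries.HasSubst.zero'),
    finsum_eq_single _ (Finsupp.single 0 1)] at h1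
  · simpa using h1
  · intro d hd
    by_cases hd₁ : d 1 = 0
    · by_cases hd₀ : d 0 = 0
      · simp [hd₀, hd₁]
      simp [hd₁, PowerSeries.coeff_X_pow]
      grind
    simp [hd₁]

theorem coeff_single_of_subst' {G : MvPowerSeries (Fin 2) R}
    (h : G.subst ![0, PowerSeries.X] = (PowerSeries.X : PowerSeries R)) :
    MvPowerSeries.coeff (Finsupp.single 1 1) G = 1 := by
  have h1 := congrArg (PowerSeries.coeff 1) h
  rw [PowerSeries.coeff_one_X, PowerSeries.coeff,
    MvPowerSeries.coeff_subst (hasSubst_vec PowerSeries.HasSubst.zero' PowerSeries.HasSubst.X'),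
    finsum_eq_single _ (Finsupp.single 1 1)] at h1
  · simpa using h1
  · intro d hd
    by_cases hd₁ : d 0 = 0
    · by_cases hd₀ : d 1 = 0
      · simp [hd₀, hd₁]
      simp [hd₁, PowerSeries.coeff_X_pow]
      grind
    simp [hd₁]

/-- The formal group law `P(F(P⁻¹(x), P⁻¹(y)))`, where `P` is invertible under substitution. -/
def conj (F : FormalGroup R) (P : PowerSeries R) (hP : PowerSeries.constantCoeff P = 0)
    (hP' : IsUnit (PowerSeries.coeff 1 P)) : FormalGroup R where
  toPowerSeries := F.conjSeries P (P.substInvOfIsUnit hP')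
  zero_constantCoeff := by
    have hQ := P.constantCoeff_substInvOfIsUnit hP'
    refine MvPowerSeries.constantCoeff_subst_eq_zero (F.hasSubst_eval₂
      (hasSubst_subst hQ (PowerSeries.HasSubst.X _))
      (hasSubst_subst hQ (PowerSeries.HasSubst.X _))).const (fun _ => ?_) hP
    refine MvPowerSeries.constantCoeff_subst_eq_zero (hasSubst_vec
      (hasSubst_subst hQ (PowerSeries.HasSubst.X _))
      (hasSubst_subst hQ (PowerSeries.HasSubst.X _))) (fun i => ?_) F.zero_constantCoeff
    fin_cases i
    all_goals exact PowerSeries.constantCoeff_subst_eq_zero (by simp) _ hQ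
  lin_coeff_X := by
    have hQ := P.constantCoeff_substInvOfIsUnit hP'
    refine coeff_single_of_subst ?_
    rw [F.conjSeries_subst hQ PowerSeries.HasSubst.X' PowerSeries.HasSubst.zero', eval₂,
      subst_zero_of hQ, F.add_zero (hasSubst_subst hQ PowerSeries.HasSubst.X'),
      subst_subst hQ (P.subst_substInvOfIsUnit_right hP hP') PowerSeries.HasSubst.X']
  lin_coeff_Y := by
    have hQ := P.constantCoeff_substInvOfIsUnit hP'
    refine coeff_single_of_subst' ?_
    rw [F.conjSeries_subst hQ PowerSeries.HasSubst.zero' PowerSeries.HasSubst.X', eval₂,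
      subst_zero_of hQ, F.zero_add (hasSubst_subst hQ PowerSeries.HasSubst.X'),
      subst_subst hQ (P.subst_substInvOfIsUnit_right hP hP') PowerSeries.HasSubst.X']
  assoc := by
    have hQ := P.constantCoeff_substInvOfIsUnit hP'
    have hPQ := P.subst_substInvOfIsUnit_left hP hP'
    have hX (i : Fin 3) := PowerSeries.HasSubst.X (S := R) i
    have hY (i : Fin 3) := hasSubst_subst hQ (hX i)
    rw [F.conjSeries_subst hQ (hX 0) (hX 1), F.conjSeries_subst hQ (hX 1) (hX 2),
      F.conjSeries_subst hQ (hasSubst_subst hP (F.hasSubst_eval₂ (hY 0) (hY 1))) (hX 2),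
      F.conjSeries_subst hQ (hX 0) (hasSubst_subst hP (F.hasSubst_eval₂ (hY 1) (hY 2))),
      subst_subst hP hPQ (F.hasSubst_eval₂ (hY 0) (hY 1)),
      subst_subst hP hPQ (F.hasSubst_eval₂ (hY 1) (hY 2))]
    congr 1
    exact F.assoc' (hY 0) (hY 1) (hY 2)

theorem eval₂_self {F : FormalGroup R} (hF : F.IsOrderTwo) {τ : Type*} {a : MvPowerSeries τ R}
    (ha : PowerSeries.HasSubst a) : F.eval₂ a a = 0 := by
  have h := congrArg (PowerSeries.subst a) hF.self_add
  have h0 : PowerSeries.subst a (0 : PowerSeries R) = 0 := by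
    rw [← PowerSeries.coe_substAlgHom ha, map_zero]
  rw [h0, PowerSeries.subst, MvPowerSeries.subst_comp_subst_apply
    (hasSubst_vec PowerSeries.HasSubst.X' PowerSeries.HasSubst.X') ha.const] at h
  rw [eval₂, ← h]
  congr 1
  funext i
  fin_cases i <;> exact (PowerSeries.subst_X ha).symm

theorem eval₂_comm {F : FormalGroup R} (hF : F.IsOrderTwo) {τ : Type*} {a b : MvPowerSeries τ R}
    (ha : PowerSeries.HasSubst a) (hb : PowerSeries.HasSubst b) : F.eval₂ a b = F.eval₂ b a := by
  have : F.IsComm := ⟨hF.comm.symm⟩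
  exact F.comm' ha hb

theorem IsOrderTwo.conj {F : FormalGroup R} (hF : F.IsOrderTwo) (P : PowerSeries R)
    (hP : PowerSeries.constantCoeff P = 0) (hP' : IsUnit (PowerSeries.coeff 1 P)) :
    (F.conj P hP hP').IsOrderTwo where
  comm := by
    have hQ := P.constantCoeff_substInvOfIsUnit hP'
    have hX (i : Fin 2) := PowerSeries.HasSubst.X (S := R) i
    change (F.conjSeries P (P.substInvOfIsUnit hP')).subst _ = F.conjSeries P _
    rw [F.conjSeries_subst hQ (hX 1) (hX 0), conjSeries,
      eval₂_comm hF (hasSubst_subst hQ (hX 1)) (hasSubst_subst hQ (hX 0))]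
  self_add := by
    have hQ := P.constantCoeff_substInvOfIsUnit hP'
    change (F.conjSeries P (P.substInvOfIsUnit hP')).subst _ = _
    rw [F.conjSeries_subst hQ PowerSeries.HasSubst.X' PowerSeries.HasSubst.X',
      eval₂_self hF (hasSubst_subst hQ PowerSeries.HasSubst.X'), subst_zero_of hP]

theorem IsOrderTwo.map {F : FormalGroup R} (hF : F.IsOrderTwo) {S : Type*} [CommRing S]
    (f : R →+* S) : (F.map f).IsOrderTwo where
  comm := by
    have h := congrArg (MvPowerSeries.map f) hF.comm
    rw [MvPowerSeries.map_subst .X_X, LazardTwo.map_vec] at h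
    simp only [MvPowerSeries.map_X] at h
    exact h
  self_add := by
    have h := congrArg (MvPowerSeries.map f) hF.self_add
    rw [PowerSeries.X, MvPowerSeries.map_subst .X_X, LazardTwo.map_vec, map_zero] at h
    simp only [MvPowerSeries.map_X] at h
    exact h

end FormalGroup

/-- The coaction `φ : N_* → B_* ⊗ N_*`, determined by `φ(F)(x, y) = h(F(h⁻¹(x), h⁻¹(y)))`. -/
def LazardTwo.coaction : LazardTwo →ₐ[ZMod 2] FaaDiBruno ⊗[ZMod 2] LazardTwo :=
  LazardTwo.lift
    ((LazardTwo.univ.map (FaaDiBruno.incl LazardTwo)).conj (FaaDiBruno.seriesOver LazardTwo)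
      (FaaDiBruno.constantCoeff_seriesOver _) (FaaDiBruno.isUnit_coeff_one_seriesOver _))
    ((LazardTwo.univ_isOrderTwo.map _).conj _ _ _)

/-! ### D-rings -/

section DRing

variable {R : Type*} [CommRing R] {S : Type*} [CommRing S] {σ : Type*} {τ : Type*}

/-- `D_t` applied to the coefficients of a power series; the parameter `t` becomes the
indeterminate `none`. -/
def adjoinParam (D : R →+* PowerSeries R) (g : MvPowerSeries σ R) : MvPowerSeries (Option σ) R :=
  fun n => PowerSeries.coeff (n none) (D (MvPowerSeries.coeff n.some g))

/-- For `g = ∑ g_n x^n`, the series `∑ D_t(g_n) u^n`, where `u` and `t` are power series.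
It is the value of `D_t` on `g` when `D_t` is extended by `D_t(x_i) = u_i`. -/
def applyD (D : R →+* PowerSeries R) (u : σ → MvPowerSeries τ R) (t : MvPowerSeries τ R)
    (g : MvPowerSeries σ R) : MvPowerSeries τ R :=
  (adjoinParam D g).subst fun i : Option σ => i.elim t u

/-- Lubin's isogeny `x F(x, t)`, whose kernel is the subgroup `{0, t}`. -/
def FormalGroup.isogeny (F : FormalGroup R) (x t : MvPowerSeries τ R) : MvPowerSeries τ R :=
  x * F.eval₂ x t

/-- The structure of a D-ring on a commutative ring `R` with a formal group law `F`. -/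
structure DStructure (R : Type*) [CommRing R] (F : FormalGroup R) where
  /-- The total squaring operation `D_t : R → R[[t]]`. -/
  D : R →+* PowerSeries R
  /-- `D_0(a) = a²`. -/
  constantCoeff_D : ∀ a, PowerSeries.constantCoeff (D a) = a ^ 2
  /-- `D_t(F) = F_t`, where `F_t` is the quotient of `F` by `{0, t}`, i.e. the formal group law
  such that `x F(x, t)` is a homomorphism from `F` to `F_t`. In this equation `x`, `y`, `t` are
  the indeterminates `0`, `1`, `2`. -/
  D_law : applyD D
      ![F.isogeny (MvPowerSeries.X 0) (MvPowerSeries.X 2 : MvPowerSeries (Fin 3) R),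
        F.isogeny (MvPowerSeries.X 1) (MvPowerSeries.X 2)] (MvPowerSeries.X 2) F.toPowerSeries =
    F.isogeny (F.eval₂ (MvPowerSeries.X 0) (MvPowerSeries.X 1)) (MvPowerSeries.X 2)
  /-- `D_s(D_t(a)) = D_t(D_s(a))`, where `D_s` is extended to `R[[t]]` by `D_s(t) = t F(t, s)`.
  Here `s`, `t` are the indeterminates `0`, `1`. -/
  D_symm : ∀ a, applyD D
      (fun _ : Unit => F.isogeny (MvPowerSeries.X 1) (MvPowerSeries.X 0 : MvPowerSeries (Fin 2) R))
      (MvPowerSeries.X 0) (D a) =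
    applyD D
      (fun _ : Unit => F.isogeny (MvPowerSeries.X 0) (MvPowerSeries.X 1 : MvPowerSeries (Fin 2) R))
      (MvPowerSeries.X 1) (D a)

theorem map_applyD [Finite σ] {D : R →+* PowerSeries R} {E : S →+* PowerSeries S} {f : R →+* S}
    (h : ∀ a, PowerSeries.map f (D a) = E (f a)) {u : σ → MvPowerSeries τ R}
    {t : MvPowerSeries τ R} (hu : ∀ i, MvPowerSeries.constantCoeff (u i) = 0)
    (ht : MvPowerSeries.constantCoeff t = 0) (g : MvPowerSeries σ R) :
    (applyD D u t g).map f =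
      applyD E (fun i => (u i).map f) (t.map f) (g.map f) := by
  have hs : MvPowerSeries.HasSubst fun i : Option σ => i.elim t u :=
    MvPowerSeries.hasSubst_of_constantCoeff_zero fun i => by
      cases i
      · exact ht
      · exact hu _
  rw [applyD, MvPowerSeries.map_subst hs, applyD]
  have h1 : (adjoinParam D g).map f = adjoinParam E (g.map f) := by
    ext n
    rw [MvPowerSeries.coeff_map]
    change f (PowerSeries.coeff (n none) (D _)) = PowerSeries.coeff (n none) (E _)
    rw [MvPowerSeries.coeff_map, ← h, PowerSeries.coeff_map]
  rw [h1]
  congr 1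
  funext i
  cases i <;> rfl

theorem FormalGroup.map_eval₂ (F : FormalGroup R) (f : R →+* S) {x y : MvPowerSeries τ R}
    (hx : PowerSeries.HasSubst x) (hy : PowerSeries.HasSubst y) :
    (F.eval₂ x y).map f = (F.map f).eval₂ (x.map f) (y.map f) := by
  rw [FormalGroup.eval₂, MvPowerSeries.map_subst (FormalGroup.hasSubst_vec hx hy),
    LazardTwo.map_vec]
  rfl

theorem FormalGroup.map_isogeny (F : FormalGroup R) (f : R →+* S) {x y : MvPowerSeries τ R}
    (hx : PowerSeries.HasSubst x) (hy : PowerSeries.HasSubst y) :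
    (F.isogeny x y).map f = (F.map f).isogeny (x.map f) (y.map f) := by
  rw [FormalGroup.isogeny, map_mul, F.map_eval₂ f hx hy]
  rfl

end DRing

/-! ### The free D-ring generated by a module -/

namespace FreeDRing

variable (M : Type u) [AddCommGroup M] [Module LazardTwo M]

/-- Formal expressions in the elements of `M` and the operations of a D-ring. -/
inductive Term (M : Type u) : Type u
  | of (m : M) : Term M
  | scalar (n : LazardTwo) : Term M
  | sum (a b : Term M) : Term M
  | prod (a b : Term M) : Term M
  | op (i : ℕ) (a : Term M) : Term M

/-- A D-ring together with an `N_*`-linear map from `M`. -/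
structure Target : Type (u + 1) where
  R : Type u
  [ring : CommRing R]
  [alg : Algebra LazardTwo R]
  str : DStructure R (LazardTwo.law R)
  f : M →ₗ[LazardTwo] R

attribute [instance] Target.ring Target.alg

variable {M}

/-- The value of an expression in a D-ring, where `op i` is the coefficient of `t^i` in `D_t`. -/
def Term.eval (T : Target M) : Term M → T.R
  | .of m => T.f m
  | .scalar n => algebraMap LazardTwo T.R n
  | .sum a b => a.eval T + b.eval T
  | .prod a b => a.eval T * b.eval T
  | .op i a => PowerSeries.coeff i (T.str.D (a.eval T))

variable (M) in
/-- Two expressions are identified if they have the same value in all D-rings under `M`. -/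
def setoid : Setoid (Term M) where
  r a b := ∀ T : Target M, a.eval T = b.eval T
  iseqv := ⟨fun _ _ => rfl, fun h T => (h T).symm, fun h h' T => (h T).trans (h' T)⟩

end FreeDRing

/-- The free D-ring `D⟨M⟩` generated by the `N_*`-module `M`. -/
def FreeDRing (M : Type u) [AddCommGroup M] [Module LazardTwo M] : Type u :=
  Quotient (FreeDRing.setoid M)

namespace FreeDRing

variable {M : Type u} [AddCommGroup M] [Module LazardTwo M]

/-- The class of an expression. -/
def cls (a : Term M) : FreeDRing M := Quotient.mk (setoid M) a

theorem cls_surjective (a : FreeDRing M) : ∃ t, cls t = a := Quotient.exists_rep a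

/-- The value of an element of `D⟨M⟩` in a D-ring under `M`. -/
def ev (T : Target M) : FreeDRing M → T.R :=
  Quotient.lift (Term.eval T) fun _ _ h => h T

theorem ev_cls (T : Target M) (a : Term M) : ev T (cls a) = a.eval T := rfl

theorem ext_ev {a b : FreeDRing M} (h : ∀ T : Target M, ev T a = ev T b) : a = b := by
  obtain ⟨a, rfl⟩ := cls_surjective a
  obtain ⟨b, rfl⟩ := cls_surjective b
  exact Quotient.sound h

instance : Zero (FreeDRing M) := ⟨cls (.scalar 0)⟩

instance : One (FreeDRing M) := ⟨cls (.scalar 1)⟩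

instance : Add (FreeDRing M) :=
  ⟨Quotient.map₂ .sum fun _ _ h _ _ h' T => congrArg₂ (· + ·) (h T) (h' T)⟩

instance : Mul (FreeDRing M) :=
  ⟨Quotient.map₂ .prod fun _ _ h _ _ h' T => congrArg₂ (· * ·) (h T) (h' T)⟩

instance : Neg (FreeDRing M) := ⟨fun a => (cls (.scalar (-1)) : FreeDRing M) * a⟩

/-- The coefficient of `t^i` in `D_t(a)`. -/
def op (i : ℕ) : FreeDRing M → FreeDRing M :=
  Quotient.map (.op i) fun _ _ h T =>
    congrArg (fun x => PowerSeries.coeff i (T.str.D x)) (h T)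

theorem ev_zero (T : Target M) : ev T 0 = 0 := map_zero (algebraMap LazardTwo T.R)

theorem ev_one (T : Target M) : ev T 1 = 1 := map_one (algebraMap LazardTwo T.R)

theorem ev_add (T : Target M) (a b : FreeDRing M) : ev T (a + b) = ev T a + ev T b := by
  obtain ⟨a, rfl⟩ := cls_surjective a
  obtain ⟨b, rfl⟩ := cls_surjective b
  rfl

theorem ev_mul (T : Target M) (a b : FreeDRing M) : ev T (a * b) = ev T a * ev T b := by
  obtain ⟨a, rfl⟩ := cls_surjective a
  obtain ⟨b, rfl⟩ := cls_surjective b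
  rfl

theorem ev_neg (T : Target M) (a : FreeDRing M) : ev T (-a) = -ev T a := by
  change ev T ((cls (.scalar (-1)) : FreeDRing M) * a) = _
  rw [ev_mul]
  change algebraMap LazardTwo T.R (-1) * _ = _
  simp

theorem ev_op (T : Target M) (i : ℕ) (a : FreeDRing M) :
    ev T (op i a) = PowerSeries.coeff i (T.str.D (ev T a)) := by
  obtain ⟨a, rfl⟩ := cls_surjective a
  rfl

instance : CommRing (FreeDRing M) where
  add_assoc a b c := ext_ev fun T => by simp only [ev_add, add_assoc]
  zero_add a := ext_ev fun T => by simp only [ev_add, ev_zero, zero_add]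
  add_zero a := ext_ev fun T => by simp only [ev_add, ev_zero, add_zero]
  add_comm a b := ext_ev fun T => by simp only [ev_add, add_comm]
  left_distrib a b c := ext_ev fun T => by simp only [ev_add, ev_mul, mul_add]
  right_distrib a b c := ext_ev fun T => by simp only [ev_add, ev_mul, add_mul]
  zero_mul a := ext_ev fun T => by simp only [ev_mul, ev_zero, zero_mul]
  mul_zero a := ext_ev fun T => by simp only [ev_mul, ev_zero, mul_zero]
  mul_assoc a b c := ext_ev fun T => by simp only [ev_mul, mul_assoc]
  one_mul a := ext_ev fun T => by simp only [ev_mul, ev_one, one_mul]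
  mul_one a := ext_ev fun T => by simp only [ev_mul, ev_one, mul_one]
  mul_comm a b := ext_ev fun T => by simp only [ev_mul, mul_comm]
  neg_add_cancel a := ext_ev fun T => by
    simp only [ev_add, ev_neg, ev_zero, neg_add_cancel]
  nsmul := nsmulRec
  zsmul := zsmulRec

/-- The evaluation as a ring homomorphism. -/
def evHom (T : Target M) : FreeDRing M →+* T.R where
  toFun := ev T
  map_one' := ev_one T
  map_mul' := ev_mul T
  map_zero' := ev_zero T
  map_add' := ev_add T

instance : Algebra LazardTwo (FreeDRing M) :=
  RingHom.toAlgebra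
    { toFun := fun n => cls (.scalar n)
      map_one' := rfl
      map_zero' := rfl
      map_mul' := fun a b => ext_ev fun T => by
        rw [ev_mul, ev_cls, ev_cls, ev_cls]; exact map_mul (algebraMap LazardTwo T.R) a b
      map_add' := fun a b => ext_ev fun T => by
        rw [ev_add, ev_cls, ev_cls, ev_cls]; exact map_add (algebraMap LazardTwo T.R) a b }

instance : Algebra (ZMod 2) (FreeDRing M) :=
  RingHom.toAlgebra ((algebraMap LazardTwo (FreeDRing M)).comp (algebraMap (ZMod 2) LazardTwo))

instance : IsScalarTower (ZMod 2) LazardTwo (FreeDRing M) :=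
  IsScalarTower.of_algebraMap_eq' rfl

theorem ev_algebraMap (T : Target M) (n : LazardTwo) :
    ev T (algebraMap LazardTwo (FreeDRing M) n) = algebraMap LazardTwo T.R n := rfl

variable (M) in
/-- The canonical map `M → D⟨M⟩`. -/
def ι : M →ₗ[LazardTwo] FreeDRing M where
  toFun m := cls (.of m)
  map_add' a b := ext_ev fun T => by rw [ev_add]; exact map_add T.f a b
  map_smul' n a := ext_ev fun T => by
    rw [RingHom.id_apply, Algebra.smul_def, ev_mul, ev_algebraMap, ← Algebra.smul_def]
    exact map_smul T.f n a

theorem ev_ι (T : Target M) (m : M) : ev T (ι M m) = T.f m := rfl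

variable (M) in
/-- The operation `D_t(a) = ∑ op i a t^i` on `D⟨M⟩`. -/
def D : FreeDRing M →+* PowerSeries (FreeDRing M) where
  toFun a := PowerSeries.mk fun i => op i a
  map_one' := PowerSeries.ext fun i => ext_ev fun T => by
    rw [PowerSeries.coeff_mk, ev_op, ev_one, map_one, PowerSeries.coeff_one,
      PowerSeries.coeff_one]
    split_ifs
    · exact (ev_one T).symm
    · exact (ev_zero T).symm
  map_zero' := PowerSeries.ext fun i => ext_ev fun T => by
    rw [PowerSeries.coeff_mk, ev_op, ev_zero, map_zero, map_zero, map_zero, ev_zero]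
  map_mul' a b := PowerSeries.ext fun i => ext_ev fun T => by
    rw [PowerSeries.coeff_mk, ev_op, ev_mul, map_mul, PowerSeries.coeff_mul,
      PowerSeries.coeff_mul]
    refine Eq.trans ?_ (map_sum (evHom T) _ _).symm
    refine Finset.sum_congr rfl fun p _ => ?_
    rw [map_mul, PowerSeries.coeff_mk, PowerSeries.coeff_mk]
    exact congrArg₂ (· * ·) (ev_op T _ _).symm (ev_op T _ _).symm
  map_add' a b := PowerSeries.ext fun i => ext_ev fun T => by
    rw [PowerSeries.coeff_mk, ev_op, ev_add, map_add, map_add, map_add, PowerSeries.coeff_mk,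
      PowerSeries.coeff_mk, ev_add, ev_op, ev_op]

theorem coeff_D (i : ℕ) (a : FreeDRing M) : PowerSeries.coeff i (D M a) = op i a :=
  PowerSeries.coeff_mk i fun j => op j a

theorem map_evHom_D (T : Target M) (a : FreeDRing M) :
    PowerSeries.map (evHom T) (D M a) = T.str.D (evHom T a) :=
  PowerSeries.ext fun i => by
    rw [PowerSeries.coeff_map, coeff_D]
    exact ev_op T i a

theorem ext_map {τ : Type*} {p q : MvPowerSeries τ (FreeDRing M)}
    (h : ∀ T : Target M, p.map (evHom T) = q.map (evHom T)) : p = q := by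
  ext n
  refine ext_ev fun T => ?_
  have := congrArg (MvPowerSeries.coeff n) (h T)
  rwa [MvPowerSeries.coeff_map, MvPowerSeries.coeff_map] at this

theorem map_law (T : Target M) :
    (LazardTwo.law (FreeDRing M)).map (evHom T) = LazardTwo.law T.R := by
  refine FormalGroup.ext ?_
  ext n
  rfl

theorem constantCoeff_isogeny_X {R : Type*} [CommRing R] {τ : Type*} (F : FormalGroup R)
    (i j : τ) : MvPowerSeries.constantCoeff
      (F.isogeny (MvPowerSeries.X i) (MvPowerSeries.X j)) = 0 := by
  rw [FormalGroup.isogeny, map_mul, MvPowerSeries.constantCoeff_X, zero_mul]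

variable (M) in
/-- The D-structure of the free D-ring. -/
def str : DStructure (FreeDRing M) (LazardTwo.law (FreeDRing M)) where
  D := D M
  constantCoeff_D a := ext_ev fun T => by
    have h := congrArg (PowerSeries.coeff 0) (map_evHom_D T a)
    rw [PowerSeries.coeff_map, PowerSeries.coeff_zero_eq_constantCoeff_apply,
      PowerSeries.coeff_zero_eq_constantCoeff_apply, T.str.constantCoeff_D] at h
    exact h.trans (map_pow (evHom T) a 2).symm
  D_law := ext_map fun T => by
    have hX (i : Fin 3) := PowerSeries.HasSubst.X (S := FreeDRing M) i
    rw [map_applyD (map_evHom_D T) (fun i => by fin_cases i <;> exact constantCoeff_isogeny_X _ _ _)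
      (MvPowerSeries.constantCoeff_X _), LazardTwo.map_vec,
      FormalGroup.map_isogeny _ _ (hX 0) (hX 2), FormalGroup.map_isogeny _ _ (hX 1) (hX 2),
      FormalGroup.map_isogeny _ _ (FormalGroup.hasSubst_eval₂ _ (hX 0) (hX 1)) (hX 2),
      FormalGroup.map_eval₂ _ _ (hX 0) (hX 1), ← FormalGroup.map_toPowerSeries, map_law]
    simp only [MvPowerSeries.map_X]
    exact T.str.D_law
  D_symm a := ext_map fun T => by
    have hX (i : Fin 2) := PowerSeries.HasSubst.X (S := FreeDRing M) i
    rw [map_applyD (map_evHom_D T) (fun _ => constantCoeff_isogeny_X _ _ _)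
      (MvPowerSeries.constantCoeff_X _),
      map_applyD (map_evHom_D T) (fun _ => constantCoeff_isogeny_X _ _ _)
      (MvPowerSeries.constantCoeff_X _)]
    have h : MvPowerSeries.map (evHom T) (D M a) = T.str.D (evHom T a) := map_evHom_D T a
    rw [h, FormalGroup.map_isogeny _ _ (hX 0) (hX 1), FormalGroup.map_isogeny _ _ (hX 1) (hX 0),
      map_law]
    simp only [MvPowerSeries.map_X]
    exact T.str.D_symm (evHom T a)

/-- The universal property of the free D-ring: an `N_*`-linear map to a D-ring extends uniquely
to a homomorphism of D-rings. -/
theorem existsUnique_hom {R : Type u} [CommRing R] [Algebra LazardTwo R]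
    (𝒟 : DStructure R (LazardTwo.law R)) (f : M →ₗ[LazardTwo] R) :
    ∃! g : FreeDRing M →ₐ[LazardTwo] R,
      (∀ a, PowerSeries.map g.toRingHom ((str M).D a) = 𝒟.D (g a)) ∧ ∀ m, g (ι M m) = f m := by
  let T : Target M := ⟨R, 𝒟, f⟩
  refine ⟨{ evHom T with commutes' := fun n => ev_algebraMap T n },
    ⟨fun a => map_evHom_D T a, fun m => ev_ι T m⟩, ?_⟩
  rintro g ⟨hg, hg'⟩
  ext a
  change g a = ev T a
  obtain ⟨a, rfl⟩ := cls_surjective a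
  induction a with
  | of m => exact hg' m
  | scalar n => exact g.commutes n
  | sum a b ha hb => exact (map_add g _ _).trans (congrArg₂ (· + ·) ha hb)
  | prod a b ha hb => exact (map_mul g _ _).trans (congrArg₂ (· * ·) ha hb)
  | op i a ha =>
    have h := congrArg (PowerSeries.coeff i) (hg (cls a))
    have h' : PowerSeries.coeff i ((str M).D (cls a)) = cls (.op i a) := coeff_D i (cls a)
    rw [PowerSeries.coeff_map, h', ha] at h
    exact h

end FreeDRing

/-! ### Landweber-Novikov coactions and the Nishida relations -/

/-- A Landweber-Novikov coaction on an `N_*`-module `M`: a left comodule structure over `B_*` such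
that the module structure map `N_* ⊗ M → M` is a map of comodules. -/
@[ext]
structure LNCoaction (M : Type*) [AddCommGroup M] [Module (ZMod 2) M] [Module LazardTwo M]
    [IsScalarTower (ZMod 2) LazardTwo M] where
  /-- The coaction. -/
  φ : M →ₗ[ZMod 2] FaaDiBruno ⊗[ZMod 2] M
  counit : ∀ m, TensorProduct.lid (ZMod 2) M
    (FaaDiBruno.counit.toLinearMap.rTensor M (φ m)) = m
  coassoc : ∀ m, TensorProduct.assoc (ZMod 2) FaaDiBruno FaaDiBruno M
    (FaaDiBruno.comul.toLinearMap.rTensor M (φ m)) = φ.lTensor FaaDiBruno (φ m)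
  /-- `φ(n m) = φ(n) φ(m)`, where `(b ⊗ n) (b' ⊗ m) = b b' ⊗ n m`. -/
  map_smul : ∀ (n : LazardTwo) (m : M), φ (n • m) =
    TensorProduct.map₂ (LinearMap.mul (ZMod 2) FaaDiBruno)
      (Algebra.lsmul (ZMod 2) (ZMod 2) M : LazardTwo →ₐ[ZMod 2] Module.End (ZMod 2) M).toLinearMap
      (LazardTwo.coaction n) (φ m)

/-- `f : M → M'` is a map of comodules. -/
def LNCoaction.IsComoduleMap {M M' : Type*}
    [AddCommGroup M] [Module (ZMod 2) M] [Module LazardTwo M] [IsScalarTower (ZMod 2) LazardTwo M]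
    [AddCommGroup M'] [Module (ZMod 2) M'] [Module LazardTwo M']
    [IsScalarTower (ZMod 2) LazardTwo M']
    (c : LNCoaction M) (c' : LNCoaction M') (f : M →ₗ[LazardTwo] M') : Prop :=
  ∀ m, c'.φ (f m) = (f.restrictScalars (ZMod 2)).lTensor FaaDiBruno (c.φ m)

section Nishida

variable {R : Type*} [CommRing R] [Algebra (ZMod 2) R] [Algebra LazardTwo R]
  [IsScalarTower (ZMod 2) LazardTwo R]

/-- `R` is an algebra over its coaction: its unit and multiplication are maps of comodules. -/
def LNCoaction.IsAlgebra (c : LNCoaction R) : Prop :=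
  c.φ 1 = 1 ∧ ∀ a b, c.φ (a * b) = c.φ a * c.φ b

/-- `E` is the D-structure on `B_* ⊗ R` (with the formal group law of `R`) determined by that of
`R` and `D_t(h)(x F(x, t)) = h(x) h(F(x, t))`. Here `x`, `t` are the indeterminates `0`, `1`. -/
structure DStructure.IsInduced {F : FormalGroup R} (𝒟 : DStructure R F)
    (E : DStructure (FaaDiBruno ⊗[ZMod 2] R) (F.map (FaaDiBruno.incl R))) : Prop where
  D_incl : ∀ a, E.D (FaaDiBruno.incl R a) = PowerSeries.map (FaaDiBruno.incl R) (𝒟.D a)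
  D_series : applyD E.D
      (fun _ : Unit => (F.map (FaaDiBruno.incl R)).isogeny (MvPowerSeries.X 0)
        (MvPowerSeries.X 1 : MvPowerSeries (Fin 2) (FaaDiBruno ⊗[ZMod 2] R)))
      (MvPowerSeries.X 1) (FaaDiBruno.seriesOver R) =
    PowerSeries.subst (MvPowerSeries.X 0) (FaaDiBruno.seriesOver R) *
      PowerSeries.subst
        ((F.map (FaaDiBruno.incl R)).eval₂ (MvPowerSeries.X 0) (MvPowerSeries.X 1))
        (FaaDiBruno.seriesOver R)

/-- The Nishida relations `D_t(φ(a)) = φ(D_t(a))` in `(B_* ⊗ R)[[t]]`, where `φ` is extended to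
`R[[t]]` by `φ(t) = h(t)`. -/
def LNCoaction.Nishida (c : LNCoaction R) (𝒟 : DStructure R (LazardTwo.law R)) : Prop :=
  ∃ E, 𝒟.IsInduced E ∧ ∀ a, E.D (c.φ a) =
    PowerSeries.subst (FaaDiBruno.seriesOver R)
      (PowerSeries.mk fun i => c.φ (PowerSeries.coeff i (𝒟.D a)))

end Nishida

end

open scoped TensorProduct

noncomputable section

/-! ### Ring homomorphisms of power series rings -/

namespace MvPowerSeries

section ext

variable {R S σ τ : Type*} [CommRing R] [CommRing S]

/-! Once `B_* ⊗ D⟨M⟩` carries the right D-structure, a coaction satisfying (2) and (3) is nothing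
but a homomorphism of D-rings from `D⟨M⟩` to it. The universal property of `D⟨M⟩` then gives
existence and uniqueness at once. Most of the work is the construction of that D-structure.

The structure of a D-ring `R` must be extended to `B_* ⊗ R` by `D_t(h)(x F(x, t)) = h(x) h(F(x, t))`
(`exists_isInduced`). Since `F(t, t) = 0`, the substitution `x ↦ F(x, t)` is an involution, and it
exchanges the two factors on the right. A series invariant under it is, in exactly one way, a series
in the isogeny `x F(x, t)` with coefficients depending on `t` only (`exists_isogeny_pow_dvd`,
`eq_of_isogeny_pow_dvd`), and these coefficients are taken as the values `D_t(h_n)`. At `t = 0` the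
isogeny is `x²` and the product is `h(x)² = ∑ h_n² x^{2n+2}` because `2 = 0`; so `D_0` is squaring
and `D_t(h_0)` is a unit. Applying `D_s` once more gives the product of `h` over the translates of
`x` by `0`, `s`, `t` and `F(s, t)`, expanded in an isogeny that is itself symmetric in `s` and `t`.
Uniqueness of the coefficients yields `D_s D_t = D_t D_s` (`iterD_symm_of_multiplicative`).

Next comes a change of parameter. If `k` satisfies `D_t(k)(x F(x, t)) = k(x) k(F(x, t))`, then
`D_{k⁻¹(t)}` is a D-structure for the formal group law conjugate to `F` under `k`
(`DStructure.twist`). For `k = h` the conjugate law is the one that a coaction has to assign to `F`,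
and the Nishida relations say exactly that `φ` is a homomorphism into the twisted structure
(`LNCoaction.IsAlgebra.nishida_iff`).

Counitality and coassociativity compare two homomorphisms out of `D⟨M⟩` that agree on `M`. For this
`ε ⊗ 1`, `δ ⊗ 1` and `1 ⊗ φ` have to respect the twisted structures. They do because `ε(h) = x`,
because `δ(h)` is a composite, so that twisting by it is twisting twice, and because `1 ⊗ φ` fixes
`h`.

Ring homomorphisms of power series rings are not assumed continuous. Infinite expansions are
therefore handled as families of congruences modulo powers of the isogeny. -/

theorem exists_eq_sum_X_mul (s : Finset σ) (g : MvPowerSeries σ R)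
    (hg : ∀ m : σ →₀ ℕ, (∀ i ∈ s, m i = 0) → coeff m g = 0) :
    ∃ q : σ → MvPowerSeries σ R, g = ∑ i ∈ s, X i * q i := by
  classical
  induction s using Finset.induction_on generalizing g with
  | empty =>
    refine ⟨0, ?_⟩
    ext m
    simpa using hg m (by simp)
  | insert i s hi ih =>
    let g₀ : MvPowerSeries σ R := fun m => if m i = 0 then coeff m g else 0
    have hg₀ (m : σ →₀ ℕ) : coeff m g₀ = if m i = 0 then coeff m g else 0 := rfl
    obtain ⟨q, hq⟩ := ih g₀ fun m hm => by
      rw [hg₀]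
      split_ifs with h
      · refine hg m fun j hj => ?_
        rcases Finset.mem_insert.mp hj with rfl | hj
        exacts [h, hm j hj]
      · rfl
    obtain ⟨p, hp⟩ : (X i : MvPowerSeries σ R) ∣ g - g₀ := X_dvd_iff.mpr fun m hm => by
      rw [map_sub, hg₀, if_pos hm, sub_self]
    refine ⟨Function.update q i p, ?_⟩
    rw [Finset.sum_insert hi, Function.update_self, ← hp, Finset.sum_congr rfl fun j hj => by
      rw [Function.update_of_ne (ne_of_mem_of_not_mem hj hi)], ← hq, sub_add_cancel]

theorem exists_eq_C_add_sum_X_mul [Fintype σ] (g : MvPowerSeries σ R) :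
    ∃ q : σ → MvPowerSeries σ R, g = C (constantCoeff g) + ∑ i, X i * q i := by
  classical
  obtain ⟨q, hq⟩ := exists_eq_sum_X_mul Finset.univ (g - C (constantCoeff g)) fun m hm => by
    have : m = 0 := by ext i; exact hm i (Finset.mem_univ i)
    subst this
    simp
  exact ⟨q, by rw [← hq, add_sub_cancel]⟩

/-- A substitute for continuity. Splitting off the constant term and writing the rest as `∑ X_i q_i`
moves the problem to the `q_i`; as `L(X_i)` has no constant term, each round pushes the error one
order higher. The ideal `I` is `⊥` when two homomorphisms are to be equal and `(X_i)` when
divisibility by `X_i` is wanted. -/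
theorem exists_sub_mem_order [Finite σ] {L L' : MvPowerSeries σ R →+* MvPowerSeries τ S}
    (I : Ideal (MvPowerSeries τ S)) (hC : ∀ a, L (C a) - L' (C a) ∈ I)
    (hX : ∀ i, L (X i) - L' (X i) ∈ I) (h0 : ∀ i, constantCoeff (L (X i)) = 0)
    (n : ℕ) (g : MvPowerSeries σ R) :
    ∃ r, L g - L' g - r ∈ I ∧ (n : ℕ∞) ≤ r.order := by
  have := Fintype.ofFinite σ
  induction n generalizing g with
  | zero => exact ⟨L g - L' g, by simp, by simp⟩
  | succ n ih =>
    obtain ⟨q, hq⟩ := exists_eq_C_add_sum_X_mul g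
    choose r hr hr' using fun i => ih (q i)
    refine ⟨∑ i, L (X i) * r i, ?_, ?_⟩
    · have key : L g - L' g - ∑ i, L (X i) * r i =
          (L (C (constantCoeff g)) - L' (C (constantCoeff g))) +
          ∑ i, (L (X i) * (L (q i) - L' (q i) - r i) + (L (X i) - L' (X i)) * L' (q i)) := by
        conv_lhs => rw [hq]
        simp only [map_add, map_sum, map_mul]
        rw [add_sub_add_comm, add_sub_assoc, ← Finset.sum_sub_distrib, ← Finset.sum_sub_distrib]
        congr 1
        exact Finset.sum_congr rfl fun i _ => by ring
      rw [key]
      exact I.add_mem (hC _) (I.sum_mem fun i _ =>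
        I.add_mem (I.mul_mem_left _ (hr i)) (I.mul_mem_right _ (hX i)))
    · refine le_order fun d hd => ?_
      rw [map_sum]
      refine Finset.sum_eq_zero fun i _ => coeff_of_lt_order (hd.trans_le ?_)
      refine le_trans ?_ le_order_mul
      rw [Nat.cast_add, add_comm]
      exact add_le_add (by simpa using one_le_order_iff_constCoeff_eq_zero.mpr (h0 i)) (hr' i)

/-- Two ring homomorphisms between power series rings that agree on the constants and the
indeterminates are equal if the indeterminates are mapped to series without constant term. -/
theorem ringHom_congr [Finite σ] {L L' : MvPowerSeries σ R →+* MvPowerSeries τ S}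
    (hC : ∀ a, L (C a) = L' (C a)) (hX : ∀ i, L (X i) = L' (X i))
    (h0 : ∀ i, constantCoeff (L (X i)) = 0) (g : MvPowerSeries σ R) : L g = L' g := by
  rw [← sub_eq_zero]
  ext d
  obtain ⟨r, hr, hr'⟩ := exists_sub_mem_order ⊥ (L' := L') (fun a => by simp [hC a])
    (fun i => by simp [hX i]) h0 (d.degree + 1) g
  rw [sub_eq_zero.mp ((Submodule.mem_bot _).mp hr)]
  exact coeff_of_lt_order (lt_of_lt_of_le (by exact_mod_cast Nat.lt_succ_self _) hr')

/-- Substitution of series without constant term, as a ring homomorphism. -/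
def substHom [Finite σ] (a : σ → MvPowerSeries τ R) (ha : ∀ i, constantCoeff (a i) = 0) :
    MvPowerSeries σ R →+* MvPowerSeries τ R :=
  (substAlgHom (hasSubst_of_constantCoeff_zero ha)).toRingHom

theorem substHom_apply [Finite σ] (a : σ → MvPowerSeries τ R)
    (ha : ∀ i, constantCoeff (a i) = 0) (g : MvPowerSeries σ R) :
    substHom a ha g = g.subst a := by
  change substAlgHom (hasSubst_of_constantCoeff_zero ha) g = _
  rw [coe_substAlgHom]

theorem constantCoeff_subst_zero [Finite σ] {a : σ → MvPowerSeries τ R}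
    (ha : ∀ i, constantCoeff (a i) = 0) {g : MvPowerSeries σ R} (hg : constantCoeff g = 0) :
    constantCoeff (g.subst a) = 0 :=
  constantCoeff_subst_eq_zero (hasSubst_of_constantCoeff_zero ha) ha hg

/-- Setting `X_i = 0` agrees with the identity modulo `(X_i)` on constants and indeterminates, hence
on all series up to terms of arbitrarily high order. Those terms do no harm, since divisibility by
`X_i` is a condition on single coefficients. -/
theorem X_dvd_of_subst_update [Finite τ] [DecidableEq τ] (i : τ) (p : MvPowerSeries τ R)
    (h : p.subst (Function.update (X : τ → MvPowerSeries τ R) i 0) = 0) :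
    (X i : MvPowerSeries τ R) ∣ p := by
  have ha (j : τ) : constantCoeff (Function.update (X : τ → MvPowerSeries τ R) i 0 j) = 0 := by
    by_cases hj : j = i
    · subst hj; simp
    · rw [Function.update_of_ne hj, constantCoeff_X]
  rw [X_dvd_iff]
  intro m hm
  obtain ⟨r, hr, hr'⟩ := exists_sub_mem_order
    (L := RingHom.id _) (L' := substHom _ ha) (Ideal.span {(X i : MvPowerSeries τ R)})
    (fun a => by
      rw [substHom_apply, RingHom.id_apply, subst_C]
      simp)
    (fun j => by
      rw [substHom_apply, RingHom.id_apply, subst_X (hasSubst_of_constantCoeff_zero ha)]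
      by_cases hj : j = i
      · subst hj
        simp
      · rw [Function.update_of_ne hj]
        simp)
    (fun j => by simp) (m.degree + 1) p
  rw [substHom_apply, h, sub_zero, RingHom.id_apply, Ideal.mem_span_singleton, X_dvd_iff] at hr
  have h1 := hr m hm
  rwa [map_sub, coeff_of_lt_order (f := r) (lt_of_lt_of_le (by exact_mod_cast Nat.lt_succ_self _) hr'),
    sub_zero] at h1

theorem eq_zero_of_forall_pow_dvd {u d : MvPowerSeries τ R} (hu : constantCoeff u = 0)
    (h : ∀ n : ℕ, u ^ n ∣ d) : d = 0 := by
  ext m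
  obtain ⟨q, rfl⟩ := h (m.degree + 1)
  refine coeff_of_lt_order (lt_of_lt_of_le ?_ (le_trans
    (le_order_pow_of_constantCoeff_eq_zero _ hu) (le_trans le_self_add le_order_mul)))
  exact_mod_cast Nat.lt_succ_self _

end ext

end MvPowerSeries

/-! ### The extension of `D_t` to power series -/

section applyD

open MvPowerSeries

variable {R S σ τ υ : Type*} [CommRing R] [CommRing S]

theorem coeff_adjoinParam (D : R →+* PowerSeries R) (g : MvPowerSeries σ R) (n : Option σ →₀ ℕ) :
    coeff n (adjoinParam D g) = PowerSeries.coeff (n none) (D (coeff n.some g)) := rfl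

/-- The coefficient of `t^i` in `D_t` applied to the coefficients of a power series. -/
def paramCoeff (D : R →+* PowerSeries R) (g : MvPowerSeries σ R) (i : ℕ) : MvPowerSeries σ R :=
  fun m => PowerSeries.coeff i (D (coeff m g))

theorem coeff_paramCoeff (D : R →+* PowerSeries R) (g : MvPowerSeries σ R) (i : ℕ)
    (m : σ →₀ ℕ) : coeff m (paramCoeff D g i) = PowerSeries.coeff i (D (coeff m g)) := rfl

/-- With `t` as the outer variable, the coefficient of each `t^i` is a series in the original
variables. Multiplicativity then amounts to exchanging the two convolution sums. -/
theorem adjoinParam_eq (D : R →+* PowerSeries R) (g : MvPowerSeries σ R) :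
    adjoinParam D g = (optionEquivLeft σ R).symm (PowerSeries.mk (paramCoeff D g)) := by
  rw [AlgEquiv.eq_symm_apply]
  ext i m
  rw [coeff_coeff_optionEquivLeft, coeff_adjoinParam, PowerSeries.coeff_mk, coeff_paramCoeff,
    Finsupp.optionElim_apply_none, Finsupp.some_optionElim]

theorem adjoinParam_mul (D : R →+* PowerSeries R) (f g : MvPowerSeries σ R) :
    adjoinParam D (f * g) = adjoinParam D f * adjoinParam D g := by
  classical
  rw [adjoinParam_eq, adjoinParam_eq, adjoinParam_eq, ← map_mul]
  congr 1
  ext i m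
  rw [PowerSeries.coeff_mk, PowerSeries.coeff_mul, map_sum, coeff_paramCoeff]
  simp only [PowerSeries.coeff_mk, coeff_mul, map_sum, map_mul, PowerSeries.coeff_mul,
    coeff_paramCoeff]
  rw [Finset.sum_comm]

/-- The ring homomorphism `adjoinParam`. -/
def adjoinParamHom (D : R →+* PowerSeries R) :
    MvPowerSeries σ R →+* MvPowerSeries (Option σ) R where
  toFun := adjoinParam D
  map_mul' := adjoinParam_mul D
  map_zero' := by
    ext n
    rw [coeff_adjoinParam, map_zero, map_zero, map_zero, map_zero]
  map_one' := by
    classical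
    ext n
    rw [coeff_adjoinParam, coeff_one, coeff_one]
    by_cases h : n.some = 0
    · rw [if_pos h, map_one, PowerSeries.coeff_one]
      refine if_congr ⟨fun h' => ?_, fun h' => by rw [h']; rfl⟩ rfl rfl
      ext (_ | i)
      · exact h'
      · exact DFunLike.congr_fun h i
    · rw [if_neg h, map_zero, map_zero, if_neg]
      rintro rfl
      exact h Finsupp.some_zero
  map_add' f g := by
    ext n
    rw [map_add, coeff_adjoinParam, coeff_adjoinParam, coeff_adjoinParam, map_add, map_add,
      map_add]

theorem elim_constantCoeff {u : σ → MvPowerSeries τ R} {t : MvPowerSeries τ R}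
    (hu : ∀ i, constantCoeff (u i) = 0) (ht : constantCoeff t = 0) (i : Option σ) :
    constantCoeff (i.elim t u) = 0 := by
  cases i
  exacts [ht, hu _]

/-- `applyD` as a ring homomorphism. -/
def applyDHom [Finite σ] (D : R →+* PowerSeries R) (u : σ → MvPowerSeries τ R)
    (t : MvPowerSeries τ R) (hu : ∀ i, constantCoeff (u i) = 0) (ht : constantCoeff t = 0) :
    MvPowerSeries σ R →+* MvPowerSeries τ R :=
  (substHom (fun i : Option σ => i.elim t u) (elim_constantCoeff hu ht)).comp (adjoinParamHom D)

theorem applyDHom_apply [Finite σ] (D : R →+* PowerSeries R) {u : σ → MvPowerSeries τ R}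
    {t : MvPowerSeries τ R} (hu : ∀ i, constantCoeff (u i) = 0) (ht : constantCoeff t = 0)
    (g : MvPowerSeries σ R) : applyDHom D u t hu ht g = applyD D u t g :=
  substHom_apply _ (elim_constantCoeff hu ht) _

theorem adjoinParam_C (D : R →+* PowerSeries R) (a : R) :
    adjoinParam D (C a : MvPowerSeries σ R) =
      PowerSeries.subst (X none : MvPowerSeries (Option σ) R) (D a) := by
  classical
  ext n
  rw [coeff_adjoinParam, PowerSeries.coeff_subst_single, coeff_C]
  by_cases h : n.some = 0
  · rw [if_pos h, if_pos]
    ext (_ | i)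
    · simp
    · simpa using DFunLike.congr_fun h i
  · rw [if_neg h, map_zero, map_zero, if_neg]
    intro h'
    rw [h'] at h
    exact h (by simp)

theorem adjoinParam_X (D : R →+* PowerSeries R) (i : σ) :
    adjoinParam D (X i : MvPowerSeries σ R) = X (some i) := by
  classical
  ext n
  rw [coeff_adjoinParam, coeff_X, coeff_X]
  by_cases h : n.some = Finsupp.single i 1
  · rw [if_pos h, map_one, PowerSeries.coeff_one]
    refine if_congr ⟨fun h' => ?_, fun h' => by rw [h']; simp⟩ rfl rfl
    ext (_ | j)
    · simpa using h'
    · simpa [Finsupp.single_apply] using DFunLike.congr_fun h j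
  · rw [if_neg h, map_zero, map_zero, if_neg]
    rintro rfl
    exact h (by simp)

theorem applyD_C [Finite σ] (D : R →+* PowerSeries R) {u : σ → MvPowerSeries τ R}
    {t : MvPowerSeries τ R} (hu : ∀ i, constantCoeff (u i) = 0) (ht : constantCoeff t = 0) (a : R) :
    applyD D u t (C a) = PowerSeries.subst t (D a) := by
  have h := hasSubst_of_constantCoeff_zero (elim_constantCoeff hu ht)
  rw [applyD, adjoinParam_C, PowerSeries.subst, subst_comp_subst_apply
    (PowerSeries.HasSubst.X _).const h, PowerSeries.subst]
  congr 1
  funext _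
  exact subst_X h none

theorem applyD_X [Finite σ] (D : R →+* PowerSeries R) {u : σ → MvPowerSeries τ R}
    {t : MvPowerSeries τ R} (hu : ∀ i, constantCoeff (u i) = 0) (ht : constantCoeff t = 0) (i : σ) :
    applyD D u t (X i) = u i := by
  rw [applyD, adjoinParam_X, subst_X (hasSubst_of_constantCoeff_zero (elim_constantCoeff hu ht))]
  rfl

theorem constantCoeff_applyD [Finite σ] (D : R →+* PowerSeries R)
    {u : σ → MvPowerSeries τ R}
    {t : MvPowerSeries τ R} (hu : ∀ i, constantCoeff (u i) = 0) (ht : constantCoeff t = 0)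
    {g : MvPowerSeries σ R} (hg : constantCoeff g = 0) : constantCoeff (applyD D u t g) = 0 := by
  refine constantCoeff_subst_zero (elim_constantCoeff hu ht) ?_
  rw [← coeff_zero_eq_constantCoeff_apply, coeff_adjoinParam, Finsupp.some_zero,
    coeff_zero_eq_constantCoeff_apply, hg, map_zero, map_zero]

/-- `D_t` of a composite of power series. -/
theorem applyD_subst [Finite σ] [Finite υ] (D : R →+* PowerSeries R) {u : σ → MvPowerSeries τ R}
    {t : MvPowerSeries τ R} (hu : ∀ i, constantCoeff (u i) = 0) (ht : constantCoeff t = 0)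
    {a : υ → MvPowerSeries σ R} (ha : ∀ i, constantCoeff (a i) = 0) (g : MvPowerSeries υ R) :
    applyD D u t (g.subst a) = applyD D (fun i => applyD D u t (a i)) t g := by
  have h (i : υ) := constantCoeff_applyD D hu ht (ha i)
  have hs := hasSubst_of_constantCoeff_zero ha
  rw [← applyDHom_apply D hu ht, ← applyDHom_apply D h ht, ← substHom_apply a ha]
  refine ringHom_congr (L := (applyDHom D u t hu ht).comp (substHom a ha)) (fun c => ?_)
    (fun i => ?_) (fun i => ?_) g
  · rw [RingHom.comp_apply, substHom_apply, subst_C, applyDHom_apply, applyDHom_apply,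
      applyD_C D hu ht, applyD_C D h ht]
  · rw [RingHom.comp_apply, substHom_apply, subst_X hs, applyDHom_apply, applyDHom_apply,
      applyD_X D h ht]
  · rw [RingHom.comp_apply, substHom_apply, subst_X hs, applyDHom_apply]
    exact h i

/-- Substitution in the value of `D_t` on a power series. -/
theorem subst_applyD [Finite σ] [Finite τ] (D : R →+* PowerSeries R) {u : σ → MvPowerSeries τ R}
    {t : MvPowerSeries τ R} (hu : ∀ i, constantCoeff (u i) = 0) (ht : constantCoeff t = 0)
    {b : τ → MvPowerSeries υ R} (hb : ∀ i, constantCoeff (b i) = 0) (g : MvPowerSeries σ R) :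
    (applyD D u t g).subst b = applyD D (fun i => (u i).subst b) (t.subst b) g := by
  rw [applyD, subst_comp_subst_apply (hasSubst_of_constantCoeff_zero (elim_constantCoeff hu ht))
    (hasSubst_of_constantCoeff_zero hb), applyD]
  congr 1
  funext i
  cases i <;> rfl

/-- `applyD` for a change of the parameter. -/
theorem applyD_substParam [Finite σ] {D D' : R →+* PowerSeries R} {k : PowerSeries R}
    (hk : PowerSeries.constantCoeff k = 0) (hD : ∀ a, D' a = PowerSeries.subst k (D a))
    {u : σ → MvPowerSeries τ R}
    {t : MvPowerSeries τ R} (hu : ∀ i, constantCoeff (u i) = 0) (ht : constantCoeff t = 0)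
    (g : MvPowerSeries σ R) :
    applyD D' u t g = applyD D u (PowerSeries.subst t k) g := by
  have hkt : constantCoeff (PowerSeries.subst t k) = 0 :=
    PowerSeries.constantCoeff_subst_eq_zero ht _ hk
  rw [← applyDHom_apply D' hu ht, ← applyDHom_apply D hu hkt]
  refine ringHom_congr (fun c => ?_) (fun i => ?_) (fun i => ?_) g
  · rw [applyDHom_apply, applyDHom_apply, applyD_C D' hu ht, applyD_C D hu hkt, hD,
      PowerSeries.subst_comp_subst_apply (PowerSeries.HasSubst.of_constantCoeff_zero' hk)
      (PowerSeries.HasSubst.of_constantCoeff_zero ht)]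
  · rw [applyDHom_apply, applyDHom_apply, applyD_X D' hu ht, applyD_X D hu hkt]
  · rw [applyDHom_apply, applyD_X D' hu ht, hu]

/-- The expansion of a power series in one variable under a ring homomorphism. -/
theorem exists_ringHom_eq_sum {W : Type*} [CommRing W] (L : PowerSeries R →+* W)
    (g : PowerSeries R) (n : ℕ) :
    ∃ q, L g = ∑ j ∈ Finset.range n, L (PowerSeries.C (PowerSeries.coeff j g)) *
      L PowerSeries.X ^ j + L PowerSeries.X ^ n * q := by
  obtain ⟨q, hq⟩ : (PowerSeries.X ^ n : PowerSeries R) ∣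
      g - ∑ j ∈ Finset.range n, PowerSeries.C (PowerSeries.coeff j g) * PowerSeries.X ^ j := by
    rw [PowerSeries.X_pow_dvd_iff]
    intro m hm
    rw [map_sub, map_sum, Finset.sum_eq_single m]
    · simp
    · intro j _ hj
      simp [PowerSeries.coeff_X_pow, hj.symm]
    · exact fun h => absurd (Finset.mem_range.mpr hm) h
  refine ⟨L q, ?_⟩
  have := congrArg L (sub_eq_iff_eq_add'.mp hq)
  simpa only [map_add, map_sum, map_mul, map_pow] using this

/-- A series in powers of a regular element has unique coefficients. -/
theorem eq_zero_of_forall_pow_dvd_sum {V W : Type*} [CommRing V] [CommRing W] (i : V →+* W)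
    (e : W →+* V) (hie : ∀ v, e (i v) = v) {N : W} (hN : IsLeftRegular N) (heN : e N = 0)
    {d : ℕ → V} (h : ∀ n, N ^ n ∣ ∑ j ∈ Finset.range n, i (d j) * N ^ j) (j : ℕ) : d j = 0 := by
  induction j using Nat.strong_induction_on with
  | _ j ih =>
    obtain ⟨q, hq⟩ := h (j + 1)
    -- The earlier coefficients vanish by induction, so `N^(j+1)` divides `i(d_j) N^j`. Cancelling
    -- `N^j` and applying `e`, which kills `N`, leaves `d_j = 0`.
    rw [Finset.sum_range_succ, Finset.sum_eq_zero fun m hm => by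
      rw [ih m (Finset.mem_range.mp hm), map_zero, zero_mul], zero_add, pow_succ, mul_assoc,
      mul_comm (i (d j))] at hq
    have := congrArg e ((hN.pow j) hq)
    rwa [hie, map_mul, heN, zero_mul] at this

end applyD

/-! ### Formal group laws and series without constant term -/

section law

open MvPowerSeries

variable {R S σ τ υ : Type*} [CommRing R] [CommRing S]

theorem constantCoeff_vec {a b : MvPowerSeries τ R} (ha : constantCoeff a = 0)
    (hb : constantCoeff b = 0) (i : Fin 2) : constantCoeff (![a, b] i) = 0 := by
  fin_cases i
  exacts [ha, hb]

theorem constantCoeff_vec₃ {a b c : MvPowerSeries τ R} (ha : constantCoeff a = 0)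
    (hb : constantCoeff b = 0) (hc : constantCoeff c = 0) (i : Fin 3) :
    constantCoeff (![a, b, c] i) = 0 := by
  fin_cases i
  exacts [ha, hb, hc]

theorem constantCoeff_powerSeries_subst {k : PowerSeries R} (hk : PowerSeries.constantCoeff k = 0)
    {a : MvPowerSeries τ R} (ha : constantCoeff a = 0) :
    constantCoeff (PowerSeries.subst a k) = 0 :=
  PowerSeries.constantCoeff_subst_eq_zero ha _ hk

theorem powerSeries_subst_subst [Finite σ] {a : MvPowerSeries σ R} (ha : constantCoeff a = 0)
    {c : σ → MvPowerSeries τ R} (hc : ∀ i, constantCoeff (c i) = 0) (k : PowerSeries R) :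
    (PowerSeries.subst a k).subst c = PowerSeries.subst (a.subst c) k := by
  rw [PowerSeries.subst, subst_comp_subst_apply (PowerSeries.HasSubst.of_constantCoeff_zero ha).const
    (hasSubst_of_constantCoeff_zero hc), PowerSeries.subst]

theorem applyD_powerSeries_subst [Finite σ] (D : R →+* PowerSeries R) {u : σ → MvPowerSeries τ R}
    {t : MvPowerSeries τ R} (hu : ∀ i, constantCoeff (u i) = 0) (ht : constantCoeff t = 0)
    {a : MvPowerSeries σ R} (ha : constantCoeff a = 0) (k : PowerSeries R) :
    applyD D u t (PowerSeries.subst a k) = applyD D (fun _ : Unit => applyD D u t a) t k :=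
  applyD_subst D hu ht (fun _ => ha) k

theorem powerSeries_subst_mul [Finite σ] {c : σ → MvPowerSeries τ R}
    (hc : ∀ i, constantCoeff (c i) = 0) (a b : MvPowerSeries σ R) :
    (a * b).subst c = a.subst c * b.subst c :=
  subst_mul (hasSubst_of_constantCoeff_zero hc) a b

namespace FormalGroup

variable (F : FormalGroup R)

theorem constantCoeff_eval₂ {a b : MvPowerSeries τ R} (ha : constantCoeff a = 0)
    (hb : constantCoeff b = 0) : constantCoeff (F.eval₂ a b) = 0 :=
  constantCoeff_subst_zero (constantCoeff_vec ha hb) F.zero_constantCoeff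

theorem constantCoeff_isogeny {a : MvPowerSeries τ R} (ha : constantCoeff a = 0)
    (b : MvPowerSeries τ R) : constantCoeff (F.isogeny a b) = 0 := by
  rw [isogeny, map_mul, ha, zero_mul]

theorem subst_eval₂ [Finite σ] {a b : MvPowerSeries σ R} (ha : constantCoeff a = 0)
    (hb : constantCoeff b = 0) {c : σ → MvPowerSeries τ R} (hc : ∀ i, constantCoeff (c i) = 0) :
    (F.eval₂ a b).subst c = F.eval₂ (a.subst c) (b.subst c) := by
  rw [eval₂, subst_comp_subst_apply (hasSubst_of_constantCoeff_zero (constantCoeff_vec ha hb))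
    (hasSubst_of_constantCoeff_zero hc), eval₂]
  congr 1
  funext i
  fin_cases i <;> rfl

theorem subst_isogeny [Finite σ] {a b : MvPowerSeries σ R} (ha : constantCoeff a = 0)
    (hb : constantCoeff b = 0) {c : σ → MvPowerSeries τ R} (hc : ∀ i, constantCoeff (c i) = 0) :
    (F.isogeny a b).subst c = F.isogeny (a.subst c) (b.subst c) := by
  rw [isogeny, powerSeries_subst_mul hc, F.subst_eval₂ ha hb hc, isogeny]

theorem eval₂_X : F.eval₂ (X 0) (X 1) = F.toPowerSeries := by
  have : (![X 0, X 1] : Fin 2 → MvPowerSeries (Fin 2) R) = X := by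
    funext i; fin_cases i <;> rfl
  rw [eval₂, this, subst_self]
  rfl

/-- This says that `k` is a homomorphism from `F` to its conjugate. Together with its converse
`eq_conj` it allows conjugates to be handled without unfolding the inverse series. -/
theorem conj_eval₂ (k : PowerSeries R) (hk : PowerSeries.constantCoeff k = 0)
    (hk' : IsUnit (PowerSeries.coeff 1 k)) {a b : MvPowerSeries τ R} (ha : constantCoeff a = 0)
    (hb : constantCoeff b = 0) :
    (F.conj k hk hk').eval₂ (PowerSeries.subst a k) (PowerSeries.subst b k) =
      PowerSeries.subst (F.eval₂ a b) k := by
  have ha' := PowerSeries.HasSubst.of_constantCoeff_zero ha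
  have hb' := PowerSeries.HasSubst.of_constantCoeff_zero hb
  change (F.conjSeries k (k.substInvOfIsUnit hk')).subst _ = _
  rw [F.conjSeries_subst (k.constantCoeff_substInvOfIsUnit hk') (hasSubst_subst hk ha')
    (hasSubst_subst hk hb'), subst_subst hk (k.subst_substInvOfIsUnit_left hk hk') ha',
    subst_subst hk (k.subst_substInvOfIsUnit_left hk hk') hb']

theorem conj_isogeny (k : PowerSeries R) (hk : PowerSeries.constantCoeff k = 0)
    (hk' : IsUnit (PowerSeries.coeff 1 k)) {a b : MvPowerSeries τ R} (ha : constantCoeff a = 0)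
    (hb : constantCoeff b = 0) :
    (F.conj k hk hk').isogeny (PowerSeries.subst a k) (PowerSeries.subst b k) =
      PowerSeries.subst a k * PowerSeries.subst (F.eval₂ a b) k := by
  rw [isogeny, conj_eval₂ F k hk hk' ha hb]

theorem subst_inv_subst (k : PowerSeries R) (hk : PowerSeries.constantCoeff k = 0)
    (hk' : IsUnit (PowerSeries.coeff 1 k)) {a : MvPowerSeries τ R} (ha : constantCoeff a = 0) :
    PowerSeries.subst (PowerSeries.subst a k) (k.substInvOfIsUnit hk') = a :=
  subst_subst hk (k.subst_substInvOfIsUnit_left hk hk')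
    (PowerSeries.HasSubst.of_constantCoeff_zero ha)

theorem subst_subst_inv (k : PowerSeries R) (hk : PowerSeries.constantCoeff k = 0)
    (hk' : IsUnit (PowerSeries.coeff 1 k)) {a : MvPowerSeries τ R} (ha : constantCoeff a = 0) :
    PowerSeries.subst (PowerSeries.subst a (k.substInvOfIsUnit hk')) k = a :=
  subst_subst (k.constantCoeff_substInvOfIsUnit hk') (k.subst_substInvOfIsUnit_right hk hk')
    (PowerSeries.HasSubst.of_constantCoeff_zero ha)

/-- The conjugate of `F` by `k` is the only formal group law for which `k` is a homomorphism. -/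
theorem eq_conj {F G : FormalGroup R} (k : PowerSeries R) (hk : PowerSeries.constantCoeff k = 0)
    (hk' : IsUnit (PowerSeries.coeff 1 k))
    (h : G.eval₂ (PowerSeries.subst (X 0 : MvPowerSeries (Fin 2) R) k)
      (PowerSeries.subst (X 1) k) = PowerSeries.subst (F.eval₂ (X 0) (X 1)) k) :
    G = F.conj k hk hk' := by
  have hX (i : Fin 2) : constantCoeff (X i : MvPowerSeries (Fin 2) R) = 0 := constantCoeff_X i
  have hq := k.constantCoeff_substInvOfIsUnit hk'
  have hc := constantCoeff_vec (constantCoeff_powerSeries_subst hq (hX 0))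
    (constantCoeff_powerSeries_subst hq (hX 1))
  have hcs := hasSubst_of_constantCoeff_zero hc
  -- Both laws agree at the points `k(x)`, `k(y)`; putting `k⁻¹(x)`, `k⁻¹(y)` for `x`, `y` makes
  -- these points generic.
  have h' := congrArg (MvPowerSeries.subst ![PowerSeries.subst (X 0 : MvPowerSeries (Fin 2) R)
    (k.substInvOfIsUnit hk'), PowerSeries.subst (X 1) (k.substInvOfIsUnit hk')])
    (h.trans (F.conj_eval₂ k hk hk' (hX 0) (hX 1)).symm)
  have hk0 (i : Fin 2) := constantCoeff_powerSeries_subst hk (hX i)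
  rw [subst_eval₂ _ (hk0 0) (hk0 1) hc, subst_eval₂ _ (hk0 0) (hk0 1) hc,
    powerSeries_subst_subst (hX 0) hc, powerSeries_subst_subst (hX 1) hc, subst_X hcs, subst_X hcs]
    at h'
  change G.eval₂ (PowerSeries.subst (PowerSeries.subst _ _) k)
    (PowerSeries.subst (PowerSeries.subst _ _) k) = (F.conj k hk hk').eval₂
    (PowerSeries.subst (PowerSeries.subst _ _) k)
    (PowerSeries.subst (PowerSeries.subst _ _) k) at h'
  rw [subst_subst_inv k hk hk' (hX 0), subst_subst_inv k hk hk' (hX 1), eval₂_X, eval₂_X] at h'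
  exact FormalGroup.ext h'

end FormalGroup

end law

/-! ### D-structures and multiplicative series -/

namespace DStructure

open MvPowerSeries

variable {R S σ τ υ : Type*} [CommRing R] [CommRing S] {F : FormalGroup R} (𝒟 : DStructure R F)

/-- The axiom is an identity between series in indeterminates, and substitution passes through
`applyD`; so it may be evaluated at any series without constant term. -/
theorem D_law_at {x y t : MvPowerSeries τ R} (hx : constantCoeff x = 0) (hy : constantCoeff y = 0)
    (ht : constantCoeff t = 0) :
    applyD 𝒟.D ![F.isogeny x t, F.isogeny y t] t F.toPowerSeries =
      F.isogeny (F.eval₂ x y) t := by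
  have hX (i : Fin 3) : constantCoeff (X i : MvPowerSeries (Fin 3) R) = 0 := constantCoeff_X i
  have hc := constantCoeff_vec₃ hx hy ht
  have hcs := hasSubst_of_constantCoeff_zero hc
  have h := congrArg (MvPowerSeries.subst ![x, y, t]) 𝒟.D_law
  rw [subst_applyD 𝒟.D (constantCoeff_vec (F.constantCoeff_isogeny (hX 0) _)
    (F.constantCoeff_isogeny (hX 1) _)) (hX 2) hc,
    F.subst_isogeny (F.constantCoeff_eval₂ (hX 0) (hX 1)) (hX 2) hc,
    F.subst_eval₂ (hX 0) (hX 1) hc, subst_X hcs, subst_X hcs, subst_X hcs] at h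
  refine Eq.trans ?_ h
  congr 1
  funext i
  fin_cases i
  · change F.isogeny x t = (F.isogeny (X 0) (X 2)).subst _
    rw [F.subst_isogeny (hX 0) (hX 2) hc, subst_X hcs, subst_X hcs]
    rfl
  · change F.isogeny y t = (F.isogeny (X 1) (X 2)).subst _
    rw [F.subst_isogeny (hX 1) (hX 2) hc, subst_X hcs, subst_X hcs]
    rfl

theorem D_symm_at {s t : MvPowerSeries τ R} (hs : constantCoeff s = 0)
    (ht : constantCoeff t = 0) (a : R) :
    applyD 𝒟.D (fun _ : Unit => F.isogeny t s) s (𝒟.D a) =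
      applyD 𝒟.D (fun _ : Unit => F.isogeny s t) t (𝒟.D a) := by
  have hX (i : Fin 2) : constantCoeff (X i : MvPowerSeries (Fin 2) R) = 0 := constantCoeff_X i
  have hc := constantCoeff_vec hs ht
  have hcs := hasSubst_of_constantCoeff_zero hc
  have h := congrArg (MvPowerSeries.subst ![s, t]) (𝒟.D_symm a)
  rw [subst_applyD 𝒟.D (fun _ => F.constantCoeff_isogeny (hX 1) _) (hX 0) hc,
    subst_applyD 𝒟.D (fun _ => F.constantCoeff_isogeny (hX 0) _) (hX 1) hc,
    F.subst_isogeny (hX 0) (hX 1) hc, F.subst_isogeny (hX 1) (hX 0) hc,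
    subst_X hcs, subst_X hcs] at h
  exact h

/-- The series `k` satisfies `D_t(k)(x F(x, t)) = k(x) k(F(x, t))`. -/
def IsMultiplicative (k : PowerSeries R) : Prop :=
  applyD 𝒟.D (fun _ : Unit => F.isogeny (X 0) (X 1 : MvPowerSeries (Fin 2) R)) (X 1) k =
    PowerSeries.subst (X 0) k * PowerSeries.subst (F.eval₂ (X 0) (X 1)) k

variable {𝒟}

theorem IsMultiplicative.applyD_eq {k : PowerSeries R} (h : 𝒟.IsMultiplicative k)
    {x t : MvPowerSeries τ R} (hx : constantCoeff x = 0) (ht : constantCoeff t = 0) :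
    applyD 𝒟.D (fun _ : Unit => F.isogeny x t) t k =
      PowerSeries.subst x k * PowerSeries.subst (F.eval₂ x t) k := by
  have hX (i : Fin 2) : constantCoeff (X i : MvPowerSeries (Fin 2) R) = 0 := constantCoeff_X i
  have hc := constantCoeff_vec hx ht
  have hcs := hasSubst_of_constantCoeff_zero hc
  have h := congrArg (MvPowerSeries.subst ![x, t]) h
  rw [subst_applyD 𝒟.D (fun _ => F.constantCoeff_isogeny (hX 0) _) (hX 1) hc,
    F.subst_isogeny (hX 0) (hX 1) hc, powerSeries_subst_mul hc,
    powerSeries_subst_subst (hX 0) hc,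
    powerSeries_subst_subst (F.constantCoeff_eval₂ (hX 0) (hX 1)) hc,
    F.subst_eval₂ (hX 0) (hX 1) hc, subst_X hcs, subst_X hcs] at h
  exact h

theorem isMultiplicative_X : 𝒟.IsMultiplicative PowerSeries.X := by
  have hX (i : Fin 2) : constantCoeff (X i : MvPowerSeries (Fin 2) R) = 0 := constantCoeff_X i
  rw [IsMultiplicative, PowerSeries.subst_X (PowerSeries.HasSubst.X _), PowerSeries.subst_X
    (PowerSeries.HasSubst.of_constantCoeff_zero (F.constantCoeff_eval₂ (hX 0) (hX 1)))]
  exact applyD_X 𝒟.D (fun _ => F.constantCoeff_isogeny (hX 0) _) (hX 1) ()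

/-! ### Change of the parameter of a D-structure along a multiplicative series -/

section twist

variable (𝒟) {k : PowerSeries R}

theorem hasSubst_inv {k : PowerSeries R} (hk' : IsUnit (PowerSeries.coeff 1 k)) :
    PowerSeries.HasSubst (k.substInvOfIsUnit hk') :=
  PowerSeries.HasSubst.of_constantCoeff_zero' (k.constantCoeff_substInvOfIsUnit hk')

/-- The operation `D_{k⁻¹(t)}`. -/
def twistD (hk' : IsUnit (PowerSeries.coeff 1 k)) : R →+* PowerSeries R :=
  (PowerSeries.substAlgHom (hasSubst_inv hk')).toRingHom.comp 𝒟.D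

theorem twistD_apply (hk' : IsUnit (PowerSeries.coeff 1 k)) (a : R) :
    𝒟.twistD hk' a = PowerSeries.subst (k.substInvOfIsUnit hk') (𝒟.D a) :=
  congrFun (PowerSeries.coe_substAlgHom (hasSubst_inv hk')) (𝒟.D a)

/-- Since `k⁻¹(k(t)) = t`, the twisted operation at the parameter `k(t)` is the original one at `t`.
For this reason the axioms of the twist are checked at points `k(x)`, `k(t)` and only afterwards
specialised to `x = k⁻¹(X)`. -/
theorem applyD_twistD [Finite σ] (hk : PowerSeries.constantCoeff k = 0)
    (hk' : IsUnit (PowerSeries.coeff 1 k))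
    {u : σ → MvPowerSeries τ R} {t : MvPowerSeries τ R}
    (hu : ∀ i, constantCoeff (u i) = 0) (ht : constantCoeff t = 0) (g : MvPowerSeries σ R) :
    applyD (𝒟.twistD hk') u (PowerSeries.subst t k) g = applyD 𝒟.D u t g := by
  rw [applyD_substParam (k.constantCoeff_substInvOfIsUnit hk') (𝒟.twistD_apply hk') hu
    (constantCoeff_powerSeries_subst hk ht), FormalGroup.subst_inv_subst k hk hk' ht]

variable {𝒟}

/-- Let `G` be the conjugate law. Apply `D_t` to `G(k(X), k(Y)) = k(F(X, Y))` at `X = x F(x, t)`, `Y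
= y F(y, t)`. By multiplicativity `D_t(k)` takes the isogeny of `F` to the isogeny of `G` at `k(x)`,
`k(t)`, and the axiom for `F` evaluates the right-hand side. -/
theorem twist_D_law_aux (hk : PowerSeries.constantCoeff k = 0)
    (hk' : IsUnit (PowerSeries.coeff 1 k)) (hm : 𝒟.IsMultiplicative k)
    {x y t : MvPowerSeries τ R} (hx : constantCoeff x = 0)
    (hy : constantCoeff y = 0) (ht : constantCoeff t = 0) :
    applyD (𝒟.twistD hk') ![(F.conj k hk hk').isogeny (PowerSeries.subst x k)
        (PowerSeries.subst t k), (F.conj k hk hk').isogeny (PowerSeries.subst y k)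
        (PowerSeries.subst t k)] (PowerSeries.subst t k) (F.conj k hk hk').toPowerSeries =
      (F.conj k hk hk').isogeny ((F.conj k hk hk').eval₂ (PowerSeries.subst x k)
        (PowerSeries.subst y k)) (PowerSeries.subst t k) := by
  have hX (i : Fin 2) : constantCoeff (X i : MvPowerSeries (Fin 2) R) = 0 := constantCoeff_X i
  have hv := constantCoeff_vec (F.constantCoeff_isogeny hx t) (F.constantCoeff_isogeny hy t)
  have hxy := F.constantCoeff_eval₂ hx hy
  have h0 : applyD 𝒟.D ![F.isogeny x t, F.isogeny y t] t (PowerSeries.subst (X 0) k) =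
      PowerSeries.subst x k * PowerSeries.subst (F.eval₂ x t) k := by
    rw [applyD_powerSeries_subst 𝒟.D hv ht (hX 0), applyD_X 𝒟.D hv ht]
    exact hm.applyD_eq hx ht
  have h1 : applyD 𝒟.D ![F.isogeny x t, F.isogeny y t] t (PowerSeries.subst (X 1) k) =
      PowerSeries.subst y k * PowerSeries.subst (F.eval₂ y t) k := by
    rw [applyD_powerSeries_subst 𝒟.D hv ht (hX 1), applyD_X 𝒟.D hv ht]
    exact hm.applyD_eq hy ht
  have hkX := constantCoeff_vec (constantCoeff_powerSeries_subst hk (hX 0))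
    (constantCoeff_powerSeries_subst hk (hX 1))
  rw [F.conj_isogeny k hk hk' hx ht, F.conj_isogeny k hk hk' hy ht, F.conj_eval₂ k hk hk' hx hy,
    F.conj_isogeny k hk hk' hxy ht, ← h0, ← h1]
  have hvec : (![applyD 𝒟.D ![F.isogeny x t, F.isogeny y t] t (PowerSeries.subst (X 0) k),
      applyD 𝒟.D ![F.isogeny x t, F.isogeny y t] t (PowerSeries.subst (X 1) k)] :
        Fin 2 → MvPowerSeries τ R) = fun i =>
      applyD 𝒟.D ![F.isogeny x t, F.isogeny y t] t
        ((![PowerSeries.subst (X 0) k, PowerSeries.subst (X 1) k] :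
          Fin 2 → MvPowerSeries (Fin 2) R) i) := by
    funext i; fin_cases i <;> rfl
  -- The two arguments are now values of `D_t` on `k(X 0)` and `k(X 1)`, so the left side collapses
  -- to `D_t` of a single composite series.
  rw [hvec, 𝒟.applyD_twistD hk hk' (fun i => constantCoeff_applyD 𝒟.D hv ht (hkX i)) ht,
    ← applyD_subst 𝒟.D hv ht hkX]
  change applyD 𝒟.D _ t ((F.conj k hk hk').eval₂ _ _) = _
  rw [F.conj_eval₂ k hk hk' (hX 0) (hX 1),
    applyD_powerSeries_subst 𝒟.D hv ht (F.constantCoeff_eval₂ (hX 0) (hX 1)), F.eval₂_X,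
    𝒟.D_law_at hx hy ht, hm.applyD_eq hxy ht]

/-- Apply `D_t` to `k⁻¹(k(X)) = X` at `X = x F(x, t)`. -/
theorem applyD_inv (hk : PowerSeries.constantCoeff k = 0)
    (hk' : IsUnit (PowerSeries.coeff 1 k)) (hm : 𝒟.IsMultiplicative k)
    {x t : MvPowerSeries τ R} (hx : constantCoeff x = 0)
    (ht : constantCoeff t = 0) :
    applyD 𝒟.D (fun _ : Unit => PowerSeries.subst x k * PowerSeries.subst (F.eval₂ x t) k) t
      (k.substInvOfIsUnit hk') = F.isogeny x t := by
  have hi := F.constantCoeff_isogeny hx t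
  rw [← hm.applyD_eq hx ht, ← applyD_powerSeries_subst 𝒟.D (fun _ => hi) ht hk,
    k.subst_substInvOfIsUnit_left hk hk']
  exact applyD_X 𝒟.D (fun _ => hi) ht ()

/-- In the parameters `k(s)`, `k(t)` the twisted double operation is the untwisted one in `s`, `t`:
the values of `D_s` on the coefficients of `k⁻¹` turn the conjugate isogeny back into that of `F`.
Symmetry is thereby inherited. -/
theorem twist_D_symm_aux (hk : PowerSeries.constantCoeff k = 0)
    (hk' : IsUnit (PowerSeries.coeff 1 k)) (hm : 𝒟.IsMultiplicative k)
    {s t : MvPowerSeries τ R} (hs : constantCoeff s = 0)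
    (ht : constantCoeff t = 0) (a : R) :
    applyD (𝒟.twistD hk') (fun _ : Unit => (F.conj k hk hk').isogeny (PowerSeries.subst t k)
        (PowerSeries.subst s k)) (PowerSeries.subst s k) (𝒟.twistD hk' a) =
      applyD 𝒟.D (fun _ : Unit => F.isogeny t s) s (𝒟.D a) := by
  have hi := (F.conj k hk hk').constantCoeff_isogeny (constantCoeff_powerSeries_subst hk ht)
    (PowerSeries.subst s k)
  rw [𝒟.applyD_twistD hk hk' (fun _ => hi) hs, twistD_apply,
    applyD_powerSeries_subst 𝒟.D (fun _ => hi) hs (k.constantCoeff_substInvOfIsUnit hk'),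
    F.conj_isogeny k hk hk' ht hs, applyD_inv hk hk' hm ht hs]

/-- The D-structure with the operation `D_{k⁻¹(t)}` and the formal group law conjugate under `k`. -/
def twist (hk : PowerSeries.constantCoeff k = 0)
    (hk' : IsUnit (PowerSeries.coeff 1 k)) (hm : 𝒟.IsMultiplicative k)
    : DStructure R (F.conj k hk hk') where
  D := 𝒟.twistD hk'
  constantCoeff_D a := by
    rw [twistD_apply]
    change MvPowerSeries.constantCoeff _ = _
    rw [PowerSeries.constantCoeff_subst (hasSubst_inv hk'),
      finsum_eq_single _ 0, pow_zero, PowerSeries.coeff_zero_eq_constantCoeff_apply,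
      𝒟.constantCoeff_D]
    · simp
    · intro n hn
      have := k.constantCoeff_substInvOfIsUnit hk'
      rw [map_pow]
      change _ • (PowerSeries.constantCoeff _) ^ n = _
      rw [this, zero_pow hn, smul_zero]
  D_law := by
    have hX (i : Fin 3) : constantCoeff (X i : MvPowerSeries (Fin 3) R) = 0 := constantCoeff_X i
    have hq (i : Fin 3) := constantCoeff_powerSeries_subst (k.constantCoeff_substInvOfIsUnit hk')
      (hX i)
    -- At `x = k⁻¹(X)` every `k(x)` becomes an indeterminate again.
    have h := twist_D_law_aux hk hk' hm (hq 0) (hq 1) (hq 2)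
    simp only [FormalGroup.subst_subst_inv k hk hk' (hX _)] at h
    exact h
  D_symm a := by
    have hX (i : Fin 2) : constantCoeff (X i : MvPowerSeries (Fin 2) R) = 0 := constantCoeff_X i
    have hq (i : Fin 2) := constantCoeff_powerSeries_subst (k.constantCoeff_substInvOfIsUnit hk')
      (hX i)
    have h := (twist_D_symm_aux hk hk' hm (hq 0) (hq 1) a).trans <|
      (𝒟.D_symm_at (hq 0) (hq 1) a).trans (twist_D_symm_aux hk hk' hm (hq 1) (hq 0) a).symm
    simp only [FormalGroup.subst_subst_inv k hk hk' (hX _)] at h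
    exact h

theorem twist_D_apply (hk : PowerSeries.constantCoeff k = 0)
    (hk' : IsUnit (PowerSeries.coeff 1 k)) (hm : 𝒟.IsMultiplicative k)
    (a : R) : (twist hk hk' hm).D a =
    PowerSeries.subst (k.substInvOfIsUnit hk') (𝒟.D a) := 𝒟.twistD_apply hk' a

theorem subst_twist_D (hk : PowerSeries.constantCoeff k = 0)
    (hk' : IsUnit (PowerSeries.coeff 1 k)) (hm : 𝒟.IsMultiplicative k)
    (a : R) : PowerSeries.subst k ((twist hk hk' hm).D a) = 𝒟.D a := by
  rw [twist_D_apply, PowerSeries.subst_comp_subst_apply (hasSubst_inv hk')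
    (PowerSeries.HasSubst.of_constantCoeff_zero' hk), k.subst_substInvOfIsUnit_left hk hk']
  exact PowerSeries.X_subst _

/-- At the points `k(x)`, `k(t)` the composite `l ∘ k⁻¹` takes the values of `l` at `x`, `t`, and
`applyD_inv` carries the conjugate isogeny back to that of `F`. The case `l = X` gives the
multiplicativity of `k⁻¹`; the general case serves iterated twists. -/
theorem IsMultiplicative.comp_inv (hk : PowerSeries.constantCoeff k = 0)
    (hk' : IsUnit (PowerSeries.coeff 1 k)) (hm : 𝒟.IsMultiplicative k)
    {l : PowerSeries R} (hl : 𝒟.IsMultiplicative l) :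
    (twist hk hk' hm).IsMultiplicative (PowerSeries.subst (k.substInvOfIsUnit hk') l) := by
  have hX (i : Fin 2) : constantCoeff (X i : MvPowerSeries (Fin 2) R) = 0 := constantCoeff_X i
  have hk₀ := k.constantCoeff_substInvOfIsUnit hk'
  have hq (i : Fin 2) := constantCoeff_powerSeries_subst hk₀ (hX i)
  have key {x t : MvPowerSeries (Fin 2) R} (hx : constantCoeff x = 0) (ht : constantCoeff t = 0) :
      applyD (𝒟.twistD hk') (fun _ : Unit => (F.conj k hk hk').isogeny (PowerSeries.subst x k)
        (PowerSeries.subst t k)) (PowerSeries.subst t k)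
        (PowerSeries.subst (k.substInvOfIsUnit hk') l) =
      PowerSeries.subst (PowerSeries.subst x k) (PowerSeries.subst (k.substInvOfIsUnit hk') l) *
      PowerSeries.subst ((F.conj k hk hk').eval₂ (PowerSeries.subst x k) (PowerSeries.subst t k))
        (PowerSeries.subst (k.substInvOfIsUnit hk') l) := by
    have hc {x : MvPowerSeries (Fin 2) R} (hx : constantCoeff x = 0) :
        PowerSeries.subst (PowerSeries.subst x k)
          (PowerSeries.subst (k.substInvOfIsUnit hk') l) = PowerSeries.subst x l := by
      rw [PowerSeries.subst_comp_subst_apply (hasSubst_inv hk')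
        (PowerSeries.HasSubst.of_constantCoeff_zero (constantCoeff_powerSeries_subst hk hx)),
        FormalGroup.subst_inv_subst k hk hk' hx]
    have hi := (F.conj k hk hk').constantCoeff_isogeny (constantCoeff_powerSeries_subst hk hx)
      (PowerSeries.subst t k)
    rw [𝒟.applyD_twistD hk hk' (fun _ => hi) ht, applyD_powerSeries_subst 𝒟.D (fun _ => hi) ht hk₀,
      F.conj_isogeny k hk hk' hx ht, applyD_inv hk hk' hm hx ht, hl.applyD_eq hx ht,
      F.conj_eval₂ k hk hk' hx ht, hc hx, hc (F.constantCoeff_eval₂ hx ht)]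
  have h := key (hq 0) (hq 1)
  simp only [FormalGroup.subst_subst_inv k hk hk' (hX _)] at h
  exact h

theorem IsMultiplicative.inv (hk : PowerSeries.constantCoeff k = 0)
    (hk' : IsUnit (PowerSeries.coeff 1 k)) (hm : 𝒟.IsMultiplicative k)
    : (twist hk hk' hm).IsMultiplicative (k.substInvOfIsUnit hk') := by
  have h := IsMultiplicative.comp_inv hk hk' hm isMultiplicative_X
  rwa [PowerSeries.subst_X (hasSubst_inv hk')] at h

end twist

/-- A homomorphism of rings with D-structures. -/
structure IsHom {G : FormalGroup S} (𝒟 : DStructure R F) (ℰ : DStructure S G) (α : R →+* S) :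
    Prop where
  map_law : F.map α = G
  map_D : ∀ a, PowerSeries.map α (𝒟.D a) = ℰ.D (α a)

theorem IsHom.comp {T : Type*} [CommRing T] {G : FormalGroup S} {H : FormalGroup T}
    {ℰ : DStructure S G} {ℋ : DStructure T H} {β : S →+* T} {α : R →+* S}
    (hβ : ℰ.IsHom ℋ β) (hα : 𝒟.IsHom ℰ α) : 𝒟.IsHom ℋ (β.comp α) where
  map_law := by
    rw [← hβ.map_law, ← hα.map_law]
    refine FormalGroup.ext ?_
    ext n
    rfl
  map_D a := by
    rw [RingHom.comp_apply, ← hβ.map_D, ← hα.map_D]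
    rfl

theorem IsHom.isMultiplicative_map {G : FormalGroup S} {ℰ : DStructure S G} {α : R →+* S}
    (hα : 𝒟.IsHom ℰ α) {k : PowerSeries R} (hk : 𝒟.IsMultiplicative k) :
    ℰ.IsMultiplicative (PowerSeries.map α k) := by
  have hX (i : Fin 2) : constantCoeff (X i : MvPowerSeries (Fin 2) R) = 0 := constantCoeff_X i
  have hX' (i : Fin 2) : PowerSeries.HasSubst (X i : MvPowerSeries (Fin 2) R) := .X i
  have h := congrArg (MvPowerSeries.map α) hk
  rw [map_applyD hα.map_D (fun _ => F.constantCoeff_isogeny (hX 0) _) (hX 1), map_mul,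
    FormalGroup.map_isogeny _ _ (hX' 0) (hX' 1), PowerSeries.map_subst (hX' 0),
    PowerSeries.map_subst (FormalGroup.hasSubst_eval₂ _ (hX' 0) (hX' 1)),
    FormalGroup.map_eval₂ _ _ (hX' 0) (hX' 1), hα.map_law] at h
  simp only [MvPowerSeries.map_X] at h
  exact h

theorem map_inv (α : R →+* S) {k : PowerSeries R} (hk : PowerSeries.constantCoeff k = 0)
    (hk' : IsUnit (PowerSeries.coeff 1 k)) {l : PowerSeries S} (h : PowerSeries.map α k = l)
    (hl' : IsUnit (PowerSeries.coeff 1 l)) :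
    PowerSeries.map α (k.substInvOfIsUnit hk') = l.substInvOfIsUnit hl' := by
  have hl : PowerSeries.constantCoeff l = 0 := by
    rw [← h, ← PowerSeries.coeff_zero_eq_constantCoeff_apply, PowerSeries.coeff_map,
      PowerSeries.coeff_zero_eq_constantCoeff_apply, hk, map_zero]
  have hz : PowerSeries.constantCoeff (PowerSeries.map α (k.substInvOfIsUnit hk')) = 0 := by
    rw [← PowerSeries.coeff_zero_eq_constantCoeff_apply, PowerSeries.coeff_map,
      PowerSeries.coeff_zero_eq_constantCoeff_apply, k.constantCoeff_substInvOfIsUnit hk', map_zero]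
  have h1 := congrArg (PowerSeries.map α) (k.subst_substInvOfIsUnit_right hk hk')
  have h2 : PowerSeries.map α (PowerSeries.subst (k.substInvOfIsUnit hk') k) =
      PowerSeries.subst (PowerSeries.map α (k.substInvOfIsUnit hk')) (PowerSeries.map α k) :=
    PowerSeries.map_subst (hasSubst_inv hk') k
  rw [h2, h, PowerSeries.map_X] at h1
  have h3 := FormalGroup.subst_inv_subst l hl hl' hz
  rw [h1] at h3
  exact h3.symm.trans (PowerSeries.X_subst _)

theorem map_conj (α : R →+* S) {k : PowerSeries R} (hk : PowerSeries.constantCoeff k = 0)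
    (hk' : IsUnit (PowerSeries.coeff 1 k)) {l : PowerSeries S} (h : PowerSeries.map α k = l)
    (hl : PowerSeries.constantCoeff l = 0)
    (hl' : IsUnit (PowerSeries.coeff 1 l)) (F : FormalGroup R) :
    (F.conj k hk hk').map α = (F.map α).conj l hl hl' := by
  have hX' (i : Fin 2) : PowerSeries.HasSubst (X i : MvPowerSeries (Fin 2) R) := .X i
  have hX (i : Fin 2) : constantCoeff (X i : MvPowerSeries (Fin 2) R) = 0 := constantCoeff_X i
  refine FormalGroup.eq_conj l hl hl' ?_
  have hkX (i : Fin 2) := PowerSeries.HasSubst.of_constantCoeff_zero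
    (constantCoeff_powerSeries_subst hk (hX i))
  have h1 := congrArg (MvPowerSeries.map α) (F.conj_eval₂ k hk hk' (hX 0) (hX 1))
  rw [FormalGroup.map_eval₂ _ _ (hkX 0) (hkX 1),
    PowerSeries.map_subst (FormalGroup.hasSubst_eval₂ _ (hX' 0) (hX' 1)),
    PowerSeries.map_subst (hX' 0), PowerSeries.map_subst (hX' 1),
    FormalGroup.map_eval₂ _ _ (hX' 0) (hX' 1)] at h1
  simp only [MvPowerSeries.map_X] at h1
  rw [← h]
  exact h1

theorem IsHom.twist {G : FormalGroup S} {ℰ : DStructure S G} {α : R →+* S}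
    (hα : 𝒟.IsHom ℰ α) {k : PowerSeries R} (hk : PowerSeries.constantCoeff k = 0)
    (hk' : IsUnit (PowerSeries.coeff 1 k)) (hm : 𝒟.IsMultiplicative k) {l : PowerSeries S}
    (h : PowerSeries.map α k = l) (hl : PowerSeries.constantCoeff l = 0)
    (hl' : IsUnit (PowerSeries.coeff 1 l)) (hm' : ℰ.IsMultiplicative l) :
    (DStructure.twist hk hk' hm).IsHom (DStructure.twist hl hl' hm') α where
  map_law := by rw [map_conj α hk hk' h hl hl', hα.map_law]
  map_D a := by
    rw [twist_D_apply, twist_D_apply, ← hα.map_D, ← map_inv α hk hk' h hl']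
    exact PowerSeries.map_subst (hasSubst_inv hk') _

end DStructure

/-! ### Regularity of the isogeny -/

namespace FormalGroup

open MvPowerSeries

variable {S τ : Type*} [CommRing S] {F : FormalGroup S}

theorem eval₂_eval₂_self (hF : F.IsOrderTwo) {c x : MvPowerSeries τ S}
    (hc : constantCoeff c = 0) (hx : constantCoeff x = 0) : F.eval₂ c (F.eval₂ c x) = x := by
  have hc' := PowerSeries.HasSubst.of_constantCoeff_zero hc
  have hx' := PowerSeries.HasSubst.of_constantCoeff_zero hx
  refine (F.assoc' hc' hc' hx').symm.trans ?_
  change F.toPowerSeries.subst ![F.eval₂ c c, x] = x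
  rw [eval₂_self hF hc']
  exact F.zero_add hx'

theorem eval₂_right_comm (hF : F.IsOrderTwo) {x s t : MvPowerSeries τ S}
    (hx : constantCoeff x = 0) (hs : constantCoeff s = 0) (ht : constantCoeff t = 0) :
    F.eval₂ (F.eval₂ x t) s = F.eval₂ (F.eval₂ x s) t := by
  have hx' := PowerSeries.HasSubst.of_constantCoeff_zero hx
  have hs' := PowerSeries.HasSubst.of_constantCoeff_zero hs
  have ht' := PowerSeries.HasSubst.of_constantCoeff_zero ht
  refine (F.assoc' hx' ht' hs').trans (Eq.trans ?_ (F.assoc' hx' hs' ht').symm)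
  change F.eval₂ x (F.eval₂ t s) = F.eval₂ x (F.eval₂ s t)
  rw [eval₂_comm hF ht' hs']

theorem zero_eval₂ {x : MvPowerSeries τ S} (hx : constantCoeff x = 0) : F.eval₂ 0 x = x :=
  F.zero_add (PowerSeries.HasSubst.of_constantCoeff_zero hx)

theorem eval₂_zero {x : MvPowerSeries τ S} (hx : constantCoeff x = 0) : F.eval₂ x 0 = x :=
  F.add_zero (PowerSeries.HasSubst.of_constantCoeff_zero hx)

/-- Translation by a point of order two is an involutive automorphism, so it carries the regular
element `X_i` to the regular element `F(c, X_i)`. -/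
theorem isLeftRegular_of_involutive {W : Type*} [CommRing W] (θ : W →+* W)
    (hθ : ∀ w, θ (θ w) = w) {w : W} (hw : IsLeftRegular w) : IsLeftRegular (θ w) := by
  intro a b h
  have h' := congrArg θ h
  simp only [map_mul, hθ] at h'
  rw [← hθ a, ← hθ b, hw h']

theorem isLeftRegular_X (i : τ) : IsLeftRegular (X i : MvPowerSeries τ S) := by
  intro a b h
  rw [← sub_eq_zero]
  refine (mem_nonZeroDivisors_iff.mp (X_mem_nonzeroDivisors (i := i))).1 _ ?_
  rw [mul_sub]
  exact sub_eq_zero.mpr h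

/-- The hypothesis `hci` expresses that `c` is unchanged by the substitution `X_i ↦ F(c, X_i)`. That
substitution is then an involution, because `F(c, F(c, X_i)) = X_i`. -/
theorem isLeftRegular_eval₂ [Finite τ] [DecidableEq τ] (hF : F.IsOrderTwo) (i : τ)
    {c : MvPowerSeries τ S} (hc : constantCoeff c = 0)
    (hci : c.subst (Function.update X i (F.eval₂ c (X i))) = c) :
    IsLeftRegular (F.eval₂ c (X i)) := by
  have hi := constantCoeff_X (R := S) i
  have hu (j : τ) : constantCoeff
      (Function.update (X : τ → MvPowerSeries τ S) i (F.eval₂ c (X i)) j) = 0 := by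
    by_cases hj : j = i
    · subst hj
      rw [Function.update_self]
      exact F.constantCoeff_eval₂ hc hi
    · rw [Function.update_of_ne hj, constantCoeff_X]
  have hus := hasSubst_of_constantCoeff_zero hu
  have hθX : substHom _ hu (X i) = F.eval₂ c (X i) := by
    rw [substHom_apply, subst_X hus, Function.update_self]
  have hθθ (j : τ) : substHom _ hu (substHom _ hu (X j)) = X j := by
    by_cases hj : j = i
    · subst hj
      rw [hθX, substHom_apply, F.subst_eval₂ hc hi hu, hci, subst_X hus, Function.update_self,
        eval₂_eval₂_self hF hc hi]
    · have : substHom _ hu (X j) = X j := by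
        rw [substHom_apply, subst_X hus, Function.update_of_ne hj]
      rw [this, this]
  rw [← hθX]
  refine isLeftRegular_of_involutive _ (fun w => ?_) (isLeftRegular_X i)
  refine ringHom_congr (L := (substHom _ hu).comp (substHom _ hu)) (L' := RingHom.id _)
    (fun a => ?_) hθθ (fun j => ?_) w
  · rw [RingHom.comp_apply, substHom_apply _ _ (C a), subst_C, substHom_apply, subst_C]
    rfl
  · rw [RingHom.comp_apply, hθθ, constantCoeff_X]

theorem isLeftRegular_eval₂_X [Finite τ] (hF : F.IsOrderTwo) {i j : τ} (hij : j ≠ i) :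
    IsLeftRegular (F.eval₂ (X j) (X i)) := by
  classical
  refine isLeftRegular_eval₂ hF i (constantCoeff_X j) ?_
  have hu (k : τ) : constantCoeff
      (Function.update (X : τ → MvPowerSeries τ S) i (F.eval₂ (X j) (X i)) k) = 0 := by
    by_cases hk : k = i
    · subst hk
      rw [Function.update_self]
      exact F.constantCoeff_eval₂ (constantCoeff_X _) (constantCoeff_X _)
    · rw [Function.update_of_ne hk, constantCoeff_X]
  rw [subst_X (hasSubst_of_constantCoeff_zero hu), Function.update_of_ne hij]

theorem isLeftRegular_eval₂_eval₂_X [Finite τ] (hF : F.IsOrderTwo) {i j k : τ} (hij : j ≠ i)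
    (hik : k ≠ i) : IsLeftRegular (F.eval₂ (F.eval₂ (X j) (X k)) (X i)) := by
  classical
  have hc := F.constantCoeff_eval₂ (constantCoeff_X (R := S) j) (constantCoeff_X k)
  refine isLeftRegular_eval₂ hF i hc ?_
  have hu (k' : τ) : constantCoeff (Function.update (X : τ → MvPowerSeries τ S) i
      (F.eval₂ (F.eval₂ (X j) (X k)) (X i)) k') = 0 := by
    by_cases hk : k' = i
    · subst hk
      rw [Function.update_self]
      exact F.constantCoeff_eval₂ hc (constantCoeff_X _)
    · rw [Function.update_of_ne hk, constantCoeff_X]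
  rw [F.subst_eval₂ (constantCoeff_X _) (constantCoeff_X _) hu,
    subst_X (hasSubst_of_constantCoeff_zero hu), subst_X (hasSubst_of_constantCoeff_zero hu),
    Function.update_of_ne hij, Function.update_of_ne hik]

/-! ### Power series in the isogeny -/

theorem isLeftRegular_isogeny (hF : F.IsOrderTwo) :
    IsLeftRegular (F.isogeny (X 0) (X 1 : MvPowerSeries (Fin 2) S)) :=
  (isLeftRegular_X 0).mul (isLeftRegular_eval₂_X hF (by decide))

theorem constantCoeff_zero_X (i : Fin 2) :
    constantCoeff ((![0, PowerSeries.X] : Fin 2 → PowerSeries S) i) = 0 :=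
  constantCoeff_vec (map_zero _) (by exact PowerSeries.constantCoeff_X) i

theorem constantCoeff_X_zero (i : Fin 2) :
    constantCoeff ((![PowerSeries.X, 0] : Fin 2 → PowerSeries S) i) = 0 :=
  constantCoeff_vec (by exact PowerSeries.constantCoeff_X) (map_zero _) i

theorem subst_zero_X_subst (a : PowerSeries S) :
    (PowerSeries.subst (X 1 : MvPowerSeries (Fin 2) S) a).subst
      (![0, PowerSeries.X] : Fin 2 → PowerSeries S) = a := by
  rw [powerSeries_subst_subst (constantCoeff_X 1) constantCoeff_zero_X,
    subst_X (hasSubst_of_constantCoeff_zero constantCoeff_zero_X)]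
  exact PowerSeries.X_subst a

theorem subst_zero_X_isogeny : (F.isogeny (X 0) (X 1)).subst
    (![0, PowerSeries.X] : Fin 2 → PowerSeries S) = 0 := by
  rw [F.subst_isogeny (constantCoeff_X 0) (constantCoeff_X 1) constantCoeff_zero_X, isogeny,
    subst_X (hasSubst_of_constantCoeff_zero constantCoeff_zero_X)]
  exact zero_mul _

/-- The coefficients of a power series in the isogeny are unique. -/
theorem eq_of_isogeny_pow_dvd (hF : F.IsOrderTwo) {f : MvPowerSeries (Fin 2) S}
    {a b : ℕ → PowerSeries S}
    (ha : ∀ n, F.isogeny (X 0) (X 1) ^ n ∣ f - ∑ j ∈ Finset.range n,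
      PowerSeries.subst (X 1) (a j) * F.isogeny (X 0) (X 1) ^ j)
    (hb : ∀ n, F.isogeny (X 0) (X 1) ^ n ∣ f - ∑ j ∈ Finset.range n,
      PowerSeries.subst (X 1) (b j) * F.isogeny (X 0) (X 1) ^ j) (j : ℕ) : a j = b j := by
  rw [← sub_eq_zero]
  -- Setting `x = 0` is a retraction onto series in `t` that kills the isogeny.
  refine eq_zero_of_forall_pow_dvd_sum (d := fun j => a j - b j)
    (substHom (fun _ : Unit => (X 1 : MvPowerSeries (Fin 2) S)) fun _ => constantCoeff_X 1)
    (substHom _ constantCoeff_zero_X)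
    (fun v => ?_) (isLeftRegular_isogeny hF) ?_ (fun n => ?_) j
  · rw [substHom_apply, substHom_apply]
    exact subst_zero_X_subst v
  · rw [substHom_apply, subst_zero_X_isogeny]
  · have h := dvd_sub (hb n) (ha n)
    rw [sub_sub_sub_cancel_left, ← Finset.sum_sub_distrib] at h
    refine h.trans (dvd_of_eq (Finset.sum_congr rfl fun j _ => ?_))
    rw [map_sub, substHom_apply, substHom_apply, sub_mul]
    rfl

/-- The substitution `x ↦ F(x, t)`, `t ↦ t`. -/
def translation (F : FormalGroup S) : Fin 2 → MvPowerSeries (Fin 2) S :=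
  ![F.eval₂ (X 0) (X 1), X 1]

theorem constantCoeff_translation (F : FormalGroup S) (i : Fin 2) :
    constantCoeff (F.translation i) = 0 :=
  constantCoeff_vec (F.constantCoeff_eval₂ (constantCoeff_X 0) (constantCoeff_X 1))
    (constantCoeff_X 1) i

theorem subst_translation_eval₂ (hF : F.IsOrderTwo) :
    (F.eval₂ (X 0) (X 1)).subst F.translation = X 0 := by
  have hX (i : Fin 2) : constantCoeff (X i : MvPowerSeries (Fin 2) S) = 0 := constantCoeff_X i
  have hτs := hasSubst_of_constantCoeff_zero F.constantCoeff_translation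
  rw [F.subst_eval₂ (hX 0) (hX 1) F.constantCoeff_translation, subst_X hτs, subst_X hτs]
  change F.eval₂ (F.eval₂ (X 0) (X 1)) (X 1) = X 0
  rw [eval₂_comm hF (PowerSeries.HasSubst.X 0) (PowerSeries.HasSubst.X 1),
    eval₂_comm hF (PowerSeries.HasSubst.of_constantCoeff_zero
      (F.constantCoeff_eval₂ (hX 1) (hX 0))) (PowerSeries.HasSubst.X 1),
    eval₂_eval₂_self hF (hX 1) (hX 0)]

/-- One step of division by the isogeny. With `a(t) = f(0, t)` one has `f - a = x p`, and invariance
gives `x p = F(x, t) p'`, where `p'` is the translate of `p`. At `x = 0` this reads `0 = t p'(0,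
t)`, so `p' = x q` and `f - a = x F(x, t) q`. The quotient is again invariant because the isogeny is
invariant and regular, so the division can be repeated. -/
theorem exists_eq_add_isogeny_mul (hF : F.IsOrderTwo) (f : MvPowerSeries (Fin 2) S)
    (hf : f.subst F.translation = f) :
    ∃ (a : PowerSeries S) (q : MvPowerSeries (Fin 2) S),
      f = PowerSeries.subst (X 1) a + F.isogeny (X 0) (X 1) * q ∧
        q.subst F.translation = q := by
  have hX (i : Fin 2) : constantCoeff (X i : MvPowerSeries (Fin 2) S) = 0 := constantCoeff_X i
  have hτ := F.constantCoeff_translation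
  have hτs := hasSubst_of_constantCoeff_zero hτ
  have hε (j : Fin 2) : constantCoeff
      (Function.update (X : Fin 2 → MvPowerSeries (Fin 2) S) 0 0 j) = 0 := by
    fin_cases j
    · simp
    · exact hX 1
  have hεs := hasSubst_of_constantCoeff_zero hε
  have hε1 : (X 1 : MvPowerSeries (Fin 2) S).subst
      (Function.update (X : Fin 2 → MvPowerSeries (Fin 2) S) 0 0) = X 1 := by
    rw [subst_X hεs]; rfl
  have hε0 : (X 0 : MvPowerSeries (Fin 2) S).subst
      (Function.update (X : Fin 2 → MvPowerSeries (Fin 2) S) 0 0) = 0 := by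
    rw [subst_X hεs]; rfl
  have hττ (w : MvPowerSeries (Fin 2) S) : (w.subst F.translation).subst
      F.translation = w := by
    rw [subst_comp_subst_apply hτs hτs]
    have : (fun i => (F.translation i).subst
        F.translation) = X := by
      funext i
      fin_cases i
      · exact subst_translation_eval₂ hF
      · exact subst_X hτs 1
    rw [this, subst_self]
    rfl
  let a : PowerSeries S := f.subst ![0, PowerSeries.X]
  have hτa : (PowerSeries.subst (X 1 : MvPowerSeries (Fin 2) S) a).subst
      F.translation = PowerSeries.subst (X 1) a := by
    rw [powerSeries_subst_subst (hX 1) hτ, subst_X hτs]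
    rfl
  obtain ⟨p, hp⟩ : (X 0 : MvPowerSeries (Fin 2) S) ∣ f - PowerSeries.subst (X 1) a := by
    refine X_dvd_of_subst_update 0 _ ?_
    rw [subst_sub hεs, powerSeries_subst_subst (hX 1) hε, hε1, sub_eq_zero]
    change _ = MvPowerSeries.subst _ (f.subst ![0, PowerSeries.X])
    rw [subst_comp_subst_apply (hasSubst_of_constantCoeff_zero constantCoeff_zero_X)
      (PowerSeries.HasSubst.X 1).const]
    congr 1
    funext i
    fin_cases i
    · exact (map_zero (substHom (fun _ : Unit => (X 1 : MvPowerSeries (Fin 2) S))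
        fun _ => hX 1)).symm.trans (substHom_apply _ _ _)
    · exact (PowerSeries.subst_X (PowerSeries.HasSubst.X 1)).symm
  have hp' : X 0 * p = F.eval₂ (X 0) (X 1) * p.subst F.translation := by
    have h := congrArg (MvPowerSeries.subst F.translation) hp
    rw [subst_sub hτs, hf, hτa, hp, subst_mul hτs, subst_X hτs] at h
    exact h
  -- Here `F(0, t) = t` is used: at `x = 0` the factor `F(x, t)` becomes the regular element `t`.
  obtain ⟨q, hq⟩ : (X 0 : MvPowerSeries (Fin 2) S) ∣ p.subst F.translation := by
    refine X_dvd_of_subst_update 0 _ ?_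
    have h := congrArg (MvPowerSeries.subst
      (Function.update (X : Fin 2 → MvPowerSeries (Fin 2) S) 0 0)) hp'
    rw [subst_mul hεs, subst_mul hεs, hε0, zero_mul, F.subst_eval₂ (hX 0) (hX 1) hε, hε0, hε1,
      zero_eval₂ (hX 1)] at h
    exact isLeftRegular_X 1 (h.symm.trans (mul_zero _).symm)
  have hfq : f = PowerSeries.subst (X 1) a + F.isogeny (X 0) (X 1) * q := by
    rw [← sub_eq_iff_eq_add', hp, hp', hq, isogeny, mul_left_comm, mul_assoc]
  refine ⟨a, q, hfq, isLeftRegular_isogeny hF ?_⟩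
  have h := congrArg (MvPowerSeries.subst F.translation) hfq
  have hi : (F.isogeny (X 0) (X 1)).subst F.translation =
      F.isogeny (X 0) (X 1 : MvPowerSeries (Fin 2) S) := by
    rw [isogeny, subst_mul hτs, subst_translation_eval₂ hF, subst_X hτs, mul_comm]
    rfl
  rw [hf, subst_add hτs, hτa, subst_mul hτs, hi] at h
  exact (add_left_cancel (h.symm.trans hfq))

/-- A power series in `x` and `t` that is invariant under `x ↦ F(x, t)` is a power series in the
isogeny `x F(x, t)` with coefficients power series in `t`. -/
theorem exists_isogeny_pow_dvd (hF : F.IsOrderTwo) (f : MvPowerSeries (Fin 2) S)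
    (hf : f.subst F.translation = f) :
    ∃ a : ℕ → PowerSeries S, ∀ n, F.isogeny (X 0) (X 1) ^ n ∣ f - ∑ j ∈ Finset.range n,
      PowerSeries.subst (X 1) (a j) * F.isogeny (X 0) (X 1) ^ j := by
  choose A Q hAQ hQ using exists_eq_add_isogeny_mul hF
  -- The successive quotients; the `n`-th of them is the cofactor of the `n`-th power of the
  -- isogeny.
  let next : {f : MvPowerSeries (Fin 2) S // f.subst F.translation = f} →
    {f : MvPowerSeries (Fin 2) S // f.subst F.translation = f} :=
    fun g => ⟨Q g.1 g.2, hQ g.1 g.2⟩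
  let g (n : ℕ) := next^[n] ⟨f, hf⟩
  refine ⟨fun n => A (g n).1 (g n).2, fun n => ⟨(g n).1, ?_⟩⟩
  rw [sub_eq_iff_eq_add']
  induction n with
  | zero => simp [g]
  | succ n ih =>
    have hg : (g (n + 1)).1 = Q (g n).1 (g n).2 := by
      simp only [g, Function.iterate_succ_apply']
      rfl
    rw [Finset.sum_range_succ, hg, ih]
    conv_lhs => rw [hAQ (g n).1 (g n).2]
    ring

end FormalGroup

/-! ### Constant terms of the coefficients in an expansion by the isogeny -/

section square

open MvPowerSeries

variable {S : Type*} [CommRing S]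

/-- Squaring, in a ring with `2 = 0`. -/
def squareHom (h2 : (2 : S) = 0) : S →+* S where
  toFun a := a ^ 2
  map_one' := one_pow 2
  map_mul' a b := mul_pow a b 2
  map_zero' := zero_pow two_ne_zero
  map_add' a b := by linear_combination a * b * h2

/-- At `t = 0` the isogeny becomes `x²` and the product becomes `k(x)²`, which in characteristic two
is `∑ k_j² x^{2j}`. The claim compares coefficients of powers of the regular element `x²`. -/
theorem constantCoeff_eq_sq_of_isogeny_pow_dvd {F : FormalGroup S} (h2 : (2 : S) = 0)
    {k : PowerSeries S} {a : ℕ → PowerSeries S}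
    (ha : ∀ n, F.isogeny (X 0) (X 1) ^ n ∣
      PowerSeries.subst (X 0 : MvPowerSeries (Fin 2) S) k * PowerSeries.subst (F.eval₂ (X 0) (X 1)) k -
      ∑ j ∈ Finset.range n, PowerSeries.subst (X 1) (a j) * F.isogeny (X 0) (X 1) ^ j) (j : ℕ) :
    PowerSeries.constantCoeff (a j) = PowerSeries.coeff j k ^ 2 := by
  have hX (i : Fin 2) : constantCoeff (X i : MvPowerSeries (Fin 2) S) = 0 := constantCoeff_X i
  have he := FormalGroup.constantCoeff_X_zero (S := S)
  have hes := hasSubst_of_constantCoeff_zero he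
  have hPX : constantCoeff (PowerSeries.X : PowerSeries S) = 0 := he 0
  have he0 : (X 0 : MvPowerSeries (Fin 2) S).subst
      (![PowerSeries.X, 0] : Fin 2 → PowerSeries S) = PowerSeries.X := subst_X hes 0
  have he1 : (X 1 : MvPowerSeries (Fin 2) S).subst
      (![PowerSeries.X, 0] : Fin 2 → PowerSeries S) = 0 := subst_X hes 1
  have heF : (F.eval₂ (X 0) (X 1)).subst
      (![PowerSeries.X, 0] : Fin 2 → PowerSeries S) = PowerSeries.X := by
    rw [F.subst_eval₂ (hX 0) (hX 1) he, he0, he1, FormalGroup.eval₂_zero hPX]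
  have h2' : (2 : PowerSeries S) = 0 := by
    have := congrArg (PowerSeries.C (R := S)) h2
    rwa [map_ofNat, map_zero] at this
  rw [← sub_eq_zero]
  have hreg : IsLeftRegular (PowerSeries.X : PowerSeries S) := fun a b h =>
    PowerSeries.X_mul_cancel h
  refine eq_zero_of_forall_pow_dvd_sum (N := PowerSeries.X ^ 2)
    (d := fun j => PowerSeries.constantCoeff (a j) - PowerSeries.coeff j k ^ 2)
    (PowerSeries.C (R := S)) PowerSeries.constantCoeff (fun v => PowerSeries.constantCoeff_C v)
    (hreg.pow 2) (by simp) (fun n => ?_) j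
  -- Squaring is a ring homomorphism here, so its expansion along `k` has remainder divisible by
  -- `(x²)^n`.
  obtain ⟨q, hq⟩ := exists_ringHom_eq_sum (squareHom h2') k n
  have h := map_dvd (substHom _ he) (ha n)
  have hiso : substHom _ he (F.isogeny (X 0) (X 1)) = PowerSeries.X ^ 2 := by
    rw [FormalGroup.isogeny, map_mul, substHom_apply, substHom_apply, he0, heF, sq]
  have hC (b : PowerSeries S) : substHom _ he (PowerSeries.subst (X 1) b) =
      PowerSeries.C (PowerSeries.constantCoeff b) := by
    rw [substHom_apply, powerSeries_subst_subst (hX 1) he, he1]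
    exact PowerSeries.subst_zero_eq_C_constantCoeff
  have hk0 : substHom _ he (PowerSeries.subst (X 0) k) = k := by
    rw [substHom_apply, powerSeries_subst_subst (hX 0) he, he0]
    exact PowerSeries.X_subst k
  have hk1 : substHom _ he (PowerSeries.subst (F.eval₂ (X 0) (X 1)) k) = k := by
    rw [substHom_apply, powerSeries_subst_subst (F.constantCoeff_eval₂ (hX 0) (hX 1)) he, heF]
    exact PowerSeries.X_subst k
  rw [map_sub, map_sum, map_mul, map_pow, hiso, hk0, hk1] at h
  have hsq : k * k = squareHom h2' k := (sq k).symm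
  rw [hsq, hq] at h
  have hsC (b : S) : squareHom h2' (PowerSeries.C b) = PowerSeries.C (b ^ 2) :=
    (map_pow PowerSeries.C b 2).symm
  have hX2 : squareHom h2' (PowerSeries.X : PowerSeries S) = PowerSeries.X ^ 2 := rfl
  simp only [hsC, hX2, map_mul, map_pow, hiso, hC] at h
  rw [← dvd_neg] at h
  have h' := dvd_add h (dvd_mul_right ((PowerSeries.X ^ 2) ^ n) q)
  refine h'.trans (dvd_of_eq ?_)
  simp only [map_sub, map_pow, sub_mul, Finset.sum_sub_distrib]
  ring

end square

/-! ### Multiplicative series determine the operations on their coefficients -/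

section multiplicative

open MvPowerSeries

variable {R S : Type*} [CommRing R] [CommRing S]

/-- This and its converse `applyD_eq_of_isogeny_pow_dvd` trade an equation for `D_t(k)(x F(x, t))`
for finite congruences. Congruences are preserved by every ring homomorphism, and they exhibit the
`D_t(k_j)` as coefficients with respect to the isogeny. -/
theorem isogeny_pow_dvd_of_applyD_eq {F : FormalGroup S} {D : S →+* PowerSeries S}
    {k : PowerSeries S} {f : MvPowerSeries (Fin 2) S}
    (h : applyD D (fun _ : Unit => F.isogeny (X 0) (X 1)) (X 1) k = f) (n : ℕ) :
    F.isogeny (X 0) (X 1) ^ n ∣ f - ∑ j ∈ Finset.range n,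
      PowerSeries.subst (X 1) (D (PowerSeries.coeff j k)) * F.isogeny (X 0) (X 1) ^ j := by
  have hu (_ : Unit) := F.constantCoeff_isogeny (constantCoeff_X (R := S) (0 : Fin 2)) (X 1)
  obtain ⟨q, hq⟩ := exists_ringHom_eq_sum (applyDHom D _ (X 1) hu (constantCoeff_X 1)) k n
  have hX : applyDHom D _ (X 1) hu (constantCoeff_X 1) PowerSeries.X =
      F.isogeny (X 0) (X 1) := by
    rw [applyDHom_apply]
    exact applyD_X D hu (constantCoeff_X 1) ()
  have hC (c : S) : applyDHom D _ (X 1) hu (constantCoeff_X 1) (PowerSeries.C c) =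
      PowerSeries.subst (X 1) (D c) := by
    rw [applyDHom_apply]
    exact applyD_C D hu (constantCoeff_X 1) c
  simp only [hX, hC, applyDHom_apply, h] at hq
  exact ⟨q, sub_eq_iff_eq_add'.mpr hq⟩

theorem applyD_eq_of_isogeny_pow_dvd {F : FormalGroup S} {D : S →+* PowerSeries S}
    {k : PowerSeries S} {f : MvPowerSeries (Fin 2) S}
    (h : ∀ n, F.isogeny (X 0) (X 1) ^ n ∣ f - ∑ j ∈ Finset.range n,
      PowerSeries.subst (X 1) (D (PowerSeries.coeff j k)) * F.isogeny (X 0) (X 1) ^ j) :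
    applyD D (fun _ : Unit => F.isogeny (X 0) (X 1)) (X 1) k = f := by
  rw [← sub_eq_zero]
  refine eq_zero_of_forall_pow_dvd
    (F.constantCoeff_isogeny (constantCoeff_X (R := S) (0 : Fin 2)) (X 1)) fun n => ?_
  have h' := dvd_sub (h n) (isogeny_pow_dvd_of_applyD_eq (F := F) (D := D) (k := k) rfl n)
  rwa [sub_sub_sub_cancel_right, dvd_sub_comm] at h'

theorem map_powerSeries_X_subst (α : R →+* S) (i : Fin 2) (a : PowerSeries R) :
    MvPowerSeries.map α (PowerSeries.subst (X i : MvPowerSeries (Fin 2) R) a) =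
      PowerSeries.subst (X i) (PowerSeries.map α a) := by
  rw [PowerSeries.map_subst (PowerSeries.HasSubst.X i), MvPowerSeries.map_X]

theorem map_isogeny_X (F : FormalGroup R) (α : R →+* S) :
    MvPowerSeries.map α (F.isogeny (X 0) (X 1 : MvPowerSeries (Fin 2) R)) =
      (F.map α).isogeny (X 0) (X 1) := by
  rw [F.map_isogeny α (PowerSeries.HasSubst.X 0) (PowerSeries.HasSubst.X 1), MvPowerSeries.map_X,
    MvPowerSeries.map_X]

/-- The operations on the coefficients of a multiplicative series are determined by the series. -/
theorem DStructure.IsMultiplicative.map_D_coeff {F : FormalGroup R} {G : FormalGroup S}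
    {𝒟 : DStructure R F} {ℰ : DStructure S G} {α : R →+* S} (hG : G.IsOrderTwo)
    (hα : F.map α = G) {k : PowerSeries R} (hk : 𝒟.IsMultiplicative k)
    (hk' : ℰ.IsMultiplicative (PowerSeries.map α k)) (j : ℕ) :
    PowerSeries.map α (𝒟.D (PowerSeries.coeff j k)) = ℰ.D (α (PowerSeries.coeff j k)) := by
  -- Both sides are the `j`-th coefficient of one and the same series with respect to the isogeny of
  -- `G`.
  refine FormalGroup.eq_of_isogeny_pow_dvd
    (a := fun j => PowerSeries.map α (𝒟.D (PowerSeries.coeff j k))) hG (fun n => ?_)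
    (fun n => isogeny_pow_dvd_of_applyD_eq hk' n) j |>.trans (by rw [PowerSeries.coeff_map])
  have h := map_dvd (MvPowerSeries.map α) (isogeny_pow_dvd_of_applyD_eq hk n)
  simp only [map_sub, map_sum, map_mul, map_pow, map_isogeny_X, hα, map_powerSeries_X_subst] at h
  rw [PowerSeries.map_subst (PowerSeries.HasSubst.of_constantCoeff_zero
    (F.constantCoeff_eval₂ (constantCoeff_X 0) (constantCoeff_X 1))),
    F.map_eval₂ α (PowerSeries.HasSubst.X 0) (PowerSeries.HasSubst.X 1), MvPowerSeries.map_X,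
    MvPowerSeries.map_X, hα] at h
  exact h

end multiplicative

/-! ### Commutation of the operations on the coefficients of a multiplicative series -/

section symm

open MvPowerSeries

variable {S : Type*} [CommRing S]

/-- The value of `D_s D_t(a)`, where `s`, `t` are the indeterminates `0`, `1`. -/
def iterD (F : FormalGroup S) (D : S →+* PowerSeries S) : S →+* MvPowerSeries (Fin 2) S :=
  (applyDHom D (fun _ : Unit => F.isogeny (X 1) (X 0)) (X 0)
    (fun _ => F.constantCoeff_isogeny (constantCoeff_X 1) _) (constantCoeff_X 0)).comp D

theorem iterD_apply (F : FormalGroup S) (D : S →+* PowerSeries S) (a : S) :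
    iterD F D a = applyD D (fun _ : Unit => F.isogeny (X 1) (X 0)) (X 0) (D a) :=
  applyDHom_apply D (fun _ => F.constantCoeff_isogeny (constantCoeff_X 1) _) (constantCoeff_X 0)
    (D a)

/-- The isogeny `x F(x, s) F(x, t) F(F(x, t), s)`, whose kernel is generated by `s` and `t`. Here
`x`, `t`, `s` are the indeterminates `0`, `1`, `2`. -/
def FormalGroup.biIsogeny (F : FormalGroup S) : MvPowerSeries (Fin 3) S :=
  F.isogeny (X 0) (X 2) * F.isogeny (F.eval₂ (X 0) (X 1)) (X 2)

theorem constantCoeff_swap (i : Fin 3) :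
    constantCoeff ((![X 0, X 2, X 1] : Fin 3 → MvPowerSeries (Fin 3) S) i) = 0 :=
  constantCoeff_vec₃ (constantCoeff_X _) (constantCoeff_X _) (constantCoeff_X _) i

theorem constantCoeff_params (i : Fin 2) :
    constantCoeff ((![X 2, X 1] : Fin 2 → MvPowerSeries (Fin 3) S) i) = 0 :=
  constantCoeff_vec (constantCoeff_X _) (constantCoeff_X _) i

/-- The substitution sets `x = 0` and returns `t`, `s` to their places in two variables. It is a
retraction for `![X 2, X 1]` and kills `biIsogeny`. -/
theorem constantCoeff_params_zero (i : Fin 3) :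
    constantCoeff ((![0, X 1, X 0] : Fin 3 → MvPowerSeries (Fin 2) S) i) = 0 :=
  constantCoeff_vec₃ (map_zero _) (constantCoeff_X _) (constantCoeff_X _) i

theorem constantCoeff_swap₂ (i : Fin 2) :
    constantCoeff ((![X 1, X 0] : Fin 2 → MvPowerSeries (Fin 2) S) i) = 0 :=
  constantCoeff_vec (constantCoeff_X _) (constantCoeff_X _) i

theorem FormalGroup.isLeftRegular_biIsogeny {F : FormalGroup S} (hF : F.IsOrderTwo) :
    IsLeftRegular F.biIsogeny :=
  ((isLeftRegular_X 0).mul (isLeftRegular_eval₂_X hF (by decide))).mul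
    ((isLeftRegular_eval₂_X hF (by decide)).mul
      (isLeftRegular_eval₂_eval₂_X hF (by decide) (by decide)))

theorem substHom_swap_X (i : Fin 3) :
    substHom _ (constantCoeff_swap (S := S)) (X i) = X (![0, 2, 1] i) := by
  rw [substHom_apply, subst_X (hasSubst_of_constantCoeff_zero constantCoeff_swap)]
  fin_cases i <;> rfl

theorem substHom_swap_biIsogeny {F : FormalGroup S} (hF : F.IsOrderTwo) :
    substHom _ constantCoeff_swap F.biIsogeny = F.biIsogeny := by
  have hX (i : Fin 3) : constantCoeff (X i : MvPowerSeries (Fin 3) S) = 0 := constantCoeff_X i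
  have hs (i : Fin 3) := substHom_swap_X (S := S) i
  have h01 := F.constantCoeff_eval₂ (hX 0) (hX 1)
  simp only [substHom_apply] at hs
  rw [FormalGroup.biIsogeny, map_mul, substHom_apply, substHom_apply,
    F.subst_isogeny (hX 0) (hX 2) constantCoeff_swap, F.subst_isogeny h01 (hX 2) constantCoeff_swap,
    F.subst_eval₂ (hX 0) (hX 1) constantCoeff_swap, hs, hs, hs]
  change F.isogeny (X 0) (X 1) * F.isogeny (F.eval₂ (X 0) (X 2)) (X 1) = _
  rw [FormalGroup.isogeny, FormalGroup.isogeny, FormalGroup.isogeny, FormalGroup.isogeny,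
    FormalGroup.eval₂_right_comm hF (hX 0) (hX 2) (hX 1)]
  ring

/-- Apply `D_s` to the congruences for `D_t(k)`. By the law axiom the isogeny of `t` is sent to
`biIsogeny`, and the product `k(x) k(F(x, t))` to the product of `k` over the four translates of
`x`. A bare ring homomorphism `D` is allowed because the result is needed before `D` is known to be
a D-structure. -/
theorem biIsogeny_pow_dvd {F : FormalGroup S} {D : S →+* PowerSeries S}
    (hlaw : applyD D ![F.isogeny (X 0) (X 2 : MvPowerSeries (Fin 3) S), F.isogeny (X 1) (X 2)]
      (X 2) F.toPowerSeries = F.isogeny (F.eval₂ (X 0) (X 1)) (X 2))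
    {k : PowerSeries S}
    (hk : applyD D (fun _ : Unit => F.isogeny (X 0) (X 1 : MvPowerSeries (Fin 2) S)) (X 1) k =
      PowerSeries.subst (X 0) k * PowerSeries.subst (F.eval₂ (X 0) (X 1)) k) (n : ℕ) :
    F.biIsogeny ^ n ∣ PowerSeries.subst (X 0) k * PowerSeries.subst (F.eval₂ (X 0) (X 2)) k *
        (PowerSeries.subst (F.eval₂ (X 0) (X 1)) k *
          PowerSeries.subst (F.eval₂ (F.eval₂ (X 0) (X 1)) (X 2)) k) -
      ∑ j ∈ Finset.range n, substHom _ constantCoeff_params (iterD F D (PowerSeries.coeff j k)) *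
        F.biIsogeny ^ j := by
  have hX (i : Fin 3) : constantCoeff (X i : MvPowerSeries (Fin 3) S) = 0 := constantCoeff_X i
  have hX' (i : Fin 2) : constantCoeff (X i : MvPowerSeries (Fin 2) S) = 0 := constantCoeff_X i
  have h01 := F.constantCoeff_eval₂ (hX 0) (hX 1)
  have hu := constantCoeff_vec (F.constantCoeff_isogeny (hX 0) (X 2))
    (F.constantCoeff_isogeny (hX 1) (X 2))
  have hmul {x t : MvPowerSeries (Fin 3) S} (hx : constantCoeff x = 0) (ht : constantCoeff t = 0) :
      applyD D (fun _ : Unit => F.isogeny x t) t k =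
        PowerSeries.subst x k * PowerSeries.subst (F.eval₂ x t) k := by
    have hc := constantCoeff_vec hx ht
    have hcs := hasSubst_of_constantCoeff_zero hc
    have h := congrArg (MvPowerSeries.subst ![x, t]) hk
    rw [subst_applyD D (fun _ => F.constantCoeff_isogeny (hX' 0) _) (hX' 1) hc,
      F.subst_isogeny (hX' 0) (hX' 1) hc, powerSeries_subst_mul hc,
      powerSeries_subst_subst (hX' 0) hc,
      powerSeries_subst_subst (F.constantCoeff_eval₂ (hX' 0) (hX' 1)) hc,
      F.subst_eval₂ (hX' 0) (hX' 1) hc, subst_X hcs, subst_X hcs] at h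
    exact h
  have hO0 : applyDHom D _ (X 2) hu (hX 2) (X 0) = F.isogeny (X 0) (X 2) := by
    rw [applyDHom_apply, applyD_X D hu (hX 2)]
    rfl
  have hO1 : applyDHom D _ (X 2) hu (hX 2) (X 1) = F.isogeny (X 1) (X 2) := by
    rw [applyDHom_apply, applyD_X D hu (hX 2)]
    rfl
  have hOF : applyDHom D _ (X 2) hu (hX 2) (F.eval₂ (X 0) (X 1)) =
      F.isogeny (F.eval₂ (X 0) (X 1)) (X 2) := by
    rw [applyDHom_apply, F.eval₂_X]
    exact hlaw
  have hON : applyDHom D _ (X 2) hu (hX 2) (F.isogeny (X 0) (X 1)) = F.biIsogeny := by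
    change applyDHom D _ (X 2) hu (hX 2) (X 0 * F.eval₂ (X 0) (X 1)) = _
    rw [map_mul, hO0, hOF, FormalGroup.biIsogeny]
  have hOk {a : MvPowerSeries (Fin 2) S} (ha : constantCoeff a = 0) :
      applyDHom D _ (X 2) hu (hX 2) (PowerSeries.subst a k) =
        applyD D (fun _ : Unit => applyDHom D _ (X 2) hu (hX 2) a) (X 2) k := by
    rw [applyDHom_apply, applyD_powerSeries_subst D hu (hX 2) ha, applyDHom_apply]
  have hOD (c : S) : applyDHom D _ (X 2) hu (hX 2) (PowerSeries.subst (X 1) (D c)) =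
      substHom _ constantCoeff_params (iterD F D c) := by
    have hps := hasSubst_of_constantCoeff_zero (constantCoeff_params (S := S))
    rw [applyDHom_apply, applyD_powerSeries_subst D hu (hX 2) (hX' 1), applyD_X D hu (hX 2),
      substHom_apply, iterD_apply, subst_applyD D (fun _ => F.constantCoeff_isogeny (hX' 1) _)
      (hX' 0) constantCoeff_params, F.subst_isogeny (hX' 1) (hX' 0) constantCoeff_params,
      subst_X hps, subst_X hps]
    rfl
  have h := map_dvd (applyDHom D _ (X 2) hu (hX 2)) (isogeny_pow_dvd_of_applyD_eq hk n)
  simp only [map_sub, map_sum, map_mul, map_pow, hON, hOD] at h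
  rwa [hOk (hX' 0), hO0, hOk (F.constantCoeff_eval₂ (hX' 0) (hX' 1)), hOF, hmul (hX 0) (hX 2),
    hmul h01 (hX 2)] at h

/-- Both `biIsogeny` and the product over the four translates are symmetric in `s` and `t`. Since
`biIsogeny` is regular, the coefficients of the expansion are unique and hence symmetric too. -/
theorem iterD_symm_of_multiplicative {F : FormalGroup S} (hF : F.IsOrderTwo)
    {D : S →+* PowerSeries S}
    (hlaw : applyD D ![F.isogeny (X 0) (X 2 : MvPowerSeries (Fin 3) S), F.isogeny (X 1) (X 2)]
      (X 2) F.toPowerSeries = F.isogeny (F.eval₂ (X 0) (X 1)) (X 2))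
    {k : PowerSeries S}
    (hk : applyD D (fun _ : Unit => F.isogeny (X 0) (X 1 : MvPowerSeries (Fin 2) S)) (X 1) k =
      PowerSeries.subst (X 0) k * PowerSeries.subst (F.eval₂ (X 0) (X 1)) k) (j : ℕ) :
    iterD F D (PowerSeries.coeff j k) =
      substHom _ constantCoeff_swap₂ (iterD F D (PowerSeries.coeff j k)) := by
  have hX (i : Fin 3) : constantCoeff (X i : MvPowerSeries (Fin 3) S) = 0 := constantCoeff_X i
  have h01 := F.constantCoeff_eval₂ (hX 0) (hX 1)
  have h02 := F.constantCoeff_eval₂ (hX 0) (hX 2)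
  have hs (i : Fin 3) := substHom_swap_X (S := S) i
  have hsF (i j : Fin 3) : substHom _ (constantCoeff_swap (S := S)) (F.eval₂ (X i) (X j)) =
      F.eval₂ (X (![0, 2, 1] i)) (X (![0, 2, 1] j)) := by
    rw [← hs, ← hs, substHom_apply, F.subst_eval₂ (hX i) (hX j) constantCoeff_swap,
      substHom_apply, substHom_apply]
  have hsk {a : MvPowerSeries (Fin 3) S} (ha : constantCoeff a = 0) :
      substHom _ (constantCoeff_swap (S := S)) (PowerSeries.subst a k) =
        PowerSeries.subst (substHom _ (constantCoeff_swap (S := S)) a) k := by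
    rw [substHom_apply, powerSeries_subst_subst ha constantCoeff_swap, substHom_apply]
  have hsFF : substHom _ (constantCoeff_swap (S := S)) (F.eval₂ (F.eval₂ (X 0) (X 1)) (X 2)) =
      F.eval₂ (F.eval₂ (X 0) (X 1)) (X 2) := by
    have e := hsF 0 1
    rw [substHom_apply] at e
    rw [substHom_apply, F.subst_eval₂ h01 (hX 2) constantCoeff_swap, e, ← substHom_apply _
      constantCoeff_swap, hs]
    exact (FormalGroup.eval₂_right_comm hF (hX 0) (hX 2) (hX 1)).symm
  have hsρ (v : MvPowerSeries (Fin 2) S) :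
      substHom _ constantCoeff_swap (substHom _ constantCoeff_params v) =
        substHom _ constantCoeff_params (substHom _ constantCoeff_swap₂ v) := by
    have hp := hasSubst_of_constantCoeff_zero (constantCoeff_params (S := S))
    have hw := hasSubst_of_constantCoeff_zero (constantCoeff_swap (S := S))
    have hw₂ := hasSubst_of_constantCoeff_zero (constantCoeff_swap₂ (S := S))
    rw [substHom_apply, substHom_apply, substHom_apply, substHom_apply,
      subst_comp_subst_apply hp hw, subst_comp_subst_apply hw₂ hp]
    congr 1
    funext i
    fin_cases i
    · exact (subst_X hw 2).trans (subst_X hp 1).symm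
    · exact (subst_X hw 1).trans (subst_X hp 0).symm
  have h1 := biIsogeny_pow_dvd hlaw hk
  rw [← sub_eq_zero]
  have hz := hasSubst_of_constantCoeff_zero (constantCoeff_params_zero (S := S))
  refine eq_zero_of_forall_pow_dvd_sum
    (d := fun j => iterD F D (PowerSeries.coeff j k) -
      substHom _ constantCoeff_swap₂ (iterD F D (PowerSeries.coeff j k)))
    (substHom _ (constantCoeff_params (S := S))) (substHom _ constantCoeff_params_zero)
    (fun v => ?_) (FormalGroup.isLeftRegular_biIsogeny hF) ?_ (fun n => ?_) j
  · have hp := hasSubst_of_constantCoeff_zero (constantCoeff_params (S := S))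
    rw [substHom_apply, substHom_apply, subst_comp_subst_apply hp hz]
    have : (fun i => ((![X 2, X 1] : Fin 2 → MvPowerSeries (Fin 3) S) i).subst
        (![0, X 1, X 0] : Fin 3 → MvPowerSeries (Fin 2) S)) = X := by
      funext i
      fin_cases i
      · exact subst_X hz 2
      · exact subst_X hz 1
    rw [this, subst_self]
    rfl
  · rw [FormalGroup.biIsogeny, map_mul, FormalGroup.isogeny, map_mul, substHom_apply, subst_X hz]
    exact (congrArg (· * _) (zero_mul _)).trans (zero_mul _)
  · have h2 := map_dvd (substHom _ (constantCoeff_swap (S := S))) (h1 n)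
    simp only [map_sub, map_sum, map_mul, map_pow, substHom_swap_biIsogeny hF, hsρ] at h2
    rw [hsk (hX 0), hsk h01, hsk h02, hsk (F.constantCoeff_eval₂ h01 (hX 2)), hs, hsF, hsF,
      hsFF] at h2
    -- The two products differ only in the order of their factors, so the subtraction leaves the
    -- differences of the coefficients.
    have h3 := dvd_sub h2 (h1 n)
    refine h3.trans (dvd_of_eq ?_)
    simp only [map_sub, sub_mul, Finset.sum_sub_distrib]
    change PowerSeries.subst (X 0) k * PowerSeries.subst (F.eval₂ (X 0) (X 1)) k *
      (PowerSeries.subst (F.eval₂ (X 0) (X 2)) k * _) - _ - _ = _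
    ring

theorem iterD_swap (F : FormalGroup S) (D : S →+* PowerSeries S) (a : S) :
    substHom _ constantCoeff_swap₂ (iterD F D a) =
      applyD D (fun _ : Unit => F.isogeny (X 0) (X 1)) (X 1) (D a) := by
  have hX (i : Fin 2) : constantCoeff (X i : MvPowerSeries (Fin 2) S) = 0 := constantCoeff_X i
  have hw₂ := hasSubst_of_constantCoeff_zero (constantCoeff_swap₂ (S := S))
  rw [substHom_apply, iterD_apply, subst_applyD D (fun _ => F.constantCoeff_isogeny (hX 1) _)
    (hX 0) constantCoeff_swap₂, F.subst_isogeny (hX 1) (hX 0) constantCoeff_swap₂,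
    subst_X hw₂, subst_X hw₂]
  rfl

end symm

/-! ### The induced D-structure on `B_* ⊗ R` -/

namespace FaaDiBruno

theorem ringHom_ext {W : Type*} [CommRing W] {f g : FaaDiBruno →+* W}
    (h : ∀ n, f (gen n) = g (gen n)) : f = g := by
  refine IsLocalization.ringHom_ext
    (Submonoid.powers (MvPolynomial.X 0 : MvPolynomial ℕ (ZMod 2))) ?_
  refine MvPolynomial.ringHom_ext' (Subsingleton.elim _ _) fun n => ?_
  exact h n

variable {R : Type*} [CommRing R] [Algebra (ZMod 2) R]

theorem coeff_succ_seriesOver (n : ℕ) :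
    PowerSeries.coeff (n + 1) (seriesOver R) = gen n ⊗ₜ 1 := by
  rw [seriesOver, PowerSeries.coeff_map, coeff_succ_series]
  rfl

theorem tensor_ringHom_ext {W : Type*} [CommRing W] {f g : FaaDiBruno ⊗[ZMod 2] R →+* W}
    (h₁ : ∀ a, f (incl R a) = g (incl R a))
    (h₂ : ∀ j, f (PowerSeries.coeff j (seriesOver R)) = g (PowerSeries.coeff j (seriesOver R))) :
    f = g := by
  have hB : f.comp (Algebra.TensorProduct.includeLeft :
      FaaDiBruno →ₐ[ZMod 2] FaaDiBruno ⊗[ZMod 2] R).toRingHom =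
      g.comp (Algebra.TensorProduct.includeLeft :
      FaaDiBruno →ₐ[ZMod 2] FaaDiBruno ⊗[ZMod 2] R).toRingHom :=
    ringHom_ext fun n => by
      have := h₂ (n + 1)
      rwa [coeff_succ_seriesOver] at this
  refine RingHom.ext fun x => ?_
  induction x using TensorProduct.induction_on with
  | zero => rw [map_zero, map_zero]
  | add x y hx hy => rw [map_add, map_add, hx, hy]
  | tmul b r =>
    have e : b ⊗ₜ[ZMod 2] r = (b ⊗ₜ 1) * (1 ⊗ₜ r : FaaDiBruno ⊗[ZMod 2] R) := by
      rw [Algebra.TensorProduct.tmul_mul_tmul, mul_one, one_mul]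
    rw [e, map_mul, map_mul]
    exact congrArg₂ (· * ·) (RingHom.congr_fun hB b) (h₁ r)

theorem two_eq_zero (S : Type*) [CommRing S] [Algebra (ZMod 2) S] : (2 : S) = 0 := by
  have := congrArg (algebraMap (ZMod 2) S) (show (2 : ZMod 2) = 0 from rfl)
  rwa [map_ofNat, map_zero] at this

end FaaDiBruno

/-! ### Existence, uniqueness and mapping properties of the induced D-structure -/

namespace DStructure

open MvPowerSeries FaaDiBruno

variable {R S : Type*} [CommRing R] [CommRing S] [Algebra (ZMod 2) R] {F : FormalGroup R}

/-- The product `h(x) h(F(x, t))` is invariant under `x ↦ F(x, t)`, and its coefficients with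
respect to the isogeny are prescribed as the values on the `h_n`. The second clause keeps the
defining equation in the form of congruences. -/
theorem exists_induced_ringHom (hF : F.IsOrderTwo) (𝒟 : DStructure R F) :
    ∃ D : FaaDiBruno ⊗[ZMod 2] R →+* PowerSeries (FaaDiBruno ⊗[ZMod 2] R),
      (∀ a, D (incl R a) = PowerSeries.map (incl R) (𝒟.D a)) ∧
      ∀ n, (F.map (incl R)).isogeny (X 0) (X 1) ^ n ∣
        PowerSeries.subst (X 0 : MvPowerSeries (Fin 2) (FaaDiBruno ⊗[ZMod 2] R)) (seriesOver R) *
          PowerSeries.subst ((F.map (incl R)).eval₂ (X 0) (X 1)) (seriesOver R) -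
        ∑ j ∈ Finset.range n, PowerSeries.subst (X 1) (D (PowerSeries.coeff j (seriesOver R))) *
          (F.map (incl R)).isogeny (X 0) (X 1) ^ j := by
  have hG := hF.map (incl R)
  generalize hGdef : F.map (incl R) = G at hG ⊢
  have hX (i : Fin 2) : constantCoeff
      (X i : MvPowerSeries (Fin 2) (FaaDiBruno ⊗[ZMod 2] R)) = 0 := constantCoeff_X i
  have hFX := G.constantCoeff_eval₂ (hX 0) (hX 1)
  have hτ := G.constantCoeff_translation
  have hτs := hasSubst_of_constantCoeff_zero hτ
  obtain ⟨a, ha⟩ := FormalGroup.exists_isogeny_pow_dvd hG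
    (PowerSeries.subst (X 0) (seriesOver R) *
      PowerSeries.subst (G.eval₂ (X 0) (X 1)) (seriesOver R)) (by
    rw [powerSeries_subst_mul hτ, powerSeries_subst_subst (hX 0) hτ,
      powerSeries_subst_subst hFX hτ, FormalGroup.subst_translation_eval₂ hG, subst_X hτs, mul_comm]
    rfl)
  have hsq := constantCoeff_eq_sq_of_isogeny_pow_dvd (two_eq_zero (FaaDiBruno ⊗[ZMod 2] R)) ha
  -- The homomorphism out of `B_*` only sees the coefficients from degree one on. In degree zero `h`
  -- has coefficient `0`, so `a 0` must vanish for the congruences to survive.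
  have ha0 : a 0 = 0 := by
    have he := FormalGroup.constantCoeff_zero_X (S := FaaDiBruno ⊗[ZMod 2] R)
    have hes := hasSubst_of_constantCoeff_zero he
    have h := map_dvd (substHom _ he) (ha 1)
    rw [pow_one, substHom_apply, FormalGroup.subst_zero_X_isogeny, zero_dvd_iff,
      Finset.sum_range_one, pow_zero, mul_one, map_sub, map_mul, substHom_apply,
      powerSeries_subst_subst (hX 0) he, subst_X hes] at h
    change PowerSeries.subst 0 _ * _ - _ = _ at h
    rw [FormalGroup.subst_zero_of (constantCoeff_seriesOver R), zero_mul, zero_sub, neg_eq_zero,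
      substHom_apply, FormalGroup.subst_zero_X_subst] at h
    exact h
  -- The constant term of `a 1` is `h_0²`, a unit; this permits the extension to `h_0⁻¹`.
  have hunit : IsUnit (PowerSeries.coeff 1 (PowerSeries.mk a)) := by
    rw [PowerSeries.coeff_mk, PowerSeries.isUnit_iff_constantCoeff, hsq]
    exact (isUnit_coeff_one_seriesOver R).pow 2
  let fR : R →ₐ[ZMod 2] PowerSeries (FaaDiBruno ⊗[ZMod 2] R) :=
    { (PowerSeries.map (incl R)).comp 𝒟.D with
      commutes' := fun r => RingHom.congr_fun (Subsingleton.elim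
        (((PowerSeries.map (incl R)).comp 𝒟.D).comp (algebraMap (ZMod 2) R))
        (algebraMap (ZMod 2) (PowerSeries (FaaDiBruno ⊗[ZMod 2] R)))) r }
  let D := Algebra.TensorProduct.productMap
    (FaaDiBruno.lift (PowerSeries.mk a) hunit) fR
  refine ⟨D.toRingHom, fun r => ?_, fun n => ?_⟩
  · exact Algebra.TensorProduct.productMap_right_apply _ _ r
  · refine (ha n).trans (dvd_of_eq ?_)
    congr 1
    refine Finset.sum_congr rfl fun j _ => ?_
    congr 2
    cases j with
    | zero =>
      rw [PowerSeries.coeff_zero_eq_constantCoeff_apply, constantCoeff_seriesOver, map_zero, ha0]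
    | succ j =>
      rw [coeff_succ_seriesOver]
      refine Eq.symm ((Algebra.TensorProduct.productMap_left_apply _ _ (gen j)).trans ?_)
      rw [lift_gen, PowerSeries.coeff_mk]

/-- The D-structure on `B_* ⊗ R` determined by that of `R` exists. -/
theorem exists_isInduced (hF : F.IsOrderTwo) (𝒟 : DStructure R F) :
    ∃ E : DStructure (FaaDiBruno ⊗[ZMod 2] R) (F.map (incl R)), 𝒟.IsInduced E := by
  obtain ⟨D, hincl, hD⟩ := exists_induced_ringHom hF 𝒟
  have hG := hF.map (incl R)
  have hX (i : Fin 3) : constantCoeff (X i : MvPowerSeries (Fin 3) R) = 0 := constantCoeff_X i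
  have hX₂ (i : Fin 2) : constantCoeff (X i : MvPowerSeries (Fin 2) R) = 0 := constantCoeff_X i
  have hX' (i : Fin 3) : PowerSeries.HasSubst (X i : MvPowerSeries (Fin 3) R) := .X i
  have hX₂' (i : Fin 2) : PowerSeries.HasSubst (X i : MvPowerSeries (Fin 2) R) := .X i
  have hmap (a : R) := (hincl a).symm
  -- The coefficients of the law lie in `R`, so this axiom is the image of the one for `R`.
  have hlaw : applyD D ![(F.map (incl R)).isogeny (X 0)
        (X 2 : MvPowerSeries (Fin 3) (FaaDiBruno ⊗[ZMod 2] R)),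
      (F.map (incl R)).isogeny (X 1) (X 2)] (X 2) (F.map (incl R)).toPowerSeries =
      (F.map (incl R)).isogeny ((F.map (incl R)).eval₂ (X 0) (X 1)) (X 2) := by
    have h := congrArg (MvPowerSeries.map (incl R)) 𝒟.D_law
    rw [map_applyD hmap (constantCoeff_vec (F.constantCoeff_isogeny (hX 0) _)
      (F.constantCoeff_isogeny (hX 1) _)) (hX 2), LazardTwo.map_vec,
      FormalGroup.map_isogeny _ _ (hX' 0) (hX' 2), FormalGroup.map_isogeny _ _ (hX' 1) (hX' 2),
      FormalGroup.map_isogeny _ _ (FormalGroup.hasSubst_eval₂ _ (hX' 0) (hX' 1)) (hX' 2),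
      FormalGroup.map_eval₂ _ _ (hX' 0) (hX' 1)] at h
    simp only [MvPowerSeries.map_X] at h
    exact h
  have hmul := applyD_eq_of_isogeny_pow_dvd hD
  have hsq := constantCoeff_eq_sq_of_isogeny_pow_dvd (two_eq_zero (FaaDiBruno ⊗[ZMod 2] R)) hD
  have hconst : (PowerSeries.constantCoeff).comp D =
      squareHom (two_eq_zero (FaaDiBruno ⊗[ZMod 2] R)) := by
    refine tensor_ringHom_ext (fun a => ?_) hsq
    rw [RingHom.comp_apply, hincl, ← PowerSeries.coeff_zero_eq_constantCoeff_apply,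
      PowerSeries.coeff_map, PowerSeries.coeff_zero_eq_constantCoeff_apply, 𝒟.constantCoeff_D,
      map_pow]
    rfl
  -- Both sides are ring homomorphisms, so it suffices to compare them on `R` and on the
  -- coefficients of `h`.
  have hsymm : iterD (F.map (incl R)) D =
      (substHom _ constantCoeff_swap₂).comp (iterD (F.map (incl R)) D) := by
    refine tensor_ringHom_ext (fun a => ?_) (iterD_symm_of_multiplicative hG hlaw hmul)
    rw [RingHom.comp_apply, iterD_swap, iterD_apply, hincl]
    have h := congrArg (MvPowerSeries.map (incl R)) (𝒟.D_symm a)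
    rw [map_applyD hmap (fun _ => F.constantCoeff_isogeny (hX₂ 1) _) (hX₂ 0),
      map_applyD hmap (fun _ => F.constantCoeff_isogeny (hX₂ 0) _) (hX₂ 1),
      FormalGroup.map_isogeny _ _ (hX₂' 0) (hX₂' 1),
      FormalGroup.map_isogeny _ _ (hX₂' 1) (hX₂' 0)] at h
    simp only [MvPowerSeries.map_X] at h
    exact h
  refine ⟨{ D := D
            constantCoeff_D := RingHom.congr_fun hconst
            D_law := hlaw
            D_symm := fun a => ?_ }, ⟨hincl, hmul⟩⟩
  have h := RingHom.congr_fun hsymm a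
  rwa [RingHom.comp_apply, iterD_swap, iterD_apply] at h

variable {𝒟 : DStructure R F} {E : DStructure (FaaDiBruno ⊗[ZMod 2] R) (F.map (incl R))}

theorem IsInduced.isMultiplicative (hE : 𝒟.IsInduced E) : E.IsMultiplicative (seriesOver R) :=
  hE.D_series

theorem IsInduced.isHom_incl (hE : 𝒟.IsInduced E) : 𝒟.IsHom E (incl R) :=
  ⟨rfl, fun a => (hE.D_incl a).symm⟩

/-- The homomorphisms from the induced D-structure. -/
theorem IsInduced.isHom (hE : 𝒟.IsInduced E) {G : FormalGroup S} (hG : G.IsOrderTwo)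
    {ℰ : DStructure S G} {α : FaaDiBruno ⊗[ZMod 2] R →+* S}
    (hα : 𝒟.IsHom ℰ (α.comp (incl R)))
    (hm : ℰ.IsMultiplicative (PowerSeries.map α (seriesOver R))) : E.IsHom ℰ α := by
  have hlaw : (F.map (incl R)).map α = G := by
    rw [← hα.map_law]
    refine FormalGroup.ext ?_
    ext n
    rfl
  refine ⟨hlaw, RingHom.congr_fun (f := (PowerSeries.map α).comp E.D) (g := ℰ.D.comp α) ?_⟩
  refine tensor_ringHom_ext (fun a => ?_) fun j => ?_
  · rw [RingHom.comp_apply, RingHom.comp_apply, hE.D_incl]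
    exact hα.map_D a
  · exact hE.isMultiplicative.map_D_coeff hG hlaw hm j

/-- The identity is a homomorphism from `E` to `E'` by `IsInduced.isHom`. -/
theorem IsInduced.unique (hF : F.IsOrderTwo) (hE : 𝒟.IsInduced E)
    {E' : DStructure (FaaDiBruno ⊗[ZMod 2] R) (F.map (incl R))} (hE' : 𝒟.IsInduced E') (a) :
    E.D a = E'.D a := by
  have h := hE.isHom (hF.map _) (ℰ := E') (α := RingHom.id _) hE'.isHom_incl (by
    have : PowerSeries.map (RingHom.id _) (seriesOver R) = seriesOver R := by ext; simp
    rw [this]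
    exact hE'.isMultiplicative)
  refine Eq.trans ?_ (h.map_D a)
  ext
  simp

/-- The formal group law of `B_* ⊗ R` conjugate to that of `R` under `h`. -/
abbrev inducedLaw (F : FormalGroup R) : FormalGroup (FaaDiBruno ⊗[ZMod 2] R) :=
  (F.map (incl R)).conj (seriesOver R) (constantCoeff_seriesOver R) (isUnit_coeff_one_seriesOver R)

/-- The inverse series of `h`. -/
abbrev seriesInv (R : Type*) [CommRing R] [Algebra (ZMod 2) R] :
    PowerSeries (FaaDiBruno ⊗[ZMod 2] R) :=
  (seriesOver R).substInvOfIsUnit (isUnit_coeff_one_seriesOver R)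

/-- The induced D-structure on `B_* ⊗ R` in the parameter `h(t)`. -/
def IsInduced.twisted (hE : 𝒟.IsInduced E) :
    DStructure (FaaDiBruno ⊗[ZMod 2] R) (inducedLaw F) :=
  DStructure.twist (constantCoeff_seriesOver R) (isUnit_coeff_one_seriesOver R) hE.isMultiplicative

theorem IsInduced.twisted_D (hE : 𝒟.IsInduced E) (a) :
    hE.twisted.D a = PowerSeries.subst (seriesInv R) (E.D a) :=
  twist_D_apply _ _ _ a

theorem IsInduced.subst_twisted_D (hE : 𝒟.IsInduced E) (a) :
    PowerSeries.subst (seriesOver R) (hE.twisted.D a) = E.D a :=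
  subst_twist_D _ _ _ a

theorem IsInduced.isMultiplicative_seriesInv (hE : 𝒟.IsInduced E) :
    hE.twisted.IsMultiplicative (seriesInv R) :=
  IsMultiplicative.inv _ _ _

theorem constantCoeff_map {A B : Type*} [CommRing A] [CommRing B] (α : A →+* B)
    {k : PowerSeries A} (hk : PowerSeries.constantCoeff k = 0) :
    PowerSeries.constantCoeff (PowerSeries.map α k) = 0 := by
  rw [← PowerSeries.coeff_zero_eq_constantCoeff_apply, PowerSeries.coeff_map,
    PowerSeries.coeff_zero_eq_constantCoeff_apply, hk, map_zero]

theorem isUnit_coeff_one_map {A B : Type*} [CommRing A] [CommRing B] (α : A →+* B)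
    {k : PowerSeries A} (hk : IsUnit (PowerSeries.coeff 1 k)) :
    IsUnit (PowerSeries.coeff 1 (PowerSeries.map α k)) := by
  rw [PowerSeries.coeff_map]
  exact hk.map α

theorem isUnit_coeff_one_inv {k : PowerSeries S}
    (hk' : IsUnit (PowerSeries.coeff 1 k)) :
    IsUnit (PowerSeries.coeff 1 (k.substInvOfIsUnit hk')) := by
  rw [PowerSeries.coeff_one_substInvOfIsUnit]
  exact Units.isUnit _

theorem inv_inv {k : PowerSeries S} (hk : PowerSeries.constantCoeff k = 0)
    (hk' : IsUnit (PowerSeries.coeff 1 k)) :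
    (k.substInvOfIsUnit hk').substInvOfIsUnit (isUnit_coeff_one_inv hk') = k := by
  have h := FormalGroup.subst_inv_subst (k.substInvOfIsUnit hk')
    (k.constantCoeff_substInvOfIsUnit hk') (isUnit_coeff_one_inv hk') (a := k) hk
  rw [k.subst_substInvOfIsUnit_left hk hk'] at h
  exact (PowerSeries.X_subst _).symm.trans h

theorem conj_conj_inv (F : FormalGroup S) {k : PowerSeries S}
    (hk : PowerSeries.constantCoeff k = 0) (hk' : IsUnit (PowerSeries.coeff 1 k)) :
    (F.conj k hk hk').conj (k.substInvOfIsUnit hk') (k.constantCoeff_substInvOfIsUnit hk')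
      (isUnit_coeff_one_inv hk') = F := by
  have hX (i : Fin 2) : constantCoeff (X i : MvPowerSeries (Fin 2) S) = 0 := constantCoeff_X i
  have hq (i : Fin 2) := constantCoeff_powerSeries_subst (k.constantCoeff_substInvOfIsUnit hk')
    (hX i)
  refine (FormalGroup.eq_conj _ _ _ ?_).symm
  have h := F.conj_eval₂ k hk hk' (hq 0) (hq 1)
  rw [FormalGroup.subst_subst_inv k hk hk' (hX 0), FormalGroup.subst_subst_inv k hk hk' (hX 1)] at h
  rw [h, FormalGroup.subst_inv_subst k hk hk' (F.constantCoeff_eval₂ (hq 0) (hq 1))]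

/-- The homomorphisms from the induced D-structure in the parameter `h(t)`. -/
theorem IsInduced.isHom_twisted (hF : F.IsOrderTwo) (hE : 𝒟.IsInduced E) {G : FormalGroup S}
    {ℰ : DStructure S G} {α : FaaDiBruno ⊗[ZMod 2] R →+* S}
    (hlaw : (inducedLaw F).map α = G)
    (hm : ℰ.IsMultiplicative (PowerSeries.map α (seriesInv R)))
    (hα : ∀ a, ℰ.D (α (incl R a)) = PowerSeries.subst (PowerSeries.map α (seriesInv R))
      (PowerSeries.map α (PowerSeries.map (incl R) (𝒟.D a)))) : hE.twisted.IsHom ℰ α := by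
  refine ⟨hlaw, fun a => ?_⟩
  have hk := constantCoeff_map α (constantCoeff_seriesOver R)
  have hk' := isUnit_coeff_one_map α (isUnit_coeff_one_seriesOver R)
  have hinv := map_inv α (constantCoeff_seriesOver R) (isUnit_coeff_one_seriesOver R) rfl hk'
  have hG := map_conj α (constantCoeff_seriesOver R) (isUnit_coeff_one_seriesOver R) rfl hk hk'
    (F.map (incl R))
  rw [hlaw] at hG
  have hq := constantCoeff_map α
    ((seriesOver R).constantCoeff_substInvOfIsUnit (isUnit_coeff_one_seriesOver R))
  have hq' := isUnit_coeff_one_map α (isUnit_coeff_one_inv (isUnit_coeff_one_seriesOver R))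
  have hqq : (PowerSeries.map α (seriesInv R)).substInvOfIsUnit hq' =
      PowerSeries.map α (seriesOver R) := by
    rw [← map_inv α ((seriesOver R).constantCoeff_substInvOfIsUnit _)
      (isUnit_coeff_one_inv (isUnit_coeff_one_seriesOver R)) rfl hq',
      inv_inv (constantCoeff_seriesOver R)]
  have hGq : G.conj _ hq hq' = (F.map (incl R)).map α := by
    subst hG
    have h := conj_conj_inv ((F.map (incl R)).map α) hk hk'
    refine Eq.trans ?_ h
    congr 1
  -- Twisting `ℰ` by the image of `h⁻¹` undoes the change of parameter on the source. What remains
  -- concerns the untwisted `E`, where only `R` and `h` have to be checked.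
  have hhom : E.IsHom (DStructure.twist hq hq' hm) α := by
    refine hE.isHom (hGq ▸ (hF.map _).map α) ⟨?_, fun a => ?_⟩ ?_
    · rw [hGq]
      refine FormalGroup.ext ?_
      ext n
      rfl
    · rw [twist_D_apply, RingHom.comp_apply, hα, hqq,
        PowerSeries.subst_comp_subst_apply (PowerSeries.HasSubst.of_constantCoeff_zero' hq)
        (PowerSeries.HasSubst.of_constantCoeff_zero' hk), hinv,
        PowerSeries.subst_substInvOfIsUnit_left _ hk hk']
      exact (PowerSeries.X_subst _).symm
    · have h := IsMultiplicative.inv hq hq' hm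
      rwa [hqq] at h
  rw [hE.twisted_D]
  have h1 : PowerSeries.map α (PowerSeries.subst (seriesInv R) (E.D a)) =
      PowerSeries.subst (PowerSeries.map α (seriesInv R)) (PowerSeries.map α (E.D a)) :=
    PowerSeries.map_subst (hasSubst_inv _) _
  rw [h1, hhom.map_D, subst_twist_D]

end DStructure

/-! ### The universal property of the free D-ring -/

namespace LazardTwo

theorem ringHom_ext {A : Type*} [CommRing A] {f g : LazardTwo →+* A}
    (h : univ.map f = univ.map g) : f = g := by
  have h' : f.comp mk.toRingHom = g.comp mk.toRingHom := by
    refine MvPolynomial.ringHom_ext' (Subsingleton.elim _ _) fun n => ?_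
    have hn := congrArg (fun G => MvPowerSeries.coeff n.1 (FormalGroup.toPowerSeries G)) h
    have hgen : MvPowerSeries.coeff n.1 generic = MvPolynomial.X n := by
      change generic n.1 = _
      rw [generic, dif_pos n.2]
    change f (mk (MvPowerSeries.coeff n.1 generic)) = g (mk (MvPowerSeries.coeff n.1 generic)) at hn
    rwa [hgen] at hn
  refine RingHom.ext fun a => ?_
  obtain ⟨p, rfl⟩ := Ideal.Quotient.mkₐ_surjective (ZMod 2) relations a
  exact RingHom.congr_fun h' p

theorem law_isOrderTwo (R : Type*) [CommRing R] [Algebra LazardTwo R] : (law R).IsOrderTwo :=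
  univ_isOrderTwo.map _

theorem lift_eq {A : Type*} [CommRing A] [Algebra (ZMod 2) A] {F : FormalGroup A}
    (hF : F.IsOrderTwo) {f : LazardTwo →+* A} (hf : univ.map f = F) :
    f = (lift F hF).toRingHom :=
  ringHom_ext (hf.trans (map_lift F hF).symm)

end LazardTwo

namespace FreeDRing

variable {M : Type u} [AddCommGroup M] [Module LazardTwo M]

theorem law_map {S : Type*} [CommRing S] (g : FreeDRing M →+* S) :
    (LazardTwo.law (FreeDRing M)).map g =
      LazardTwo.univ.map (g.comp (algebraMap LazardTwo (FreeDRing M))) := by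
  refine FormalGroup.ext ?_
  ext n
  rfl

/-- The universal property of the free D-ring, for rings with a D-structure. -/
theorem existsUnique_ringHom {S : Type u} [CommRing S] [Algebra (ZMod 2) S] {F : FormalGroup S}
    (hF : F.IsOrderTwo) (𝒟 : DStructure S F) (f : M →+ S)
    (hf : ∀ (n : LazardTwo) (m : M), f (n • m) = LazardTwo.lift F hF n * f m) :
    ∃! g : FreeDRing M →+* S, (str M).IsHom 𝒟 g ∧ ∀ m, g (ι M m) = f m := by
  -- The `N_*`-structure is the one classified by `F`. In the application to `B_* ⊗ D⟨M⟩` this is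
  -- the conjugate law, not the law of `D⟨M⟩`.
  let alg : Algebra LazardTwo S := (LazardTwo.lift F hF).toRingHom.toAlgebra
  have hlaw : LazardTwo.law S = F := LazardTwo.map_lift F hF
  have hmap : ∀ n, algebraMap LazardTwo S n = LazardTwo.lift F hF n := fun _ => rfl
  clear_value alg
  have hf' : ∀ (n : LazardTwo) (m : M), f (n • m) = algebraMap LazardTwo S n * f m := by
    intro n m
    rw [hf, hmap]
  clear hf hmap
  subst hlaw
  let f' : M →ₗ[LazardTwo] S :=
    { f with
      map_smul' := fun n m => by
        rw [RingHom.id_apply, Algebra.smul_def]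
        exact hf' n m }
  obtain ⟨g, ⟨hg, hgι⟩, huniq⟩ := existsUnique_hom 𝒟 f'
  refine ⟨g.toRingHom, ⟨⟨?_, hg⟩, hgι⟩, ?_⟩
  · rw [law_map]
    exact congrArg LazardTwo.univ.map (RingHom.ext g.commutes)
  · rintro g' ⟨hg', hg'ι⟩
    have hcomm : g'.comp (algebraMap LazardTwo (FreeDRing M)) = algebraMap LazardTwo S := by
      refine LazardTwo.ringHom_ext ?_
      rw [← law_map]
      exact hg'.map_law
    have := huniq { g' with commutes' := RingHom.congr_fun hcomm } ⟨hg'.map_D, hg'ι⟩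
    rw [← this]

end FreeDRing

/-! ### The induced formal group law under the counit, the diagonal and extension of scalars -/

namespace DStructure

open MvPowerSeries

variable {S : Type*} [CommRing S]

theorem inv_X (h : IsUnit (PowerSeries.coeff 1 (PowerSeries.X : PowerSeries S))) :
    (PowerSeries.X : PowerSeries S).substInvOfIsUnit h = PowerSeries.X := by
  have h' := (PowerSeries.X : PowerSeries S).subst_substInvOfIsUnit_right
    PowerSeries.constantCoeff_X h
  rwa [PowerSeries.subst_X (hasSubst_inv h)] at h'

theorem conj_X (F : FormalGroup S)
    (h : IsUnit (PowerSeries.coeff 1 (PowerSeries.X : PowerSeries S))) :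
    F.conj PowerSeries.X PowerSeries.constantCoeff_X h = F := by
  refine (FormalGroup.eq_conj _ _ _ ?_).symm
  have hX (i : Fin 2) : PowerSeries.HasSubst (X i : MvPowerSeries (Fin 2) S) := .X i
  rw [PowerSeries.subst_X (hX 0), PowerSeries.subst_X (hX 1),
    PowerSeries.subst_X (F.hasSubst_eval₂ (hX 0) (hX 1))]

theorem constantCoeff_comp {k l : PowerSeries S} (hk : PowerSeries.constantCoeff k = 0)
    (hl : PowerSeries.constantCoeff l = 0) :
    PowerSeries.constantCoeff (PowerSeries.subst k l : PowerSeries S) = 0 :=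
  constantCoeff_powerSeries_subst (τ := Unit) hl hk

theorem isUnit_coeff_one_comp {k l : PowerSeries S} (hk : PowerSeries.constantCoeff k = 0)
    (hk' : IsUnit (PowerSeries.coeff 1 k)) (hl' : IsUnit (PowerSeries.coeff 1 l)) :
    IsUnit (PowerSeries.coeff 1 (PowerSeries.subst k l : PowerSeries S)) := by
  rw [FaaDiBruno.coeff_one_subst _ _ hk]
  exact hl'.mul hk'

theorem conj_conj (F : FormalGroup S) {k l : PowerSeries S}
    (hk : PowerSeries.constantCoeff k = 0) (hk' : IsUnit (PowerSeries.coeff 1 k))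
    (hl : PowerSeries.constantCoeff l = 0) (hl' : IsUnit (PowerSeries.coeff 1 l)) :
    (F.conj k hk hk').conj l hl hl' = F.conj (PowerSeries.subst k l) (constantCoeff_comp hk hl)
      (isUnit_coeff_one_comp hk hk' hl') := by
  have hX (i : Fin 2) : constantCoeff (X i : MvPowerSeries (Fin 2) S) = 0 := constantCoeff_X i
  have hkX (i : Fin 2) := constantCoeff_powerSeries_subst hk (hX i)
  have hc {a : MvPowerSeries (Fin 2) S} (ha : constantCoeff a = 0) :
      PowerSeries.subst a (PowerSeries.subst k l : PowerSeries S) =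
        PowerSeries.subst (PowerSeries.subst a k) l :=
    PowerSeries.subst_comp_subst_apply (PowerSeries.HasSubst.of_constantCoeff_zero' hk)
      (PowerSeries.HasSubst.of_constantCoeff_zero ha) l
  refine FormalGroup.eq_conj _ _ _ ?_
  rw [hc (hX 0), hc (hX 1), hc (F.constantCoeff_eval₂ (hX 0) (hX 1)),
    FormalGroup.conj_eval₂ _ l hl hl' (hkX 0) (hkX 1), F.conj_eval₂ k hk hk' (hX 0) (hX 1)]

theorem inv_comp {k l : PowerSeries S}
    (hk : PowerSeries.constantCoeff k = 0) (hk' : IsUnit (PowerSeries.coeff 1 k))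
    (hl : PowerSeries.constantCoeff l = 0) (hl' : IsUnit (PowerSeries.coeff 1 l)) :
    PowerSeries.substInvOfIsUnit (PowerSeries.subst k l) (isUnit_coeff_one_comp hk hk' hl') =
      PowerSeries.subst (l.substInvOfIsUnit hl') (k.substInvOfIsUnit hk') := by
  have hql := l.constantCoeff_substInvOfIsUnit hl'
  have hq : PowerSeries.constantCoeff
      (PowerSeries.subst (l.substInvOfIsUnit hl') (k.substInvOfIsUnit hk')) = 0 :=
    constantCoeff_comp hql (k.constantCoeff_substInvOfIsUnit hk')
  have h := FormalGroup.subst_inv_subst (PowerSeries.subst k l) (constantCoeff_comp hk hl)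
    (isUnit_coeff_one_comp hk hk' hl') (τ := Unit) (a := PowerSeries.subst (l.substInvOfIsUnit hl')
      (k.substInvOfIsUnit hk')) hq
  rw [PowerSeries.subst_comp_subst_apply (PowerSeries.HasSubst.of_constantCoeff_zero' hk)
    (PowerSeries.HasSubst.of_constantCoeff_zero' hq), FormalGroup.subst_subst_inv k hk hk' hql,
    l.subst_substInvOfIsUnit_right hl hl'] at h
  exact (PowerSeries.X_subst _).symm.trans h

end DStructure

namespace FaaDiBruno

open DStructure

section maps

variable {R S : Type*} [CommRing R] [Algebra (ZMod 2) R] [CommRing S] [Algebra (ZMod 2) S]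

/-- A ring homomorphism between algebras over `Z/2` is a homomorphism of algebras. -/
def algHom (α : R →+* S) : R →ₐ[ZMod 2] S :=
  { α with
    commutes' := fun r => RingHom.congr_fun (Subsingleton.elim
      (α.comp (algebraMap (ZMod 2) R)) (algebraMap (ZMod 2) S)) r }

/-- The homomorphism `B_* ⊗ R → B_* ⊗ S` induced by a homomorphism `R → S`. -/
def baseMap (α : R →+* S) : FaaDiBruno ⊗[ZMod 2] R →+* FaaDiBruno ⊗[ZMod 2] S :=
  (Algebra.TensorProduct.map (AlgHom.id (ZMod 2) FaaDiBruno) (algHom α)).toRingHom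

theorem baseMap_eq_lTensor (α : R →+* S) (x : FaaDiBruno ⊗[ZMod 2] R) :
    baseMap α x = (algHom α).toLinearMap.lTensor FaaDiBruno x := rfl

theorem baseMap_comp_incl (α : R →+* S) : (baseMap α).comp (incl R) = (incl S).comp α := rfl

theorem map_baseMap_seriesOver (α : R →+* S) :
    PowerSeries.map (baseMap α) (seriesOver R) = seriesOver S := by
  refine PowerSeries.ext fun j => ?_
  rw [seriesOver, seriesOver, PowerSeries.coeff_map, PowerSeries.coeff_map, PowerSeries.coeff_map]
  change _ ⊗ₜ[ZMod 2] α 1 = _ ⊗ₜ[ZMod 2] 1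
  rw [map_one]
  rfl

/-- The homomorphism `ε ⊗ 1 : B_* ⊗ R → R`. -/
def counitMap (R : Type*) [CommRing R] [Algebra (ZMod 2) R] : FaaDiBruno ⊗[ZMod 2] R →+* R :=
  ((Algebra.TensorProduct.lid (ZMod 2) R).toAlgHom.comp
    (Algebra.TensorProduct.map counit (AlgHom.id (ZMod 2) R))).toRingHom

theorem counitMap_eq (x : FaaDiBruno ⊗[ZMod 2] R) :
    counitMap R x = TensorProduct.lid (ZMod 2) R (counit.toLinearMap.rTensor R x) := rfl

theorem counitMap_comp_incl : (counitMap R).comp (incl R) = RingHom.id R := by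
  refine RingHom.ext fun r => ?_
  change counit 1 • r = r
  rw [map_one, one_smul]

theorem map_counit_series : PowerSeries.map counit.toRingHom series = PowerSeries.X := by
  refine PowerSeries.ext fun j => ?_
  cases j with
  | zero =>
    rw [PowerSeries.coeff_map, PowerSeries.coeff_zero_eq_constantCoeff_apply, constantCoeff_series,
      map_zero, PowerSeries.coeff_zero_X]
  | succ j =>
    rw [PowerSeries.coeff_map, coeff_succ_series]
    exact lift_gen _ _ _

theorem map_counitMap_seriesOver :
    PowerSeries.map (counitMap R) (seriesOver R) = PowerSeries.X := by
  have h := congrArg (PowerSeries.map (algebraMap (ZMod 2) R)) map_counit_series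
  rw [PowerSeries.map_X] at h
  rw [← h]
  refine PowerSeries.ext fun j => ?_
  rw [seriesOver, PowerSeries.coeff_map, PowerSeries.coeff_map, PowerSeries.coeff_map,
    PowerSeries.coeff_map]
  exact (Algebra.algebraMap_eq_smul_one _).symm

theorem inducedLaw_counit (F : FormalGroup R) : (inducedLaw F).map (counitMap R) = F := by
  have hX : IsUnit (PowerSeries.coeff 1 (PowerSeries.X : PowerSeries R)) := by simp
  rw [map_conj (counitMap R) _ _ map_counitMap_seriesOver PowerSeries.constantCoeff_X hX, conj_X]
  refine FormalGroup.ext ?_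
  ext n
  exact RingHom.congr_fun counitMap_comp_incl _

theorem inducedLaw_baseMap (F : FormalGroup R) (α : R →+* S) :
    (inducedLaw F).map (baseMap α) = inducedLaw (F.map α) := by
  rw [map_conj (baseMap α) _ _ (map_baseMap_seriesOver α) (constantCoeff_seriesOver S)
    (isUnit_coeff_one_seriesOver S)]
  rfl

/-- The homomorphism `δ ⊗ 1 : B_* ⊗ R → B_* ⊗ (B_* ⊗ R)`. -/
def comulMap (R : Type*) [CommRing R] [Algebra (ZMod 2) R] :
    FaaDiBruno ⊗[ZMod 2] R →+* FaaDiBruno ⊗[ZMod 2] (FaaDiBruno ⊗[ZMod 2] R) :=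
  ((Algebra.TensorProduct.assoc (ZMod 2) (ZMod 2) (ZMod 2) FaaDiBruno FaaDiBruno R).toAlgHom.comp
    (Algebra.TensorProduct.map comul (AlgHom.id (ZMod 2) R))).toRingHom

theorem comulMap_eq (x : FaaDiBruno ⊗[ZMod 2] R) :
    comulMap R x = TensorProduct.assoc (ZMod 2) FaaDiBruno FaaDiBruno R
      (comul.toLinearMap.rTensor R x) := rfl

theorem comulMap_comp_incl :
    (comulMap R).comp (incl R) = (incl (FaaDiBruno ⊗[ZMod 2] R)).comp (incl R) := by
  refine RingHom.ext fun r => ?_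
  change TensorProduct.assoc (ZMod 2) FaaDiBruno FaaDiBruno R (comul 1 ⊗ₜ r) = _
  rw [map_one]
  rfl

theorem map_comul_series : PowerSeries.map comul.toRingHom series = comulSeries := by
  refine PowerSeries.ext fun j => ?_
  cases j with
  | zero =>
    rw [PowerSeries.coeff_map, PowerSeries.coeff_zero_eq_constantCoeff_apply, constantCoeff_series,
      map_zero, PowerSeries.coeff_zero_eq_constantCoeff_apply, comulSeries]
    exact (constantCoeff_comp (constantCoeff_map _ constantCoeff_series)
      (constantCoeff_map _ constantCoeff_series)).symm
  | succ j =>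
    rw [PowerSeries.coeff_map, coeff_succ_series]
    exact lift_gen _ _ _

theorem assoc_tmul_one {k A B C : Type*} [CommRing k] [CommRing A] [Algebra k A] [CommRing B]
    [Algebra k B] [CommRing C] [Algebra k C] (x : A ⊗[k] B) :
    TensorProduct.assoc k A B C (x ⊗ₜ 1) =
      (Algebra.TensorProduct.includeLeft : B →ₐ[k] B ⊗[k] C).toLinearMap.lTensor A x := by
  induction x using TensorProduct.induction_on with
  | zero => rw [TensorProduct.zero_tmul, map_zero, map_zero]
  | add x y hx hy => rw [TensorProduct.add_tmul, map_add, map_add, hx, hy]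
  | tmul a b => rfl

/-- After reassociation `h ⊗ 1` is the series of the outer factor `B_*`, and `1 ⊗ h` is that of the
inner `B_* ⊗ R`. -/
theorem map_comulMap_seriesOver : PowerSeries.map (comulMap R) (seriesOver R) =
    PowerSeries.subst (PowerSeries.map (incl (FaaDiBruno ⊗[ZMod 2] R)) (seriesOver R))
      (seriesOver (FaaDiBruno ⊗[ZMod 2] R)) := by
  let j := baseMap (R := FaaDiBruno) (S := FaaDiBruno ⊗[ZMod 2] R) (Algebra.TensorProduct.includeLeft :
      FaaDiBruno →ₐ[ZMod 2] FaaDiBruno ⊗[ZMod 2] R).toRingHom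
  have h1 : PowerSeries.map (comulMap R) (seriesOver R) = PowerSeries.map j comulSeries := by
    rw [← map_comul_series]
    refine PowerSeries.ext fun i => ?_
    rw [seriesOver, PowerSeries.coeff_map, PowerSeries.coeff_map, PowerSeries.coeff_map,
      PowerSeries.coeff_map]
    change TensorProduct.assoc (ZMod 2) FaaDiBruno FaaDiBruno R
      (comul (PowerSeries.coeff i series) ⊗ₜ 1) = j (comul (PowerSeries.coeff i series))
    exact assoc_tmul_one (comul (PowerSeries.coeff i series))
  rw [h1, comulSeries]
  refine (PowerSeries.map_subst (PowerSeries.HasSubst.of_constantCoeff_zero'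
    (constantCoeff_map _ constantCoeff_series)) _).trans ?_
  congr 1

/-- Conjugation by the composite `(h ⊗ 1) ∘ (1 ⊗ h)` is conjugation by the inner series followed by
the outer one. -/
theorem inducedLaw_comul (F : FormalGroup R) :
    (inducedLaw F).map (comulMap R) = inducedLaw (inducedLaw F) := by
  have hk := constantCoeff_map (incl (FaaDiBruno ⊗[ZMod 2] R)) (constantCoeff_seriesOver R)
  have hk' := isUnit_coeff_one_map (incl (FaaDiBruno ⊗[ZMod 2] R)) (isUnit_coeff_one_seriesOver R)
  rw [map_conj (comulMap R) _ _ map_comulMap_seriesOver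
    (constantCoeff_comp hk (constantCoeff_seriesOver _))
    (isUnit_coeff_one_comp hk hk' (isUnit_coeff_one_seriesOver _)),
    ← conj_conj _ hk hk' (constantCoeff_seriesOver _) (isUnit_coeff_one_seriesOver _)]
  · congr 1
    rw [map_conj (incl (FaaDiBruno ⊗[ZMod 2] R)) (constantCoeff_seriesOver R)
      (isUnit_coeff_one_seriesOver R) rfl hk hk']
    congr 1
    refine FormalGroup.ext ?_
    ext n
    exact RingHom.congr_fun comulMap_comp_incl _

theorem map_comulMap_seriesInv : PowerSeries.map (comulMap R) (seriesInv R) =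
    PowerSeries.subst (seriesInv (FaaDiBruno ⊗[ZMod 2] R))
      (PowerSeries.map (incl (FaaDiBruno ⊗[ZMod 2] R)) (seriesInv R)) := by
  have hk := constantCoeff_map (incl (FaaDiBruno ⊗[ZMod 2] R)) (constantCoeff_seriesOver R)
  have hk' := isUnit_coeff_one_map (incl (FaaDiBruno ⊗[ZMod 2] R)) (isUnit_coeff_one_seriesOver R)
  rw [map_inv (comulMap R) (constantCoeff_seriesOver R) _ map_comulMap_seriesOver
    (isUnit_coeff_one_comp hk hk' (isUnit_coeff_one_seriesOver _)),
    inv_comp hk hk' (constantCoeff_seriesOver _),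
    map_inv (incl (FaaDiBruno ⊗[ZMod 2] R)) (constantCoeff_seriesOver R) _ rfl hk']

end maps

end FaaDiBruno

/-! ### Counit, diagonal and extension of scalars as homomorphisms of twisted D-structures -/

namespace DStructure

open FaaDiBruno

variable {R S : Type*} [CommRing R] [Algebra (ZMod 2) R] [CommRing S] [Algebra (ZMod 2) S]
  {F : FormalGroup R} {𝒟 : DStructure R F}
  {E : DStructure (FaaDiBruno ⊗[ZMod 2] R) (F.map (incl R))}

theorem inducedLaw_isOrderTwo (hF : F.IsOrderTwo) : (inducedLaw F).IsOrderTwo :=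
  (hF.map _).conj _ _ _

/-- The counit sends `h` to `x`, so the parameter `h(t)` becomes `t` again and the twist disappears.
-/
theorem IsInduced.isHom_counitMap (hF : F.IsOrderTwo) (hE : 𝒟.IsInduced E) :
    hE.twisted.IsHom 𝒟 (counitMap R) := by
  have hX : IsUnit (PowerSeries.coeff 1 (PowerSeries.X : PowerSeries R)) := by simp
  have hinv : PowerSeries.map (counitMap R) (seriesInv R) = PowerSeries.X := by
    rw [map_inv (counitMap R) (constantCoeff_seriesOver R) _ map_counitMap_seriesOver hX, inv_X]
  have hi (a : R) : counitMap R (incl R a) = a := RingHom.congr_fun counitMap_comp_incl a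
  refine hE.isHom_twisted hF (inducedLaw_counit F) ?_ fun a => ?_
  · rw [hinv]
    exact isMultiplicative_X
  · rw [hinv, hi]
    refine Eq.trans ?_ (PowerSeries.X_subst _).symm
    ext n
    rw [PowerSeries.coeff_map, PowerSeries.coeff_map, hi]

/-- The diagonal sends `h⁻¹` to the inner inverse series composed with the outer one. Changing the
parameter by it is the same as two successive twists, which is how the structure on `B_* ⊗ (B_* ⊗
R)` is built. -/
theorem IsInduced.isHom_comulMap (hF : F.IsOrderTwo) (hE : 𝒟.IsInduced E)
    {E₂ : DStructure (FaaDiBruno ⊗[ZMod 2] (FaaDiBruno ⊗[ZMod 2] R)) ((inducedLaw F).map (incl _))}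
    (hE₂ : hE.twisted.IsInduced E₂) : hE.twisted.IsHom hE₂.twisted (comulMap R) := by
  have hi (a : R) : comulMap R (incl R a) = incl (FaaDiBruno ⊗[ZMod 2] R) (incl R a) :=
    RingHom.congr_fun comulMap_comp_incl a
  refine hE.isHom_twisted hF (inducedLaw_comul F) ?_ fun a => ?_
  · rw [map_comulMap_seriesInv]
    exact IsMultiplicative.comp_inv _ _ _
      (hE₂.isHom_incl.isMultiplicative_map hE.isMultiplicative_seriesInv)
  · have h1 : PowerSeries.map (incl (FaaDiBruno ⊗[ZMod 2] R))
        (PowerSeries.subst (seriesInv R) (PowerSeries.map (incl R) (𝒟.D a))) =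
        PowerSeries.subst (PowerSeries.map (incl (FaaDiBruno ⊗[ZMod 2] R)) (seriesInv R))
          (PowerSeries.map (incl (FaaDiBruno ⊗[ZMod 2] R)) (PowerSeries.map (incl R) (𝒟.D a))) :=
      PowerSeries.map_subst (hasSubst_inv _) _
    have h2 : PowerSeries.map (comulMap R) (PowerSeries.map (incl R) (𝒟.D a)) =
        PowerSeries.map (incl (FaaDiBruno ⊗[ZMod 2] R)) (PowerSeries.map (incl R) (𝒟.D a)) := by
      ext n
      rw [PowerSeries.coeff_map, PowerSeries.coeff_map, PowerSeries.coeff_map,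
        PowerSeries.coeff_map, hi]
    rw [hi, hE₂.twisted_D, hE₂.D_incl, hE.twisted_D, hE.D_incl, h1, h2, map_comulMap_seriesInv]
    exact PowerSeries.subst_comp_subst_apply (PowerSeries.HasSubst.of_constantCoeff_zero'
      (constantCoeff_map _ (PowerSeries.constantCoeff_substInvOfIsUnit _ _)))
      (hasSubst_inv _) _

theorem IsInduced.isHom_baseMap (hE : 𝒟.IsInduced E) {G : FormalGroup S} (hG : G.IsOrderTwo)
    {ℰ : DStructure S G} {E' : DStructure (FaaDiBruno ⊗[ZMod 2] S) (G.map (incl S))}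
    (hE' : ℰ.IsInduced E') {α : R →+* S} (hα : 𝒟.IsHom ℰ α) :
    hE.twisted.IsHom hE'.twisted (baseMap α) := by
  have h : E.IsHom E' (baseMap α) := by
    refine hE.isHom (hG.map _) ?_ ?_
    · rw [baseMap_comp_incl]
      exact hE'.isHom_incl.comp hα
    · rw [map_baseMap_seriesOver]
      exact hE'.isMultiplicative
  exact h.twist _ _ _ (map_baseMap_seriesOver α) _ _ _

end DStructure

/-! ### Coactions on algebras over the Lazard ring -/

namespace TensorProduct

variable {k B N R M : Type*} [CommRing k] [CommRing B] [Algebra k B] [CommRing N] [Algebra k N]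
  [CommRing R] [Algebra k R] [AddCommGroup M] [Module k M]

/-- This turns the pairing in the definition of a coaction into the product of the ring `B ⊗ R`. It
is used for the canonical map of a module into its free D-ring, and for the identity of an algebra.
-/
theorem lTensor_map₂_lsmul [Module N M] [IsScalarTower k N M] (a : N →ₐ[k] R) (j : M →ₗ[k] R)
    (hj : ∀ n m, j (n • m) = a n * j m) (x : B ⊗[k] N) (y : B ⊗[k] M) :
    j.lTensor B (map₂ (LinearMap.mul k B)
      (Algebra.lsmul k k M : N →ₐ[k] Module.End k M).toLinearMap x y) =
      Algebra.TensorProduct.map (AlgHom.id k B) a x * j.lTensor B y := by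
  induction x using TensorProduct.induction_on with
  | zero => rw [map_zero, LinearMap.zero_apply, map_zero, map_zero, zero_mul]
  | add x x' hx hx' => rw [map_add, LinearMap.add_apply, map_add, map_add, add_mul, hx, hx']
  | tmul b n =>
    induction y using TensorProduct.induction_on with
    | zero => rw [map_zero, map_zero, mul_zero]
    | add y y' hy hy' => rw [map_add, map_add, map_add, mul_add, hy, hy']
    | tmul b' m =>
      change (b * b') ⊗ₜ[k] j (n • m) = (b ⊗ₜ[k] a n) * (b' ⊗ₜ[k] j m)
      rw [Algebra.TensorProduct.tmul_mul_tmul, hj]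

theorem lid_rTensor_lTensor (ε : B →ₗ[k] k) (j : M →ₗ[k] R) (x : B ⊗[k] M) :
    TensorProduct.lid k R (ε.rTensor R (j.lTensor B x)) =
      j (TensorProduct.lid k M (ε.rTensor M x)) := by
  induction x using TensorProduct.induction_on with
  | zero => simp only [map_zero]
  | add x y hx hy => simp only [map_add, hx, hy]
  | tmul b m => exact (map_smul j (ε b) m).symm

theorem assoc_tmul_lTensor (j : M →ₗ[k] R) (x : B ⊗[k] B) (m : M) :
    TensorProduct.assoc k B B R (x ⊗ₜ j m) =
      (j.lTensor B).lTensor B (TensorProduct.assoc k B B M (x ⊗ₜ m)) := by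
  induction x using TensorProduct.induction_on with
  | zero => simp only [zero_tmul, map_zero]
  | add x y hx hy => simp only [add_tmul, map_add, hx, hy]
  | tmul b b' => rfl

theorem assoc_rTensor_lTensor (δ : B →ₗ[k] B ⊗[k] B) (j : M →ₗ[k] R) (x : B ⊗[k] M) :
    TensorProduct.assoc k B B R (δ.rTensor R (j.lTensor B x)) =
      (j.lTensor B).lTensor B (TensorProduct.assoc k B B M (δ.rTensor M x)) := by
  induction x using TensorProduct.induction_on with
  | zero => simp only [map_zero]
  | add x y hx hy => simp only [map_add, hx, hy]
  | tmul b m => exact assoc_tmul_lTensor j (δ b) m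

theorem lTensor_lTensor_of_comp {P : Type*} [AddCommGroup P] [Module k P] {Q : Type*}
    [AddCommGroup Q] [Module k Q] (j : M →ₗ[k] R) (g : R →ₗ[k] P) (c : M →ₗ[k] Q) (l : Q →ₗ[k] P)
    (h : ∀ m, g (j m) = l (c m)) (x : B ⊗[k] M) :
    g.lTensor B (j.lTensor B x) = l.lTensor B (c.lTensor B x) := by
  rw [← LinearMap.lTensor_comp_apply, ← LinearMap.lTensor_comp_apply]
  congr 2
  exact LinearMap.ext h

end TensorProduct

open DStructure FaaDiBruno

namespace LazardTwo

theorem map_coaction : univ.map coaction.toRingHom = inducedLaw univ := map_lift _ _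

variable {R : Type*} [CommRing R] [Algebra (ZMod 2) R] [Algebra LazardTwo R]

theorem map_baseMap_coaction :
    univ.map ((baseMap (algebraMap LazardTwo R)).comp coaction.toRingHom) =
      inducedLaw (law R) := by
  refine Eq.trans ?_ (inducedLaw_baseMap univ (algebraMap LazardTwo R))
  rw [← map_coaction]
  refine FormalGroup.ext ?_
  ext n
  rfl

end LazardTwo

namespace LNCoaction

section algebra

variable {R : Type*} [CommRing R] [Algebra (ZMod 2) R] [Algebra LazardTwo R]
  [IsScalarTower (ZMod 2) LazardTwo R]

theorem map₂_lsmul_eq_mul (x : FaaDiBruno ⊗[ZMod 2] LazardTwo) (y : FaaDiBruno ⊗[ZMod 2] R) :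
    TensorProduct.map₂ (LinearMap.mul (ZMod 2) FaaDiBruno)
      (Algebra.lsmul (ZMod 2) (ZMod 2) R : LazardTwo →ₐ[ZMod 2] Module.End (ZMod 2) R).toLinearMap
      x y = baseMap (algebraMap LazardTwo R) x * y := by
  have h := TensorProduct.lTensor_map₂_lsmul (B := FaaDiBruno) (algHom (algebraMap LazardTwo R))
    (LinearMap.id (R := ZMod 2) (M := R)) (fun n m => Algebra.smul_def n m) x y
  rw [LinearMap.lTensor_id, LinearMap.id_apply, LinearMap.id_apply] at h
  exact h

/-- A coassociative and counital ring homomorphism `R → B_* ⊗ R` that is compatible with the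
coaction on `N_*`, as a Landweber-Novikov coaction. -/
def ofRingHom (g : R →+* FaaDiBruno ⊗[ZMod 2] R) (hcounit : (counitMap R).comp g = RingHom.id R)
    (hcoassoc : (comulMap R).comp g = (baseMap g).comp g)
    (hlaw : g.comp (algebraMap LazardTwo R) =
      (baseMap (algebraMap LazardTwo R)).comp LazardTwo.coaction.toRingHom) : LNCoaction R where
  φ := (algHom g).toLinearMap
  counit := RingHom.congr_fun hcounit
  coassoc := RingHom.congr_fun hcoassoc
  map_smul n m := by
    rw [map₂_lsmul_eq_mul, Algebra.smul_def]
    refine (map_mul g _ _).trans ?_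
    exact congrArg (· * g m) (RingHom.congr_fun hlaw n)

theorem ofRingHom_isAlgebra (g : R →+* FaaDiBruno ⊗[ZMod 2] R) (h₁ h₂ h₃) :
    (ofRingHom g h₁ h₂ h₃).IsAlgebra :=
  ⟨map_one g, map_mul g⟩

/-- The coaction as a ring homomorphism. -/
def IsAlgebra.ringHom {c : LNCoaction R} (hc : c.IsAlgebra) : R →+* FaaDiBruno ⊗[ZMod 2] R where
  toFun := c.φ
  map_one' := hc.1
  map_mul' := hc.2
  map_zero' := map_zero c.φ
  map_add' := map_add c.φ

/-- Compatibility with scalars, taken at `1`, forces `φ` on the image of `N_*`, where the coaction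
classifies the conjugate law. -/
theorem IsAlgebra.map_law {c : LNCoaction R} (hc : c.IsAlgebra) :
    (LazardTwo.law R).map hc.ringHom = inducedLaw (LazardTwo.law R) := by
  rw [← LazardTwo.map_baseMap_coaction]
  have h : hc.ringHom.comp (algebraMap LazardTwo R) =
      (baseMap (algebraMap LazardTwo R)).comp LazardTwo.coaction.toRingHom := by
    refine RingHom.ext fun n => ?_
    have h := c.map_smul n 1
    rw [map₂_lsmul_eq_mul, hc.1, mul_one, Algebra.smul_def, mul_one] at h
    exact h
  rw [← h]
  refine FormalGroup.ext ?_
  ext n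
  rfl

/-- Substituting `h⁻¹(t)` for `t` moves the series `h` in the Nishida relations to the side of `E`;
what is left is compatibility with the twisted operations. The condition on the laws is automatic.
-/
theorem IsAlgebra.nishida_iff {c : LNCoaction R} (hc : c.IsAlgebra)
    {𝒟 : DStructure R (LazardTwo.law R)}
    {E : DStructure (FaaDiBruno ⊗[ZMod 2] R) ((LazardTwo.law R).map (incl R))}
    (hE : 𝒟.IsInduced E) : c.Nishida 𝒟 ↔ 𝒟.IsHom hE.twisted hc.ringHom := by
  have hmk (a : R) : (PowerSeries.mk fun i => c.φ (PowerSeries.coeff i (𝒟.D a))) =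
      PowerSeries.map hc.ringHom (𝒟.D a) :=
    PowerSeries.ext fun i => by
      rw [PowerSeries.coeff_mk, PowerSeries.coeff_map]
      rfl
  constructor
  · rintro ⟨E', hE', h⟩
    refine ⟨hc.map_law, fun a => ?_⟩
    have ha := h a
    -- The Nishida relations only provide some induced structure; by uniqueness it has the same
    -- operation as `E`.
    rw [hmk, ← hE.unique (LazardTwo.law_isOrderTwo R) hE'] at ha
    refine Eq.trans ?_ (hE.twisted_D _).symm
    refine Eq.trans ?_ (congrArg (PowerSeries.subst (seriesInv R)) ha).symm
    rw [PowerSeries.subst_comp_subst_apply (PowerSeries.HasSubst.of_constantCoeff_zero'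
      (constantCoeff_seriesOver R)) (hasSubst_inv _),
      PowerSeries.subst_substInvOfIsUnit_right _ (constantCoeff_seriesOver R)]
    exact (PowerSeries.X_subst _).symm
  · intro h
    refine ⟨E, hE, fun a => ?_⟩
    rw [hmk, h.map_D, hE.subst_twisted_D]
    rfl

end algebra

theorem counitMap_comp_coaction :
    (counitMap LazardTwo).comp LazardTwo.coaction.toRingHom = RingHom.id LazardTwo := by
  refine LazardTwo.ringHom_ext ?_
  refine Eq.trans ?_ (inducedLaw_counit LazardTwo.univ)
  rw [← LazardTwo.map_coaction]
  rfl

/-- Homomorphisms out of `N_*` are determined by the law that they classify, and both sides classify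
the twofold conjugate. -/
theorem comulMap_comp_coaction : (comulMap LazardTwo).comp LazardTwo.coaction.toRingHom =
    (baseMap LazardTwo.coaction.toRingHom).comp LazardTwo.coaction.toRingHom := by
  refine LazardTwo.ringHom_ext (A := FaaDiBruno ⊗[ZMod 2] (FaaDiBruno ⊗[ZMod 2] LazardTwo)) ?_
  have h₁ := inducedLaw_comul LazardTwo.univ
  have h₂ := inducedLaw_baseMap LazardTwo.univ LazardTwo.coaction.toRingHom
  rw [LazardTwo.map_coaction, ← h₁, ← LazardTwo.map_coaction] at h₂
  exact h₂.symm

theorem baseMap_algebraMap_self :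
    baseMap (algebraMap LazardTwo LazardTwo) = RingHom.id (FaaDiBruno ⊗[ZMod 2] LazardTwo) := by
  refine tensor_ringHom_ext (fun a => rfl) fun j => ?_
  have h := congrArg (PowerSeries.coeff j)
    (map_baseMap_seriesOver (algebraMap LazardTwo LazardTwo))
  rwa [PowerSeries.coeff_map] at h

/-- The coaction on the Lazard ring. -/
def lazardTwo : LNCoaction LazardTwo :=
  ofRingHom LazardTwo.coaction.toRingHom counitMap_comp_coaction comulMap_comp_coaction (by
    rw [baseMap_algebraMap_self]
    rfl)

end LNCoaction

/-! ### The coaction on the free D-ring -/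

namespace FreeDRing

variable {M : Type u} [AddCommGroup M] [Module LazardTwo M]

/-- Homomorphisms of D-rings from the free D-ring are determined by their values on `M`. -/
theorem ringHom_ext {S : Type u} [CommRing S] [Algebra (ZMod 2) S] {F : FormalGroup S}
    (hF : F.IsOrderTwo) {𝒟 : DStructure S F} {g g' : FreeDRing M →+* S}
    (hg : (str M).IsHom 𝒟 g) (hg' : (str M).IsHom 𝒟 g') (h : ∀ m, g (ι M m) = g' (ι M m)) :
    g = g' := by
  have hl := LazardTwo.lift_eq hF ((law_map g).symm.trans hg.map_law)
  refine (existsUnique_ringHom hF 𝒟 (g.toAddMonoidHom.comp (ι M).toAddMonoidHom)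
    fun n m => ?_).unique ⟨hg, fun m => rfl⟩ ⟨hg', fun m => (h m).symm⟩
  change g (ι M (n • m)) = _
  rw [map_smul, Algebra.smul_def, map_mul]
  exact congrArg (· * g (ι M m)) (RingHom.congr_fun hl n)

variable [Module (ZMod 2) M] [IsScalarTower (ZMod 2) LazardTwo M]

/-- The coaction is the unique homomorphism from `D⟨M⟩` to `B_* ⊗ D⟨M⟩` with its twisted D-structure
that extends `φ` on `M`. All comodule identities follow because homomorphisms of D-rings out of
`D⟨M⟩` are determined on `M`. -/
theorem existsUnique_coaction (c : LNCoaction M) :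
    ∃! c' : LNCoaction (FreeDRing M),
      c.IsComoduleMap c' (ι M) ∧ c'.IsAlgebra ∧ c'.Nishida (str M) := by
  have hF := LazardTwo.law_isOrderTwo (FreeDRing M)
  obtain ⟨E, hE⟩ := exists_isInduced hF (str M)
  -- Inducing from the twisted structure gives the common target of the two sides of
  -- coassociativity.
  obtain ⟨E₂, hE₂⟩ := exists_isInduced (inducedLaw_isOrderTwo hF) hE.twisted
  have hlift := LazardTwo.lift_eq (inducedLaw_isOrderTwo hF)
    (LazardTwo.map_baseMap_coaction (R := FreeDRing M))
  let j := (ι M).restrictScalars (ZMod 2)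
  obtain ⟨g, ⟨hg, hgι⟩, -⟩ := existsUnique_ringHom (inducedLaw_isOrderTwo hF) hE.twisted
    ((j.lTensor FaaDiBruno).comp c.φ).toAddMonoidHom (by
      intro n m
      change j.lTensor FaaDiBruno (c.φ (n • m)) = _ * j.lTensor FaaDiBruno (c.φ m)
      rw [c.map_smul, TensorProduct.lTensor_map₂_lsmul
        (algHom (algebraMap LazardTwo (FreeDRing M))) j (fun n m => by
          change ι M (n • m) = _
          rw [map_smul, Algebra.smul_def]
          rfl)]
      exact congrArg (· * j.lTensor FaaDiBruno (c.φ m)) (RingHom.congr_fun hlift n))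
  have hgι' (m : M) : g (ι M m) = j.lTensor FaaDiBruno (c.φ m) := hgι m
  have hcounit : (counitMap (FreeDRing M)).comp g = RingHom.id _ := by
    refine ringHom_ext hF ((hE.isHom_counitMap hF).comp hg) ⟨?_, fun a => ?_⟩ fun m => ?_
    · refine FormalGroup.ext ?_
      ext n
      rfl
    · ext n
      rfl
    · rw [RingHom.comp_apply, hgι', counitMap_eq, TensorProduct.lid_rTensor_lTensor, c.counit]
      rfl
  have hcoassoc : (comulMap (FreeDRing M)).comp g = (baseMap g).comp g := by
    refine ringHom_ext (inducedLaw_isOrderTwo (inducedLaw_isOrderTwo hF))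
      ((hE.isHom_comulMap hF hE₂).comp hg)
      ((hE.isHom_baseMap (inducedLaw_isOrderTwo hF) hE₂ hg).comp hg) fun m => ?_
    rw [RingHom.comp_apply, RingHom.comp_apply, hgι', comulMap_eq,
      TensorProduct.assoc_rTensor_lTensor, c.coassoc, baseMap_eq_lTensor]
    exact (TensorProduct.lTensor_lTensor_of_comp j (algHom g).toLinearMap c.φ
      (j.lTensor FaaDiBruno) hgι' (c.φ m)).symm
  have hlaw : g.comp (algebraMap LazardTwo (FreeDRing M)) =
      (baseMap (algebraMap LazardTwo (FreeDRing M))).comp LazardTwo.coaction.toRingHom := by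
    refine LazardTwo.ringHom_ext ?_
    rw [← law_map, hg.map_law, LazardTwo.map_baseMap_coaction]
  refine ⟨.ofRingHom g hcounit hcoassoc hlaw, ⟨hgι', LNCoaction.ofRingHom_isAlgebra _ _ _ _,
    ((LNCoaction.ofRingHom_isAlgebra g hcounit hcoassoc hlaw).nishida_iff hE).mpr hg⟩, ?_⟩
  -- By the Nishida relations a competing coaction is also a homomorphism into the twisted
  -- structure, with the same values on `M`.
  rintro c' ⟨hι, hc', hN⟩
  have h : hc'.ringHom = g := ringHom_ext (inducedLaw_isOrderTwo hF) ((hc'.nishida_iff hE).mp hN)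
    hg fun m => (hι m).trans (hgι' m).symm
  exact LNCoaction.ext (LinearMap.ext (RingHom.congr_fun h))

/-- The D-ring `D⟨x⟩` is `D⟨N_*⟩` with `x` the image of `1`. As `N_*` is generated by `1`,
compatibility with scalars reduces the comodule condition to the value at `x`. -/
theorem isComoduleMap_lazardTwo_iff (c : LNCoaction (FreeDRing LazardTwo)) :
    LNCoaction.lazardTwo.IsComoduleMap c (ι LazardTwo) ↔
      c.φ (ι LazardTwo 1) = 1 ⊗ₜ ι LazardTwo 1 := by
  let j := (ι LazardTwo).restrictScalars (ZMod 2)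
  have hone : LNCoaction.lazardTwo.φ 1 = 1 ⊗ₜ 1 := by
    change LazardTwo.coaction 1 = _
    rw [map_one]
    rfl
  refine ⟨fun h => ?_, fun h n => ?_⟩
  · rw [h 1, hone]
    rfl
  · have h₁ := c.map_smul n (ι LazardTwo 1)
    have h₂ := TensorProduct.lTensor_map₂_lsmul (B := FaaDiBruno)
      (algHom (algebraMap LazardTwo (FreeDRing LazardTwo))) j (fun n m => by
          change ι LazardTwo (n • m) = _
          rw [map_smul, Algebra.smul_def]
          rfl) (LazardTwo.coaction n) (1 ⊗ₜ 1)
    have h₃ := LNCoaction.lazardTwo.map_smul n 1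
    rw [hone] at h₃
    rw [← h₃, smul_eq_mul, mul_one] at h₂
    rw [← map_smul, smul_eq_mul, mul_one, LNCoaction.map₂_lsmul_eq_mul, h] at h₁
    exact h₁.trans h₂.symm

end FreeDRing

end

theorem theorem3 :
    (∀ (M : Type u) [AddCommGroup M] [Module (ZMod 2) M] [Module LazardTwo M]
        [IsScalarTower (ZMod 2) LazardTwo M] (c : LNCoaction M),
      ∃! c' : LNCoaction (FreeDRing M),
        c.IsComoduleMap c' (FreeDRing.ι M) ∧ c'.IsAlgebra ∧ c'.Nishida (FreeDRing.str M)) ∧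
    (∃! c' : LNCoaction (FreeDRing LazardTwo),
      c'.φ (FreeDRing.ι LazardTwo 1) = 1 ⊗ₜ FreeDRing.ι LazardTwo 1 ∧
        c'.IsAlgebra ∧ c'.Nishida (FreeDRing.str LazardTwo)) := by
  refine ⟨fun M _ _ _ _ c => FreeDRing.existsUnique_coaction c, ?_⟩
  have h := FreeDRing.existsUnique_coaction LNCoaction.lazardTwo
  simpa only [FreeDRing.isComoduleMap_lazardTwo_iff] using h
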